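/- **Theorem 3.1 (Lee).** Let $D$ be an (unoriented) alternating knot diagram with finitely many crossings, numbered $1,\dots,n$; a diagram without crossings (one circle) is allowed. *Alternating* means that one alternately over- and undercrosses other strands as one goes along the knot. *Conventions.* Smoothing a crossing means replacing it by its $0$-smoothing (the one connecting the two regions swept out when the over-strand is rotated counterclockwise until it reaches the under-strand) or by its $1$-smoothing (the other one). A Kauffman state $S$ of $D$ is the result of smoothing all crossings; $r(D,S)$ is the number of $1$-smoothings in $S$. Let $\mathcal A$ be the free $\mathbb Z$-module on $v_+,v_-$ of degrees $+1,-1$, with $$m(v_+\otimes v_+)=v_+,\quad m(v_+\otimes v_-)=m(v_-\otimes v_+)=v_-,\quad m(v_-\otimes v_-)=0,$$ $$\Delta(v_+)=v_+\otimes v_-+v_-\otimes v_+,\quad \Delta(v_-)=v_-\otimes v_-.$$ The Khovanov complex is $\mathcal C(D)=\bigoplus_S\mathcal A^{\otimes\{\text{circles of }S\}}$, where an element of degree $k$ in the summand of $S$ has bidegree $(i,j)=(r(D,S),\,k+r(D,S))$. Its differential, of bidegree $(1,0)$, is the sum, over all ways to change one $0$-smoothing of $S$ to a $1$-smoothing,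 of the maps induced by $m$ (if two circles merge) or $\Delta$ (if a circle splits), with the sign $(-1)^{e}$, where $e$ is the number of $1$-smoothings of $S$ at crossings preceding the changed one. Let $\mathcal H(D)^{i,j}$ be its homology over $\mathbb Z$ in bidegree $(i,j)\in\mathbb Z^2$ (no shift by an orientation or writhe is applied). *Claim.* $D$ has at least one Kauffman state consisting of exactly one circle, and all such states have the same number of $1$-smoothings, denoted $n_1(D)$. For all integers $i,j$: 1. $\mathcal H(D)^{i,j}=0$ unless $j=2i-n_1(D)+1$ or $j=2i-n_1(D)-1$; 2. $\mathcal H(D)^{i,j}$ is torsion-free unless $j=2i-n_1(D)-1$. -/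

import Mathlib

/-- The orbits on `X` of the group generated by a set of permutations of `X`. -/
def PermOrbits {X : Type} (S : Set (Equiv.Perm X)) : Type :=
  MulAction.orbitRel.Quotient (Subgroup.closure S) X

noncomputable instance {X : Type} [Finite X] (S : Set (Equiv.Perm X)) : Fintype (PermOrbits S) :=
  haveI : Finite (PermOrbits S) :=
    inferInstanceAs (Finite (MulAction.orbitRel.Quotient (Subgroup.closure S) X))
  Fintype.ofFinite _

/-- The ends of edges at the `n` crossings of a diagram. The dart `(c, k)` is the `k`-th of the four
edge ends at the crossing `c`; the ends `0, 1, 2, 3` are listed in counterclockwise order,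
the ends `0, 2` belong to the under-strand and the ends `1, 3` to the over-strand. -/
abbrev Dart (n : ℕ) : Type := Fin n × Fin 4

/-- The permutation of the darts turning by one step counterclockwise about each crossing. -/
def dartRotate (n : ℕ) : Equiv.Perm (Dart n) :=
  Equiv.prodCongrRight fun _ => Equiv.addRight 1

/-- The permutation of the darts passing straight through each crossing. -/
def dartOpposite (n : ℕ) : Equiv.Perm (Dart n) :=
  Equiv.prodCongrRight fun _ => Equiv.addRight 2

/-- A link diagram (unoriented, with `n` numbered crossings), given as a planar diagram code,
i.e. a four-valent combinatorial map of genus zero with over/under information at its vertices: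
`edge` sends an end of an edge to the other end of the same edge, and `loops` is the number of
components of the diagram which are circles without crossings. The vertices of the map are the
crossings, its `2n` edges are the cycles of `edge`, its faces are the cycles of
`dartRotate n * edge`; each connected component has Euler characteristic `2`, that is
`n - 2n + #faces = 2 * #(connected components)`. -/
structure LinkDiagram (n : ℕ) where
  edge : Equiv.Perm (Dart n)
  edge_edge : ∀ d, edge (edge d) = d
  edge_ne : ∀ d, edge d ≠ d
  loops : ℕ
  planar : Nat.card (PermOrbits {dartRotate n * edge}) =
    n + 2 * Nat.card (PermOrbits {dartRotate n, edge})

/-- A choice of smoothing for each of `n` crossings: `false` is the `0`-smoothing and `true` the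
`1`-smoothing. -/
abbrev KauffmanState (n : ℕ) : Type := Fin n → Bool

/-- The number of `1`-smoothings in a Kauffman state. -/
def KauffmanState.oneCount {n : ℕ} (s : KauffmanState n) : ℕ :=
  (Finset.univ.filter fun c => s c = true).card

/-- The two arcs replacing a crossing: the `0`-smoothing joins the ends `0, 1` and the ends `2, 3`
(it connects the two regions swept out when the over-strand is turned counterclockwise);
the `1`-smoothing joins the ends `1, 2` and the ends `3, 0`. -/
def smoothingArcs : Bool → Equiv.Perm (Fin 4)
  | false => Equiv.swap 0 1 * Equiv.swap 2 3
  | true => Equiv.swap 1 2 * Equiv.swap 3 0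

/-- The involution of the darts given by the smoothing arcs of a Kauffman state. -/
def KauffmanState.arcs {n : ℕ} (s : KauffmanState n) : Equiv.Perm (Dart n) :=
  Equiv.prodCongrRight fun c => smoothingArcs (s c)

/-- The matrix coefficient of `v_z` in `m (v_x ⊗ v_y)` for the multiplication `m` of the free
module with basis `v_1, v_{-1}`:
`v_1 v_1 = v_1`, `v_1 v_{-1} = v_{-1} v_1 = v_{-1}`, `v_{-1} v_{-1} = 0`. -/
def mulCoeff (x y z : ℤˣ) : ℤ :=
  if (x = 1 ∧ z = y) ∨ (y = 1 ∧ z = x) then 1 else 0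

/-- The matrix coefficient of `v_x ⊗ v_y` in `Δ v_z` for the comultiplication `Δ`:
`Δ v_1 = v_1 ⊗ v_{-1} + v_{-1} ⊗ v_1`, `Δ v_{-1} = v_{-1} ⊗ v_{-1}`. -/
def comulCoeff (z x y : ℤˣ) : ℤ :=
  if (x = -1 ∧ y = z) ∨ (y = -1 ∧ x = z) then 1 else 0

namespace LinkDiagram

variable {n : ℕ} (D : LinkDiagram n)

/-- The diagram has exactly one component. The components are the orbits of the darts under moving
along an edge and passing straight through a crossing, and the circles without crossings. -/
def IsKnot : Prop :=
  Nat.card (PermOrbits {D.edge, dartOpposite n}) + D.loops = 1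

/-- Each edge has one end on an over-strand and the other on an under-strand; that is, over- and
undercrossings alternate along the diagram. -/
def IsAlternating : Prop :=
  ∀ d : Dart n, (((D.edge d).2 = 1 ∨ (D.edge d).2 = 3) ↔ (d.2 = 0 ∨ d.2 = 2))

/-- The circles of a Kauffman state. -/
abbrev Circle (s : KauffmanState n) : Type :=
  PermOrbits {D.edge, s.arcs} ⊕ Fin D.loops

/-- The circle of a Kauffman state passing through a given dart. -/
def circleAt (s : KauffmanState n) (d : Dart n) : D.Circle s :=
  Sum.inl (Quotient.mk (MulAction.orbitRel (Subgroup.closure {D.edge, s.arcs}) (Dart n)) d)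

/-- The Kauffman states consisting of exactly one circle. -/
def oneCircleStates : Set (KauffmanState n) :=
  {s | Nat.card (D.Circle s) = 1}

/-- The standard basis of `⨁ₛ A^{⊗ (circles of s)}`: a Kauffman state `s` together with a basis
vector `v_1` or `v_{-1}` of `A` for each circle of `s`. -/
abbrev EnhancedState : Type := Σ s : KauffmanState n, (D.Circle s → ℤˣ)

/-- The primary degree of a basis element, the number of `1`-smoothings. -/
def primaryDegree (x : D.EnhancedState) : ℤ := (x.1.oneCount : ℤ)

/-- The secondary degree of a basis element: `v_1` has degree `1`, `v_{-1}` has degree `-1`,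
degrees add under tensor multiplication and are shifted by the number of `1`-smoothings. -/
noncomputable def secondaryDegree (x : D.EnhancedState) : ℤ :=
  (∑ a : D.Circle x.1, (x.2 a : ℤ)) + (x.1.oneCount : ℤ)

open scoped Classical in
/-- The matrix coefficient, from the basis element `x` to the basis element `y`, of the map induced
by changing the smoothing at the crossing `c` from `0` to `1`: multiplication if two circles merge,
comultiplication if a circle splits, and the identity on the circles not meeting `c`.
(It is used only for `x`, `y` whose states differ exactly in this way.) -/
noncomputable def surgeryCoeff (c : Fin n) (x y : D.EnhancedState) : ℤ :=
  let a := D.circleAt x.1 (c, 0)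
  let b := D.circleAt x.1 (c, 2)
  let a' := D.circleAt y.1 (c, 0)
  let b' := D.circleAt y.1 (c, 2)
  if (∀ d, D.circleAt x.1 d ≠ a → D.circleAt x.1 d ≠ b →
        x.2 (D.circleAt x.1 d) = y.2 (D.circleAt y.1 d)) ∧
      (∀ k : Fin D.loops, x.2 (Sum.inr k) = y.2 (Sum.inr k)) then
    if a ≠ b ∧ a' = b' then mulCoeff (x.2 a) (x.2 b) (y.2 a')
    else if a = b ∧ a' ≠ b' then comulCoeff (x.2 a) (y.2 a') (y.2 b')
    else 0
  else 0

open scoped Classical in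
/-- The matrix coefficient of the Khovanov differential from `x` to `y`: the signed sum of the maps
induced by changing one `0`-smoothing to a `1`-smoothing, where the sign at the crossing `c` is
`-1` to the number of `1`-smoothings at crossings preceding `c`. -/
noncomputable def diffCoeff (x y : D.EnhancedState) : ℤ :=
  ∑ c : Fin n, if x.1 c = false ∧ y.1 = Function.update x.1 c true then
    (-1) ^ (Finset.univ.filter fun c' => c' < c ∧ x.1 c' = true).card * D.surgeryCoeff c x y
  else 0

/-- The basis elements of bidegree `(i, j)`. -/
abbrev Generator (i j : ℤ) : Type :=
  {x : D.EnhancedState // D.primaryDegree x = i ∧ D.secondaryDegree x = j}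

noncomputable instance (i j : ℤ) : Fintype (D.Generator i j) := Fintype.ofFinite _

/-- The component of bidegree `(i, j)` of the Khovanov complex: the free `ℤ`-module on the basis
elements of that bidegree. -/
abbrev Chain (i j : ℤ) : Type := D.Generator i j → ℤ

/-- The Khovanov differential from bidegree `(i, j)` to bidegree `(i', j)`; only `i' = i + 1` is of
interest, and the map is zero otherwise. -/
noncomputable def differential (i i' j : ℤ) : D.Chain i j →ₗ[ℤ] D.Chain i' j :=
  Matrix.mulVecLin (Matrix.of fun y x => D.diffCoeff x.1 y.1)

/-- The Khovanov homology in bidegree `(i, j)`: cycles modulo boundaries. -/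
abbrev Homology (i j : ℤ) : Type :=
  LinearMap.ker (D.differential i (i + 1) j) ⧸
    (LinearMap.range (D.differential (i - 1) i j)).submoduleOf
      (LinearMap.ker (D.differential i (i + 1) j))

end LinkDiagram

/-! ### Orbits of permutations -/

/-! The circles of the all-`0` state are the vertices, and the crossings the edges, of a
checkerboard graph; a Kauffman state is the subgraph formed by its `1`-smoothings. Alternation makes
the faces of the diagram exactly the circles of the two extreme states (`card_face`), so Euler's
formula gives `card_circle_add`. The quantity `excess` never decreases when a `0`-smoothing becomes
a `1`-smoothing, and it agrees at the two extremes, so it is constant (`excess_eq`): no state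
produces genus. Hence one-circle states are spanning trees (`mem_oneCircleStates_iff`). They all
have the same number of edges, which is `n₁`, and they satisfy basis exchange.

Fix a base point `b` and write `X` for multiplication by `v_{-1}` at its circle. The kernel of `X`
is the reduced complex. Its homology is shown to lie on one diagonal, for every subcube of states
containing a spanning tree and over every coefficient ring (`reducedThin`), by induction on the
number of free crossings. Following the circle of a spanning tree from `b`, let `c` be the first
free crossing met. If both smoothings at `c` extend to spanning trees in the subcube, both halves
are thin and so is their cone. If only one smoothing does, basis exchange shows that surgery at `c`
always splits, or always merges, and it involves the circle through `b` by the choice of `c`.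
Writing `C` for the reduced chains on the side with the single circle and `A` for the Frobenius
algebra, splitting and merging then form an exact sequence 0 → C → C ⊗ A → C → 0. So the cone has,
up to a shift along the diagonal, the homology of the half containing a spanning tree.

The sequence 0 → ker `X` → full complex → ker `X` → 0 given by `X` yields the two diagonals
(`exists_partialDiff_eq`). For torsion on the upper diagonal, suppose m·x = dy. Then y is a cycle
modulo m in a bidegree off both diagonals, hence a boundary modulo m. Thus y = dΨ + m·v and x = dv
(`mem_range_differential_of_smul`). -/

theorem orbitRel_closure_le {X : Type} {S : Set (Equiv.Perm X)} {E : Setoid X}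
    (h : ∀ g ∈ S, ∀ x, E (g x) x) : MulAction.orbitRel (Subgroup.closure S) X ≤ E := by
  rintro x y ⟨⟨g, hg⟩, rfl⟩
  change E (g y) y
  induction hg using Subgroup.closure_induction generalizing y with
  | mem g hg => exact h g hg y
  | one => exact E.refl y
  | mul a b _ _ iha ihb => exact E.iseqv.trans (@iha (b y)) (@ihb y)
  | inv a _ ih => simpa using E.symm (@ih (a⁻¹ y))

theorem orbitRel_closure_apply {X : Type} {S : Set (Equiv.Perm X)} {g : Equiv.Perm X} (hg : g ∈ S)
    (x : X) : MulAction.orbitRel (Subgroup.closure S) X (g x) x :=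
  ⟨⟨g, Subgroup.subset_closure hg⟩, rfl⟩

namespace Equiv.Perm

variable {X : Type}

/-- Two walks coincide as long as the permutations agree along the first of them. This is used for a
walk that has not yet met a transposition, and for a circle that has not yet met a free crossing. -/
theorem pow_eq_of_forall_lt {f g : Perm X} {x : X} {k : ℕ}
    (h : ∀ i < k, f ((f ^ i) x) = g ((f ^ i) x)) : ∀ i ≤ k, (g ^ i) x = (f ^ i) x := by
  intro i
  induction i with
  | zero => simp
  | succ i ih =>
    intro hi
    rw [pow_succ', pow_succ', mul_apply, mul_apply, ih (by omega), h i (by omega)]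

theorem sameCycle_exists_lt_of_pow_eq [Finite X] {f : Perm X} {x y : X} {k : ℕ} (hk : 0 < k)
    (h : (f ^ k) x = x) (hxy : SameCycle f x y) : ∃ i < k, (f ^ i) x = y := by
  obtain ⟨m, rfl⟩ := hxy.exists_nat_pow_eq
  refine ⟨m % k, Nat.mod_lt _ hk, ?_⟩
  conv_rhs => rw [← Nat.mod_add_div m k, pow_add, mul_apply, pow_mul]
  congr 1
  exact (pow_apply_eq_self_of_apply_eq_self h _).symm

/-- Multiplying by the transposition of `x` and `y` joins the cycles of `x` and `y` if they are
different and separates `x` from `y` otherwise. -/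
theorem sameCycle_swap_mul_iff [Finite X] [DecidableEq X] (f : Perm X) {x y : X} (hxy : x ≠ y) :
    SameCycle (swap x y * f) x y ↔ ¬ SameCycle f x y := by
  -- If the walk from `x` closes up before meeting `y`, then `y` lies on another cycle, and the swap
  -- redirects the closing step to `y`.
  have key : ∀ f : Perm X, ∀ k, 0 < k → (∀ i, 0 < i → i < k → (f ^ i) x ≠ x ∧ (f ^ i) x ≠ y) →
      (f ^ k) x = x → SameCycle (swap x y * f) x y ∧ ¬ SameCycle f x y := by
    intro f k hk hmin hx
    refine ⟨⟨k, ?_⟩, fun h => ?_⟩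
    · obtain ⟨j, rfl⟩ : ∃ j, k = j + 1 := ⟨k - 1, by omega⟩
      have h1 : ((swap x y * f) ^ j) x = (f ^ j) x := by
        refine pow_eq_of_forall_lt (k := j) (fun i hi => ?_) j le_rfl
        have := hmin (i + 1) (by omega) (by omega)
        rw [pow_succ', mul_apply] at this
        rw [mul_apply, swap_apply_of_ne_of_ne this.1 this.2]
      rw [zpow_natCast, pow_succ', mul_apply, h1, mul_apply, ← mul_apply f, ← pow_succ', hx,
        swap_apply_left]
    · obtain ⟨i, hi, h⟩ := sameCycle_exists_lt_of_pow_eq hk hx h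
      rcases Nat.eq_zero_or_pos i with rfl | h0
      · exact hxy h
      · exact (hmin i h0 hi).2 h
  have hex : ∃ k, 0 < k ∧ ((f ^ k) x = x ∨ (f ^ k) x = y) :=
    ⟨orderOf f, orderOf_pos f, Or.inl (by simp [pow_orderOf_eq_one])⟩
  classical
  obtain ⟨hk, hk'⟩ := Nat.find_spec hex
  have hmin : ∀ i, 0 < i → i < Nat.find hex → (f ^ i) x ≠ x ∧ (f ^ i) x ≠ y := by
    intro i h0 hi
    have := Nat.find_min hex hi
    tauto
  generalize Nat.find hex = k at *
  rcases hk' with hx | hy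
  · have := key f k hk hmin hx
    tauto
  -- The walk meets `y` first. Then the walk of `swap x y * f` closes up at `x` at that time, so
  -- `key` applies to it; multiplying by the swap again gives back `f`.
  · obtain ⟨j, rfl⟩ : ∃ j, k = j + 1 := ⟨k - 1, by omega⟩
    have hp : ∀ i ≤ j, ((swap x y * f) ^ i) x = (f ^ i) x := by
      refine pow_eq_of_forall_lt (fun i hi => ?_)
      have := hmin (i + 1) (by omega) (by omega)
      rw [pow_succ', mul_apply] at this
      rw [mul_apply, swap_apply_of_ne_of_ne this.1 this.2]
    have := key (swap x y * f) (j + 1) hk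
      (fun i h0 hi => by rw [hp i (by omega)]; exact hmin i h0 hi)
      (by rw [pow_succ', mul_apply, hp j le_rfl, mul_apply, ← mul_apply f, ← pow_succ', hy,
        swap_apply_right])
    rw [← mul_assoc, swap_mul_self, one_mul] at this
    exact ⟨fun h => absurd h this.2, fun h => absurd this.1 h⟩

end Equiv.Perm

/-! ### Joining two classes of an equivalence relation -/

namespace Setoid

/-- The equivalence relation obtained from `E` by joining the classes of `p` and `q`. -/
def glue {X : Type*} (E : Setoid X) (p q : X) : Setoid X where
  r x y := E x y ∨ (E x p ∧ E y q) ∨ (E x q ∧ E y p)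
  iseqv :=
    { refl := fun x => Or.inl (E.refl x)
      symm := by
        rintro x y (h | ⟨h, h'⟩ | ⟨h, h'⟩)
        exacts [Or.inl (E.symm h), Or.inr (Or.inr ⟨h', h⟩), Or.inr (Or.inl ⟨h', h⟩)]
      trans := by
        rintro x y z (h | ⟨h, h'⟩ | ⟨h, h'⟩) (k | ⟨k, k'⟩ | ⟨k, k'⟩)
        · exact Or.inl (E.trans h k)
        · exact Or.inr (Or.inl ⟨E.trans h k, k'⟩)
        · exact Or.inr (Or.inr ⟨E.trans h k, k'⟩)
        · exact Or.inr (Or.inl ⟨h, E.trans (E.symm k) h'⟩)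
        · exact Or.inl (E.trans h (E.trans (E.symm (E.trans (E.symm h') k)) (E.symm k')))
        · exact Or.inl (E.trans h (E.symm k'))
        · exact Or.inr (Or.inr ⟨h, E.trans (E.symm k) h'⟩)
        · exact Or.inl (E.trans h (E.symm k'))
        · exact Or.inl (E.trans h (E.trans (E.symm (E.trans (E.symm h') k)) (E.symm k'))) }

variable {X : Type*} {E F : Setoid X} {p q x y : X}

theorem glue_rel : glue E p q x y ↔ E x y ∨ (E x p ∧ E y q) ∨ (E x q ∧ E y p) := Iff.rfl

theorem le_glue : E ≤ glue E p q := fun _ _ h => Or.inl h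

theorem glue_pair : glue E p q p q := Or.inr (Or.inl ⟨E.refl p, E.refl q⟩)

theorem glue_le_iff : glue E p q ≤ F ↔ E ≤ F ∧ F p q := by
  refine ⟨fun h => ⟨le_glue.trans h, h glue_pair⟩, ?_⟩
  rintro ⟨h, h'⟩ x y (k | ⟨k, k'⟩ | ⟨k, k'⟩)
  · exact h k
  · exact F.trans (h k) (F.trans h' (F.symm (h k')))
  · exact F.trans (h k) (F.trans (F.symm h') (F.symm (h k')))

theorem glue_eq_self (h : E p q) : glue E p q = E :=
  le_antisymm (glue_le_iff.2 ⟨le_rfl, h⟩) le_glue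

theorem glue_mono (h : E ≤ F) : glue E p q ≤ glue F p q :=
  glue_le_iff.2 ⟨h.trans le_glue, glue_pair⟩

end Setoid

/-- A sum over the classes of `glue E p q` compared with a sum over the classes of `E`. -/
theorem sum_glue {P A B : Type*} [Fintype A] [Fintype B] {α : P → A} {β : P → B}
    (hα : Function.Surjective α) (hβ : Function.Surjective β) {p q : P} (hpq : α p ≠ α q)
    (h : Setoid.ker β = Setoid.glue (Setoid.ker α) p q) (fA : A → ℤ) (fB : B → ℤ)
    (hf : ∀ z, α z ≠ α p → α z ≠ α q → fA (α z) = fB (β z)) :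
    ∑ x, fB x + fA (α p) + fA (α q) = ∑ x, fA x + fB (β p) := by
  classical
  have hr : ∀ z w, β z = β w ↔ α z = α w ∨ (α z = α p ∧ α w = α q) ∨ (α z = α q ∧ α w = α p) := by
    intro z w
    have : Setoid.ker β z w ↔ Setoid.glue (Setoid.ker α) p q z w := by rw [h]
    simpa only [Setoid.glue_rel, Setoid.ker_def] using this
  have e1 : ∑ x, fB x = fB (β p) + ∑ x ∈ Finset.univ.erase (β p), fB x :=
    (Finset.add_sum_erase _ _ (Finset.mem_univ _)).symm
  have e2 : ∑ x, fA x = fA (α p) + (fA (α q) + ∑ x ∈ (Finset.univ.erase (α p)).erase (α q), fA x) := by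
    rw [Finset.add_sum_erase _ _ (by simp [hpq.symm]), Finset.add_sum_erase _ _ (Finset.mem_univ _)]
  have e3 : ∑ x ∈ (Finset.univ.erase (α p)).erase (α q), fA x
      = ∑ x ∈ Finset.univ.erase (β p), fB x := by
    -- The classes other than those of `p` and `q` are not affected by gluing.
    refine Finset.sum_bij (fun x _ => β (Function.surjInv hα x)) ?_ ?_ ?_ ?_
    · intro x hx
      simp only [Finset.mem_erase, Finset.mem_univ, and_true] at hx ⊢
      rw [Ne, hr, Function.surjInv_eq hα]
      tauto
    · intro x hx x' hx' hxx
      simp only [Finset.mem_erase, Finset.mem_univ, and_true] at hx hx'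
      rw [hr, Function.surjInv_eq hα, Function.surjInv_eq hα] at hxx
      tauto
    · intro y hy
      obtain ⟨z, rfl⟩ := hβ y
      simp only [Finset.mem_erase, Finset.mem_univ, and_true, Ne, hr] at hy
      refine ⟨α z, ?_, ?_⟩
      · simp only [Finset.mem_erase, Finset.mem_univ, and_true]
        tauto
      · rw [hr, Function.surjInv_eq hα]
        exact Or.inl rfl
    · intro x hx
      obtain ⟨z, rfl⟩ := hα x
      simp only [Finset.mem_erase, Finset.mem_univ, and_true] at hx
      rw [hf z hx.2 hx.1]
      congr 1
      rw [hr, Function.surjInv_eq hα]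
      exact Or.inl rfl
  rw [e1, e2, e3]
  ring

theorem card_glue {P A B : Type*} [Finite A] [Finite B] {α : P → A} {β : P → B}
    (hα : Function.Surjective α) (hβ : Function.Surjective β) {p q : P} (hpq : α p ≠ α q)
    (h : Setoid.ker β = Setoid.glue (Setoid.ker α) p q) : Nat.card B + 1 = Nat.card A := by
  have := Fintype.ofFinite A
  have := Fintype.ofFinite B
  have := sum_glue hα hβ hpq h (fun _ => 1) (fun _ => 1) (fun _ _ _ => rfl)
  simp only [Finset.sum_const, Finset.card_univ, mul_one, nsmul_eq_mul] at this
  rw [Nat.card_eq_fintype_card, Nat.card_eq_fintype_card]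
  omega

/-! ### Circles of Kauffman states -/

/-- The state obtained by changing the smoothing at one crossing. -/
def KauffmanState.flip {n : ℕ} (s : KauffmanState n) (c : Fin n) : KauffmanState n :=
  Function.update s c (!s c)

namespace KauffmanState

variable {n : ℕ} (s : KauffmanState n) {c c' : Fin n}

theorem flip_apply_self : s.flip c c = !s c := by simp [flip]

theorem flip_apply_of_ne (h : c' ≠ c) : s.flip c c' = s c' := by simp [flip, h]

theorem flip_flip : (s.flip c).flip c = s := by simp [flip]

theorem flip_comm : (s.flip c).flip c' = (s.flip c').flip c := by
  by_cases h : c = c'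
  · rw [h]
  · simp [flip, Function.update_of_ne h, Function.update_of_ne (Ne.symm h),
      Function.update_comm h]

theorem arcs_apply (d : Dart n) : s.arcs d = (d.1, smoothingArcs (s d.1) d.2) := rfl

theorem arcs_arcs (d : Dart n) : s.arcs (s.arcs d) = d := by
  have : ∀ b k, smoothingArcs b (smoothingArcs b k) = k := by decide
  simp [arcs_apply, this]

end KauffmanState

/-- A dart belonging to the under-strand of its crossing. -/
def Dart.IsUnder {n : ℕ} (d : Dart n) : Prop := d.2 = 0 ∨ d.2 = 2

instance {n : ℕ} (d : Dart n) : Decidable d.IsUnder := inferInstanceAs (Decidable (_ ∨ _))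

theorem Dart.IsUnder.eq {n : ℕ} {d : Dart n} (h : d.IsUnder) : d = (d.1, 0) ∨ d = (d.1, 2) := by
  rcases h with h | h
  exacts [Or.inl (Prod.ext rfl h), Or.inr (Prod.ext rfl h)]

theorem Dart.isUnder_arcs {n : ℕ} (s : KauffmanState n) (d : Dart n) :
    Dart.IsUnder (s.arcs d) ↔ ¬ d.IsUnder := by
  have : ∀ b k, (smoothingArcs b k = 0 ∨ smoothingArcs b k = 2) ↔ ¬ (k = 0 ∨ k = 2) := by decide
  exact this _ _

/-- The `0`-smoothing pairs each under-end with its counterclockwise neighbour, the `1`-smoothing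
each over-end with its own. This is what relates faces to the two constant states. -/
theorem Dart.rotate_of_isUnder {n : ℕ} {d : Dart n} (h : d.IsUnder) :
    dartRotate n d = KauffmanState.arcs (fun _ => false) d := by
  have : ∀ k : Fin 4, (k = 0 ∨ k = 2) → k + 1 = smoothingArcs false k := by decide
  exact Prod.ext rfl (this _ h)

theorem Dart.rotate_of_not_isUnder {n : ℕ} {d : Dart n} (h : ¬ d.IsUnder) :
    dartRotate n d = KauffmanState.arcs (fun _ => true) d := by
  have : ∀ k : Fin 4, ¬ (k = 0 ∨ k = 2) → k + 1 = smoothingArcs true k := by decide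
  exact Prod.ext rfl (this _ h)

namespace LinkDiagram

variable {n : ℕ} (D : LinkDiagram n)

/-- Points of a diagram meeting all circles of all states: the darts and the circles without
crossings. -/
abbrev Point : Type := Dart n ⊕ Fin D.loops

/-- The circle of a state passing through a point. -/
def pt (s : KauffmanState n) : D.Point → D.Circle s
  | Sum.inl d => D.circleAt s d
  | Sum.inr k => Sum.inr k

theorem pt_surjective (s : KauffmanState n) : Function.Surjective (D.pt s) := by
  rintro (⟨⟨d⟩⟩ | k)
  exacts [⟨Sum.inl d, rfl⟩, ⟨Sum.inr k, rfl⟩]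

/-- Lying on the same circle of a state. -/
def circ (s : KauffmanState n) : Setoid D.Point := Setoid.ker (D.pt s)

/-- One of the ends of the under-strand at a crossing. -/
def fst (c : Fin n) : D.Point := Sum.inl (c, 0)

/-- The other end of the under-strand at a crossing. -/
def snd (c : Fin n) : D.Point := Sum.inl (c, 2)

theorem circleAt_eq_iff {s : KauffmanState n} {d d' : Dart n} :
    D.circleAt s d = D.circleAt s d' ↔
      MulAction.orbitRel (Subgroup.closure {D.edge, s.arcs}) (Dart n) d d' :=
  Sum.inl_injective.eq_iff.trans Quotient.eq

theorem circleAt_edge (s : KauffmanState n) (d : Dart n) :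
    D.circleAt s (D.edge d) = D.circleAt s d :=
  D.circleAt_eq_iff.2 (orbitRel_closure_apply (by simp) d)

theorem circleAt_arcs (s : KauffmanState n) (d : Dart n) :
    D.circleAt s (s.arcs d) = D.circleAt s d :=
  D.circleAt_eq_iff.2 (orbitRel_closure_apply (by simp) d)

/-- The universal property of `circ`. -/
theorem circ_le {s : KauffmanState n} {E : Setoid D.Point}
    (h₁ : ∀ d, E (Sum.inl (D.edge d)) (Sum.inl d)) (h₂ : ∀ d, E (Sum.inl (s.arcs d)) (Sum.inl d)) :
    D.circ s ≤ E := by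
  rintro (d | k) (d' | k') h
  · have : MulAction.orbitRel (Subgroup.closure {D.edge, s.arcs}) (Dart n) ≤
        Setoid.comap Sum.inl E := by
      refine orbitRel_closure_le ?_
      rintro g (rfl | rfl) x
      exacts [h₁ x, h₂ x]
    exact this (D.circleAt_eq_iff.1 h)
  · exact absurd h Sum.inl_ne_inr
  · exact absurd h Sum.inr_ne_inl
  · rw [Sum.inr_injective (show (Sum.inr k : D.Circle s) = Sum.inr k' from h)]

/-- Either smoothing pairs under-ends with over-ends, so the two under-ends represent the two arcs
at a crossing in every state. -/
theorem circ_fst_or_snd (s : KauffmanState n) (c : Fin n) (k : Fin 4) :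
    D.circ s (Sum.inl (c, k)) (D.fst c) ∨ D.circ s (Sum.inl (c, k)) (D.snd c) := by
  have key : ∀ b k, k = 0 ∨ k = 2 ∨ smoothingArcs b k = 0 ∨ smoothingArcs b k = 2 := by decide
  rcases key (s c) k with rfl | rfl | h | h
  · exact Or.inl rfl
  · exact Or.inr rfl
  · have := D.circleAt_arcs s (c, k)
    rw [KauffmanState.arcs_apply, h] at this
    exact Or.inl this.symm
  · have := D.circleAt_arcs s (c, k)
    rw [KauffmanState.arcs_apply, h] at this
    exact Or.inr this.symm

/-- Only arcs at `c` change, and all four ends at `c` fall into one class once `fst c` and `snd c`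
are glued. -/
theorem circ_flip_le (s : KauffmanState n) (c : Fin n) :
    D.circ (s.flip c) ≤ Setoid.glue (D.circ s) (D.fst c) (D.snd c) := by
  refine D.circ_le (fun d => Setoid.le_glue (D.circleAt_edge s d)) ?_
  rintro ⟨c', k⟩
  by_cases hc : c' = c
  · subst hc
    rcases D.circ_fst_or_snd s c' k with h | h <;>
      rcases D.circ_fst_or_snd s c' (smoothingArcs (s.flip c' c') k) with h' | h'
    · exact Or.inl ((D.circ s).trans h' ((D.circ s).symm h))
    · exact Or.inr (Or.inr ⟨h', h⟩)
    · exact Or.inr (Or.inl ⟨h', h⟩)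
    · exact Or.inl ((D.circ s).trans h' ((D.circ s).symm h))
  · have := D.circleAt_arcs s (c', k)
    rw [KauffmanState.arcs_apply] at this ⊢
    simp only [KauffmanState.flip_apply_of_ne s hc]
    exact Or.inl this

/-! ### Alternating diagrams: circles as cycles of a permutation of the under-darts -/

variable {D}

namespace IsAlternating

variable (hA : D.IsAlternating)
include hA

theorem isUnder_edge (d : Dart n) : Dart.IsUnder (D.edge d) ↔ ¬ d.IsUnder := by
  have key : ∀ k : Fin 4, (k = 1 ∨ k = 3) ↔ ¬ (k = 0 ∨ k = 2) := by decide
  have := hA d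
  rw [key] at this
  unfold Dart.IsUnder
  tauto

/-- Moving along a circle of a state, from under-dart to under-dart. -/
def circlePerm (s : KauffmanState n) : Equiv.Perm {d : Dart n // d.IsUnder} :=
  (s.arcs * D.edge).subtypePerm fun d => by
    rw [Equiv.Perm.mul_apply, Dart.isUnder_arcs, hA.isUnder_edge, not_not]

theorem circlePerm_apply (s : KauffmanState n) (d : {d : Dart n // d.IsUnder}) :
    (hA.circlePerm s d : Dart n) = s.arcs (D.edge d) := rfl

/-- The under-dart on the same edge as the given dart. -/
def toUnder (d : Dart n) : {d : Dart n // d.IsUnder} :=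
  if h : d.IsUnder then ⟨d, h⟩ else ⟨D.edge d, (hA.isUnder_edge d).2 h⟩

theorem toUnder_of_isUnder {d : Dart n} (h : d.IsUnder) : hA.toUnder d = ⟨d, h⟩ := dif_pos h

theorem toUnder_edge (d : Dart n) : hA.toUnder (D.edge d) = hA.toUnder d := by
  by_cases h : d.IsUnder
  · have h' := mt (hA.isUnder_edge d).1 (not_not.2 h)
    rw [toUnder, dif_neg h', toUnder, dif_pos h]
    exact Subtype.ext (D.edge_edge d)
  · have h' := (hA.isUnder_edge d).2 h
    rw [toUnder, dif_pos h', toUnder, dif_neg h]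

theorem circleAt_toUnder (s : KauffmanState n) (d : Dart n) :
    D.circleAt s (hA.toUnder d) = D.circleAt s d := by
  unfold toUnder
  split_ifs
  exacts [rfl, D.circleAt_edge s d]

theorem circleAt_circlePerm (s : KauffmanState n) (d : {d : Dart n // d.IsUnder}) :
    D.circleAt s (hA.circlePerm s d) = D.circleAt s d := by
  rw [circlePerm_apply, circleAt_arcs, circleAt_edge]

theorem sameCycle_toUnder_arcs (s : KauffmanState n) (d : Dart n) :
    (hA.circlePerm s).SameCycle (hA.toUnder (s.arcs d)) (hA.toUnder d) := by
  wlog h : ¬ d.IsUnder generalizing d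
  · have := this (s.arcs d) (by rw [Dart.isUnder_arcs]; exact h)
    rw [KauffmanState.arcs_arcs] at this
    exact this.symm
  · have e : hA.toUnder (s.arcs d) = hA.circlePerm s (hA.toUnder d) := by
      apply Subtype.ext
      rw [hA.toUnder_of_isUnder ((Dart.isUnder_arcs s d).2 h), circlePerm_apply, toUnder,
        dif_neg h, D.edge_edge]
    rw [e]
    exact Equiv.Perm.sameCycle_apply_left.2 (Equiv.Perm.SameCycle.refl _ _)

/-- Edges and arcs both exchange under- and over-darts. Collapsing each edge to its under-end
therefore turns an arc into one step of `circlePerm` or its inverse, and orients all circles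
consistently. -/
theorem circleAt_eq_iff_sameCycle (s : KauffmanState n) (d d' : {d : Dart n // d.IsUnder}) :
    D.circleAt s d = D.circleAt s d' ↔ (hA.circlePerm s).SameCycle d d' := by
  constructor
  · intro h
    have hle : MulAction.orbitRel (Subgroup.closure {D.edge, s.arcs}) (Dart n) ≤
        Setoid.comap hA.toUnder (Equiv.Perm.SameCycle.setoid (hA.circlePerm s)) := by
      refine orbitRel_closure_le ?_
      rintro g (rfl | rfl) x
      · change (hA.circlePerm s).SameCycle _ _
        rw [hA.toUnder_edge]
      · exact hA.sameCycle_toUnder_arcs s x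
    have := hle (D.circleAt_eq_iff.1 h)
    change (hA.circlePerm s).SameCycle _ _ at this
    rwa [hA.toUnder_of_isUnder d.2, hA.toUnder_of_isUnder d'.2] at this
  · intro h
    obtain ⟨i, rfl⟩ := h.exists_nat_pow_eq
    clear h
    induction i with
    | zero => rfl
    | succ i ih => rw [pow_succ', Equiv.Perm.mul_apply, circleAt_circlePerm, ← ih]

/-- A walk arrives at `c` by an over-end and leaves by an under-end; the other smoothing sends it
out by the other under-end. Composition with a transposition always joins or separates cycles, so no
surgery turns one circle into one circle. -/
theorem circlePerm_flip (s : KauffmanState n) (c : Fin n) :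
    hA.circlePerm (s.flip c) =
      Equiv.swap ⟨(c, 0), Or.inl rfl⟩ ⟨(c, 2), Or.inr rfl⟩ * hA.circlePerm s := by
  ext1 d
  apply Subtype.ext
  rw [Equiv.Perm.mul_apply, circlePerm_apply, KauffmanState.arcs_apply]
  have hu := mt (hA.isUnder_edge d).1 (not_not.2 d.2)
  generalize hx : hA.circlePerm s d = x
  have hx' : (x : Dart n) = _ := (congrArg Subtype.val hx.symm).trans (hA.circlePerm_apply s d)
  rw [KauffmanState.arcs_apply] at hx'
  generalize D.edge d = e at *
  obtain ⟨c', k⟩ := e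
  obtain ⟨x, hxu⟩ := x
  dsimp only at hx' ⊢
  subst hx'
  by_cases hc : c' = c
  · subst hc
    rw [KauffmanState.flip_apply_self]
    have hk : k = 1 ∨ k = 3 := by
      have : ∀ k : Fin 4, ¬ (k = 0 ∨ k = 2) → k = 1 ∨ k = 3 := by decide
      exact this k hu
    have e1 : ∀ b, smoothingArcs b 1 = if b then 2 else 0 := by decide
    have e3 : ∀ b, smoothingArcs b 3 = if b then 0 else 2 := by decide
    clear hx
    revert hxu
    generalize s c' = b
    rcases hk with rfl | rfl <;> cases b <;> intro hxu <;> simp [e1, e3]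
  · rw [KauffmanState.flip_apply_of_ne s hc, Equiv.swap_apply_of_ne_of_ne]
    · simp [Subtype.ext_iff, hc]
    · simp [Subtype.ext_iff, hc]

/-- Changing a smoothing either joins two circles or splits a circle in two. -/
theorem circ_flip_iff (s : KauffmanState n) (c : Fin n) :
    D.circ (s.flip c) (D.fst c) (D.snd c) ↔ ¬ D.circ s (D.fst c) (D.snd c) := by
  have h := fun s => hA.circleAt_eq_iff_sameCycle s ⟨(c, 0), Or.inl rfl⟩ ⟨(c, 2), Or.inr rfl⟩
  change D.circleAt _ _ = D.circleAt _ _ ↔ ¬ D.circleAt _ _ = D.circleAt _ _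
  rw [h, h, circlePerm_flip, Equiv.Perm.sameCycle_swap_mul_iff]
  intro h
  have h' : (0 : Fin 4) = 2 := congrArg (fun d => d.1.2) h
  exact absurd h' (by decide)

theorem circ_flip_eq_glue {s : KauffmanState n} {c : Fin n} (h : ¬ D.circ s (D.fst c) (D.snd c)) :
    D.circ (s.flip c) = Setoid.glue (D.circ s) (D.fst c) (D.snd c) := by
  refine le_antisymm (D.circ_flip_le s c) ?_
  rw [Setoid.glue_le_iff]
  refine ⟨?_, (hA.circ_flip_iff s c).2 h⟩
  have := D.circ_flip_le (s.flip c) c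
  rwa [KauffmanState.flip_flip, Setoid.glue_eq_self ((hA.circ_flip_iff s c).2 h)] at this

theorem circ_eq_glue_flip {s : KauffmanState n} {c : Fin n} (h : D.circ s (D.fst c) (D.snd c)) :
    D.circ s = Setoid.glue (D.circ (s.flip c)) (D.fst c) (D.snd c) := by
  have h' : ¬ D.circ (s.flip c) (D.fst c) (D.snd c) := by
    rw [hA.circ_flip_iff]
    exact not_not.2 h
  rw [← hA.circ_flip_eq_glue h', KauffmanState.flip_flip]

theorem card_circle_flip_of_not {s : KauffmanState n} {c : Fin n}
    (h : ¬ D.circ s (D.fst c) (D.snd c)) :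
    Nat.card (D.Circle (s.flip c)) + 1 = Nat.card (D.Circle s) :=
  card_glue (D.pt_surjective _) (D.pt_surjective _) h (hA.circ_flip_eq_glue h)

theorem card_circle_flip_of_circ {s : KauffmanState n} {c : Fin n}
    (h : D.circ s (D.fst c) (D.snd c)) :
    Nat.card (D.Circle (s.flip c)) = Nat.card (D.Circle s) + 1 := by
  have h' : ¬ D.circ (s.flip c) (D.fst c) (D.snd c) := by
    rw [hA.circ_flip_iff]
    exact not_not.2 h
  have := hA.card_circle_flip_of_not h'
  rw [KauffmanState.flip_flip] at this
  exact this.symm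

end IsAlternating

end LinkDiagram

/-! ### Counting `1`-smoothings -/

namespace KauffmanState

variable {n : ℕ}

theorem oneCount_flip {s : KauffmanState n} {c : Fin n} (h : s c = false) :
    (s.flip c).oneCount = s.oneCount + 1 := by
  have : (Finset.univ.filter fun c' => s.flip c c' = true) =
      insert c (Finset.univ.filter fun c' => s c' = true) := by
    ext c'
    by_cases hc : c' = c
    · subst hc
      simp [flip_apply_self, h]
    · simp [flip_apply_of_ne s hc, hc]
  rw [oneCount, this, Finset.card_insert_of_notMem (by simp [h])]
  rfl

theorem flip_induction {P : KauffmanState n → Prop} (h0 : P fun _ => false)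
    (h : ∀ s c, s c = false → P s → P (s.flip c)) (s : KauffmanState n) : P s := by
  induction hk : s.oneCount generalizing s with
  | zero =>
    convert h0 using 1
    funext c
    simpa using (Finset.filter_eq_empty_iff.1 (Finset.card_eq_zero.1 hk)) (Finset.mem_univ c)
  | succ k ih =>
    obtain ⟨c, hc⟩ : ∃ c, s c = true := by
      by_contra! hne
      rw [oneCount, Finset.filter_false_of_mem fun c _ => hne c] at hk
      simp at hk
    have hc' : s.flip c c = false := by simp [flip_apply_self, hc]
    have := h (s.flip c) c hc' (ih _ (by
      have := oneCount_flip hc'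
      rw [flip_flip] at this
      omega))
    rwa [flip_flip] at this

theorem le_iff {s t : KauffmanState n} : s ≤ t ↔ ∀ c, s c = true → t c = true :=
  Iff.rfl

theorem le_flip {s : KauffmanState n} {c : Fin n} (h : s c = false) : s ≤ s.flip c := by
  rw [le_iff]
  intro c' hc'
  rw [flip_apply_of_ne _ (by rintro rfl; simp [h] at hc'), hc']

theorem oneCount_true : oneCount (fun _ : Fin n => true) = n := by simp [oneCount]

theorem oneCount_false : oneCount (fun _ : Fin n => false) = 0 := by simp [oneCount]

end KauffmanState

/-! ### Subgraphs of the checkerboard graph -/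

namespace LinkDiagram

variable {n : ℕ} (D : LinkDiagram n)

/-- The equivalence relation on the points of a diagram generated by lying on the same circle of the
all-`0` state and by joining the two arcs of that state at each crossing with a `1`-smoothing in
the given state; its classes are the components of a subgraph of the checkerboard graph. -/
def joined (s : KauffmanState n) : Setoid D.Point :=
  sInf {E | D.circ (fun _ => false) ≤ E ∧ ∀ c, s c = true → E (D.fst c) (D.snd c)}

variable {D}

theorem joined_le {s : KauffmanState n} {E : Setoid D.Point} (h₁ : D.circ (fun _ => false) ≤ E)
    (h₂ : ∀ c, s c = true → E (D.fst c) (D.snd c)) : D.joined s ≤ E :=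
  sInf_le ⟨h₁, h₂⟩

theorem circ_false_le_joined (s : KauffmanState n) : D.circ (fun _ => false) ≤ D.joined s :=
  le_sInf fun _ h => h.1

theorem joined_fst_snd {s : KauffmanState n} {c : Fin n} (h : s c = true) :
    D.joined s (D.fst c) (D.snd c) := by
  rw [joined, Setoid.sInf_def]
  simp only [sInf_apply, iInf_apply, iInf_Prop_eq]
  rintro ⟨_, E, hE, rfl⟩
  exact hE.2 c h

theorem joined_mono {s t : KauffmanState n} (h : s ≤ t) : D.joined s ≤ D.joined t :=
  joined_le (circ_false_le_joined t) fun c hc => joined_fst_snd (KauffmanState.le_iff.1 h c hc)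

theorem joined_flip {s : KauffmanState n} {c : Fin n} (h : s c = false) :
    D.joined (s.flip c) = Setoid.glue (D.joined s) (D.fst c) (D.snd c) := by
  apply le_antisymm
  · refine joined_le ((circ_false_le_joined s).trans Setoid.le_glue) fun c' hc' => ?_
    by_cases hc : c' = c
    · rw [hc]
      exact Setoid.glue_pair
    · rw [KauffmanState.flip_apply_of_ne s hc] at hc'
      exact Setoid.le_glue (joined_fst_snd hc')
  · rw [Setoid.glue_le_iff]
    exact ⟨joined_mono (KauffmanState.le_flip h),
      joined_fst_snd (by simp [KauffmanState.flip_apply_self, h])⟩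

/-- A circle of a state stays within one component of the corresponding subgraph: each change of
smoothing glues at most the pair that the new edge joins. -/
theorem circ_le_joined (s : KauffmanState n) : D.circ s ≤ D.joined s := by
  induction s using KauffmanState.flip_induction with
  | h0 => exact circ_false_le_joined _
  | h s c hc ih =>
    rw [joined_flip hc]
    exact (D.circ_flip_le s c).trans (Setoid.glue_mono ih)

theorem joined_false : D.joined (fun _ => false) = D.circ fun _ => false :=
  le_antisymm (joined_le le_rfl (by simp)) (circ_le_joined _)

/-- The number of classes of `joined`. -/
noncomputable def joinedCard (D : LinkDiagram n) (s : KauffmanState n) : ℕ :=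
  Nat.card (Quotient (D.joined s))

theorem joinedCard_flip_of_not {s : KauffmanState n} {c : Fin n} (h : s c = false)
    (h' : ¬ D.joined s (D.fst c) (D.snd c)) : D.joinedCard (s.flip c) + 1 = D.joinedCard s := by
  refine card_glue (α := Quotient.mk (D.joined s)) (β := Quotient.mk (D.joined (s.flip c)))
    Quotient.mk_surjective Quotient.mk_surjective (p := D.fst c) (q := D.snd c)
    (fun e => h' (Quotient.exact e)) ?_
  rw [Setoid.ker_mk_eq, Setoid.ker_mk_eq, joined_flip h]

theorem joinedCard_flip_of_joined {s : KauffmanState n} {c : Fin n} (h : s c = false)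
    (h' : D.joined s (D.fst c) (D.snd c)) : D.joinedCard (s.flip c) = D.joinedCard s := by
  rw [joinedCard, joined_flip h, Setoid.glue_eq_self h', joinedCard]

theorem joinedCard_false : D.joinedCard (fun _ => false) = Nat.card (D.Circle fun _ => false) := by
  rw [joinedCard, joined_false]
  exact Nat.card_congr (Setoid.quotientKerEquivOfSurjective _ (D.pt_surjective _))

/-! ### Knots are connected -/

namespace IsKnot

variable (hK : D.IsKnot)
include hK

theorem subsingleton : Subsingleton (PermOrbits {D.edge, dartOpposite n} ⊕ Fin D.loops) := by
  have h : Nat.card (PermOrbits {D.edge, dartOpposite n} ⊕ Fin D.loops) = 1 := by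
    rw [Nat.card_sum, Nat.card_fin]
    exact hK
  exact (Nat.card_eq_one_iff_unique.1 h).1

theorem nonempty_point : Nonempty D.Point := by
  have h : Nat.card (PermOrbits {D.edge, dartOpposite n} ⊕ Fin D.loops) = 1 := by
    rw [Nat.card_sum, Nat.card_fin]
    exact hK
  obtain ⟨⟨⟨d⟩⟩ | k⟩ := (Nat.card_eq_one_iff_unique.1 h).2
  exacts [⟨Sum.inl d⟩, ⟨Sum.inr k⟩]

/-- All four ends at each crossing become equivalent, so passing straight through a crossing stays
in a class, and the whole knot is traversed that way. -/
theorem eq_top {s : KauffmanState n} {E : Setoid D.Point} (h₁ : D.circ s ≤ E)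
    (h₂ : ∀ c, E (D.fst c) (D.snd c)) (x y : D.Point) : E x y := by
  have hc : ∀ c k, E (Sum.inl (c, k)) (D.fst c) := by
    intro c k
    rcases D.circ_fst_or_snd s c k with h | h
    exacts [h₁ h, E.trans (h₁ h) (E.symm (h₂ c))]
  have hle : MulAction.orbitRel (Subgroup.closure {D.edge, dartOpposite n}) (Dart n) ≤
      Setoid.comap Sum.inl E := by
    refine orbitRel_closure_le ?_
    rintro g (rfl | rfl) ⟨c, k⟩
    · exact h₁ (D.circleAt_edge s (c, k))
    · exact E.trans (hc c _) (E.symm (hc c k))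
  have hs := hK.subsingleton
  rcases x with d | k <;> rcases y with d' | k'
  · have := hs.elim (Sum.inl (Quotient.mk _ d)) (Sum.inl (Quotient.mk _ d'))
    exact hle (Quotient.exact (Sum.inl_injective this))
  · exact absurd (hs.elim (Sum.inl (Quotient.mk _ d)) (Sum.inr k')) Sum.inl_ne_inr
  · exact absurd (hs.elim (Sum.inr k) (Sum.inl (Quotient.mk _ d'))) Sum.inr_ne_inl
  · rw [Sum.inr_injective (hs.elim (Sum.inr k) (Sum.inr k'))]

/-- Passing straight through is turning twice about a crossing, so the combinatorial map has no more
components than the knot. -/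
theorem card_component_add_loops :
    Nat.card (PermOrbits {dartRotate n, D.edge}) + D.loops = 1 := by
  suffices h : Nat.card (PermOrbits {dartRotate n, D.edge}) =
      Nat.card (PermOrbits {D.edge, dartOpposite n}) by
    rw [h]
    exact hK
  have hle : MulAction.orbitRel (Subgroup.closure {D.edge, dartOpposite n}) (Dart n) ≤
      MulAction.orbitRel (Subgroup.closure {dartRotate n, D.edge}) (Dart n) := by
    refine orbitRel_closure_le ?_
    rintro g (rfl | rfl) x
    · exact orbitRel_closure_apply (by simp) x
    · have h1 : ∀ x, dartOpposite n x = dartRotate n (dartRotate n x) := by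
        have : ∀ k : Fin 4, k + 2 = k + 1 + 1 := by decide
        exact fun x => Prod.ext rfl (this _)
      rw [h1]
      exact (MulAction.orbitRel _ _).trans (orbitRel_closure_apply (by simp) _)
        (orbitRel_closure_apply (by simp) x)
  have hs := hK.subsingleton
  have s1 : Subsingleton (PermOrbits {D.edge, dartOpposite n}) :=
    (Sum.inl_injective (β := Fin D.loops)).subsingleton
  have s2 : Subsingleton (PermOrbits {dartRotate n, D.edge}) := by
    constructor
    rintro ⟨d⟩ ⟨d'⟩
    exact Quotient.sound (hle (Quotient.exact
      (s1.elim (Quotient.mk _ d : PermOrbits _) (Quotient.mk _ d' : PermOrbits _))))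
  refine Nat.card_congr (Equiv.ofBijective
    (Quotient.lift (fun d => (Quotient.mk _ d : PermOrbits {D.edge, dartOpposite n}))
      fun _ _ _ => s1.elim _ _) ⟨Function.injective_of_subsingleton _, ?_⟩)
  rintro ⟨d⟩
  exact ⟨Quotient.mk _ d, rfl⟩

end IsKnot

/-! ### Planarity -/

namespace IsAlternating

variable (hA : D.IsAlternating)
include hA

theorem face_apply (d : Dart n) : (dartRotate n * D.edge) d =
    KauffmanState.arcs (fun _ => decide d.IsUnder) (D.edge d) := by
  by_cases h : d.IsUnder
  · simp only [h, decide_true]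
    exact Dart.rotate_of_not_isUnder (mt (hA.isUnder_edge d).1 (not_not.2 h))
  · simp only [h, decide_false]
    exact Dart.rotate_of_isUnder ((hA.isUnder_edge d).2 h)

/-- The faces of an alternating diagram are the circles of its two extreme states. -/
theorem card_face : Nat.card (PermOrbits {dartRotate n * D.edge}) =
    Nat.card (PermOrbits {D.edge, KauffmanState.arcs fun _ : Fin n => true}) +
      Nat.card (PermOrbits {D.edge, KauffmanState.arcs fun _ : Fin n => false}) := by
  set R := MulAction.orbitRel (Subgroup.closure {dartRotate n * D.edge}) (Dart n) with hR
  have hface : ∀ d, R (KauffmanState.arcs (fun _ => decide d.IsUnder) (D.edge d)) d := by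
    intro d
    rw [← hA.face_apply]
    exact orbitRel_closure_apply (Set.mem_singleton _) d
  -- a dart on the edge of `d` such that the face at this dart is a circle of the constant state `b`
  let u : Bool → Dart n → Dart n := fun b d => if decide d.IsUnder = b then d else D.edge d
  have hu_edge : ∀ b d, u b (D.edge d) = u b d := by
    intro b d
    by_cases h : d.IsUnder
    · have h' := mt (hA.isUnder_edge d).1 (not_not.2 h)
      cases b <;> simp [u, h, h', D.edge_edge]
    · have h' := (hA.isUnder_edge d).2 h
      cases b <;> simp [u, h, h', D.edge_edge]
  have hu_arcs : ∀ b d, R (u b (KauffmanState.arcs (fun _ => b) d)) (u b d) := by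
    intro b d
    wlog hd : decide d.IsUnder = b generalizing d
    · have hd' : decide (Dart.IsUnder (KauffmanState.arcs (fun _ => b) d)) = b := by
        rw [Bool.eq_iff_iff, decide_eq_true_iff, Dart.isUnder_arcs]
        rw [Bool.eq_iff_iff, decide_eq_true_iff] at hd
        tauto
      have := this _ hd'
      rw [KauffmanState.arcs_arcs] at this
      exact R.symm this
    · have hd' : ¬ decide (Dart.IsUnder (KauffmanState.arcs (fun _ => b) d)) = b := by
        rw [Bool.eq_iff_iff, decide_eq_true_iff, Dart.isUnder_arcs]
        rw [Bool.eq_iff_iff, decide_eq_true_iff] at hd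
        tauto
      have hd'' : decide (Dart.IsUnder (D.edge (KauffmanState.arcs (fun _ => b) d))) = b := by
        rw [Bool.eq_iff_iff, decide_eq_true_iff, hA.isUnder_edge]
        rw [Bool.eq_iff_iff, decide_eq_true_iff] at hd'
        tauto
      simp only [u]
      rw [if_pos hd, if_neg hd']
      have := hface (D.edge (KauffmanState.arcs (fun _ => b) d))
      rw [hd'', D.edge_edge, KauffmanState.arcs_arcs] at this
      exact R.symm this
  have hu_le : ∀ b, MulAction.orbitRel
      (Subgroup.closure {D.edge, KauffmanState.arcs fun _ : Fin n => b}) (Dart n) ≤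
        Setoid.comap (u b) R := by
    intro b
    refine orbitRel_closure_le ?_
    rintro g (rfl | rfl) d
    · change R _ _
      rw [hu_edge]
    · exact hu_arcs b d
  -- A step along a face preserves the type of a dart: faces through under-darts follow circles of
  -- the all-`1` state, the others follow circles of the all-`0` state.
  let Φ : Dart n → PermOrbits {D.edge, KauffmanState.arcs fun _ : Fin n => true} ⊕
      PermOrbits {D.edge, KauffmanState.arcs fun _ : Fin n => false} :=
    fun d => if d.IsUnder then Sum.inl (Quotient.mk _ d) else Sum.inr (Quotient.mk _ d)
  have hΦ : Function.Surjective Φ := by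
    rintro (⟨⟨d⟩⟩ | ⟨⟨d⟩⟩)
    · by_cases h : d.IsUnder
      · exact ⟨d, if_pos h⟩
      · refine ⟨D.edge d, (if_pos ((hA.isUnder_edge d).2 h)).trans (congrArg Sum.inl ?_)⟩
        exact Quotient.sound (orbitRel_closure_apply (by simp) d)
    · by_cases h : d.IsUnder
      · refine ⟨D.edge d, (if_neg (mt (hA.isUnder_edge d).1 (not_not.2 h))).trans
          (congrArg Sum.inr ?_)⟩
        exact Quotient.sound (orbitRel_closure_apply (by simp) d)
      · exact ⟨d, if_neg h⟩
  have hker : Setoid.ker Φ = R := by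
    apply le_antisymm
    · intro d d' h
      rw [Setoid.ker_def] at h
      by_cases hd : d.IsUnder <;> by_cases hd' : d'.IsUnder
      · simp only [Φ, if_pos hd, if_pos hd'] at h
        have := hu_le true (Quotient.exact (Sum.inl_injective h))
        change R _ _ at this
        simpa [u, hd, hd'] using this
      · simp [Φ, hd, hd'] at h
      · simp [Φ, hd, hd'] at h
      · simp only [Φ, if_neg hd, if_neg hd'] at h
        have := hu_le false (Quotient.exact (Sum.inr_injective h))
        change R _ _ at this
        simpa [u, hd, hd'] using this
    · refine orbitRel_closure_le ?_
      rintro _ rfl d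
      rw [hA.face_apply, Setoid.ker_def]
      by_cases hd : d.IsUnder
      · have hd' : Dart.IsUnder (KauffmanState.arcs (fun _ => true) (D.edge d)) := by
          rw [Dart.isUnder_arcs, hA.isUnder_edge]
          exact not_not.2 hd
        simp only [hd, decide_true, Φ, if_pos hd, if_pos hd']
        exact congrArg Sum.inl (Quotient.sound ((MulAction.orbitRel _ _).trans
          (orbitRel_closure_apply (by simp) _) (orbitRel_closure_apply (by simp) _)))
      · have hd' : ¬ Dart.IsUnder (KauffmanState.arcs (fun _ => false) (D.edge d)) := by
          rw [Dart.isUnder_arcs, hA.isUnder_edge]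
          exact not_not.2 hd
        simp only [hd, decide_false, Φ, if_neg hd']
        exact congrArg Sum.inr (Quotient.sound ((MulAction.orbitRel _ _).trans
          (orbitRel_closure_apply (by simp) _) (orbitRel_closure_apply (by simp) _)))
  rw [← Nat.card_sum]
  have e := Setoid.quotientKerEquivOfSurjective Φ hΦ
  rw [hker] at e
  exact Nat.card_congr e

end IsAlternating

end LinkDiagram

/-! ### Genus zero, and one-circle states as spanning trees -/

namespace LinkDiagram

variable {n : ℕ} {D : LinkDiagram n}

/-- This is Euler's formula, since the faces are the circles of the two extreme states; a knot
without crossings contributes its single loop to both. -/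
theorem card_circle_add (hA : D.IsAlternating) (hK : D.IsKnot) :
    Nat.card (D.Circle fun _ => false) + Nat.card (D.Circle fun _ => true) = n + 2 := by
  have h1 := D.planar
  have h2 := hK.card_component_add_loops
  rw [hA.card_face] at h1
  rw [Circle, Circle, Nat.card_sum, Nat.card_sum, Nat.card_fin]
  omega

/-- Twice the genus of the surface carrying a state, plus a constant. -/
noncomputable def excess (D : LinkDiagram n) (s : KauffmanState n) : ℤ :=
  2 * D.joinedCard s - Nat.card (D.Circle s) + s.oneCount

theorem joinedCard_eq_one (hK : D.IsKnot) {s : KauffmanState n} (h : ∀ x y, D.joined s x y) :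
    D.joinedCard s = 1 := by
  have := hK.nonempty_point
  refine Nat.card_eq_one_iff_unique.2 ⟨⟨?_⟩, this.map (Quotient.mk _)⟩
  rintro ⟨x⟩ ⟨y⟩
  exact Quotient.sound (h x y)

theorem mem_oneCircleStates_iff_circ (hK : D.IsKnot) {s : KauffmanState n} :
    s ∈ D.oneCircleStates ↔ ∀ x y, D.circ s x y := by
  have := hK.nonempty_point
  constructor
  · intro h x y
    exact (Nat.card_eq_one_iff_unique.1 h).1.elim _ _
  · intro h
    refine Nat.card_eq_one_iff_unique.2 ⟨⟨fun a b => ?_⟩, this.map (D.pt s)⟩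
    obtain ⟨x, rfl⟩ := D.pt_surjective s a
    obtain ⟨y, rfl⟩ := D.pt_surjective s b
    exact h x y

section Planarity

variable (hA : D.IsAlternating)
include hA

/-- An edge between two components merges two circles and leaves the excess unchanged. An edge
within a component leaves it unchanged if a circle splits, and raises it by `2` if two circles
merge. -/
theorem excess_le_flip {s : KauffmanState n} {c : Fin n} (h : s c = false) :
    D.excess s ≤ D.excess (s.flip c) := by
  have h1 := KauffmanState.oneCount_flip h
  unfold excess
  by_cases hj : D.joined s (D.fst c) (D.snd c)
  · have h2 := joinedCard_flip_of_joined h hj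
    by_cases hc : D.circ s (D.fst c) (D.snd c)
    · have := hA.card_circle_flip_of_circ hc
      omega
    · have := hA.card_circle_flip_of_not hc
      omega
  · have h2 := joinedCard_flip_of_not h hj
    have := hA.card_circle_flip_of_not (fun hc => hj (circ_le_joined s hc))
    omega

theorem excess_false_le (s : KauffmanState n) : D.excess (fun _ => false) ≤ D.excess s := by
  induction s using KauffmanState.flip_induction with
  | h0 => exact le_rfl
  | h s c hc ih => exact ih.trans (excess_le_flip hA hc)

theorem excess_le_true (s : KauffmanState n) : D.excess s ≤ D.excess (fun _ => true) := by
  induction hk : n - s.oneCount generalizing s with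
  | zero =>
    have : s = fun _ => true := by
      by_contra hne
      obtain ⟨c, hc⟩ := Function.ne_iff.1 hne
      have h1 := KauffmanState.oneCount_flip (s := s) (c := c) (by simpa using hc)
      have h2 : (s.flip c).oneCount ≤ n := (Finset.card_le_univ _).trans_eq (by simp)
      omega
    rw [this]
  | succ k ih =>
    obtain ⟨c, hc⟩ : ∃ c, s c = false := by
      by_contra! hne
      have : s = fun _ => true := funext fun c => by simpa using hne c
      rw [this, KauffmanState.oneCount_true] at hk
      omega
    have h1 := KauffmanState.oneCount_flip hc
    exact (excess_le_flip hA hc).trans (ih _ (by omega))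

variable (hK : D.IsKnot)
include hK

/-- The excess is monotone, and Euler's formula says that its values at the two extreme states
agree. -/
theorem excess_eq (s : KauffmanState n) : D.excess s = Nat.card (D.Circle fun _ => false) := by
  have h1 := excess_false_le hA s
  have h2 := excess_le_true hA s
  have h3 := card_circle_add hA hK
  have h4 : D.joinedCard (fun _ => true) = 1 := joinedCard_eq_one hK
    (hK.eq_top (circ_le_joined _) fun c => joined_fst_snd rfl)
  have e1 : D.excess (fun _ => false) = Nat.card (D.Circle fun _ => false) := by
    rw [excess, joinedCard_false, KauffmanState.oneCount_false]
    omega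
  have e2 : D.excess (fun _ => true) = Nat.card (D.Circle fun _ => false) := by
    rw [excess, h4, KauffmanState.oneCount_true]
    omega
  omega

/-- A merge within one component would raise the excess, which is constant. So surgery splits a
circle exactly when the new edge closes a cycle of the graph. -/
theorem circ_iff_joined {s : KauffmanState n} {c : Fin n} (h : s c = false) :
    D.circ s (D.fst c) (D.snd c) ↔ D.joined s (D.fst c) (D.snd c) := by
  refine ⟨fun hc => circ_le_joined s hc, fun hj => ?_⟩
  by_contra hc
  have h1 := excess_eq hA hK s
  have h2 := excess_eq hA hK (s.flip c)
  have h3 := KauffmanState.oneCount_flip h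
  have h4 := joinedCard_flip_of_joined h hj
  have h5 := hA.card_circle_flip_of_not hc
  unfold excess at h1 h2
  omega

/-- The states with one circle are the spanning trees of the checkerboard graph. -/
theorem mem_oneCircleStates_iff {s : KauffmanState n} : s ∈ D.oneCircleStates ↔
    (∀ x y, D.joined s x y) ∧ s.oneCount + 1 = Nat.card (D.Circle fun _ => false) := by
  have h1 := excess_eq hA hK s
  unfold excess at h1
  constructor
  · intro h
    have hj : ∀ x y, D.joined s x y := fun x y =>
      circ_le_joined s ((mem_oneCircleStates_iff_circ hK).1 h x y)
    have h2 := joinedCard_eq_one hK hj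
    have h3 : Nat.card (D.Circle s) = 1 := h
    exact ⟨hj, by omega⟩
  · rintro ⟨hj, h3⟩
    have h2 := joinedCard_eq_one hK hj
    change Nat.card (D.Circle s) = 1
    omega

/-- In a state with the fewest circles no surgery merges, so the two arcs at each crossing lie on
one circle, and the knot is connected. -/
theorem oneCircleStates_nonempty : D.oneCircleStates.Nonempty := by
  obtain ⟨s, hs⟩ := Finite.exists_min fun s : KauffmanState n => Nat.card (D.Circle s)
  refine ⟨s, (mem_oneCircleStates_iff_circ hK).2 (hK.eq_top le_rfl fun c => ?_)⟩
  by_contra hc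
  have h1 := hA.card_circle_flip_of_not hc
  have h2 := hs (s.flip c)
  omega

/-- If some state with one circle that has a `0`-smoothing at `c` cannot be changed, at `c` and at
crossings in `F`, to a state with one circle having a `1`-smoothing at `c`, then changing the
smoothing at `c` always splits a circle. -/
theorem circ_of_forall_notMem {F : Finset (Fin n)} {c : Fin n} {T : KauffmanState n}
    (hT : T ∈ D.oneCircleStates) (hTc : T c = false)
    (hno : ∀ T' : KauffmanState n, (∀ c' ∉ F, c' ≠ c → T' c' = T c') → T' c = true →
      T' ∉ D.oneCircleStates)
    {s : KauffmanState n} (hs : ∀ c' ∉ F, s c' = T c') (hsc : s c = false) :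
    D.circ s (D.fst c) (D.snd c) := by
  rw [mem_oneCircleStates_iff hA hK] at hT
  rw [circ_iff_joined hA hK hsc]
  by_contra hj
  -- `W` is a smallest part of the tree `T` that still connects the ends of `c` and contains all
  -- fixed edges of `T`. As `s` does not connect them, `W` has a free edge `c'`, and `T` with `c'`
  -- exchanged for `c` will be a spanning tree.
  obtain ⟨W, ⟨hWT, hWF, hWj⟩, hmin⟩ := (Set.toFinite {W : KauffmanState n | W ≤ T ∧
    (∀ c' ∉ F, W c' = T c') ∧ D.joined W (D.fst c) (D.snd c)}).exists_minimal
    ⟨T, le_rfl, fun _ _ => rfl, hT.1 _ _⟩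
  obtain ⟨c', hc'F, hWc'⟩ : ∃ c' ∈ F, W c' = true := by
    by_contra! hne
    refine hj (joined_mono (KauffmanState.le_iff.2 fun c' hc' => ?_) hWj)
    by_cases hF : c' ∈ F
    · exact absurd hc' (hne c' hF)
    · rw [hs c' hF, ← hWF c' hF, hc']
  have hW'c' : W.flip c' c' = false := by simp [KauffmanState.flip_apply_self, hWc']
  have hTc' := KauffmanState.le_iff.1 hWT c' hWc'
  have hcc' : c' ≠ c := by
    rintro rfl
    simp [hTc] at hTc'
  have hW'W := KauffmanState.le_flip hW'c'
  have hWg := joined_flip (D := D) hW'c'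
  rw [KauffmanState.flip_flip] at hW'W hWg
  have hW'j : ¬ D.joined (W.flip c') (D.fst c) (D.snd c) := by
    intro h
    have := hmin ⟨hW'W.trans hWT, fun d hd => ?_, h⟩ hW'W
    · have := KauffmanState.le_iff.1 this c' hWc'
      simp [hW'c'] at this
    · rw [KauffmanState.flip_apply_of_ne, hWF d hd]
      rintro rfl
      exact hd hc'F
  have hW'T : W.flip c' ≤ (T.flip c).flip c' := by
    rw [KauffmanState.le_iff]
    intro d hd
    by_cases hdc' : d = c'
    · subst hdc'
      simp [hW'c'] at hd
    · have hdT := KauffmanState.le_iff.1 (hW'W.trans hWT) d hd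
      have hdc : d ≠ c := by
        rintro rfl
        simp [hTc] at hdT
      rw [KauffmanState.flip_apply_of_ne _ hdc', KauffmanState.flip_apply_of_ne _ hdc, hdT]
  have hT'c : (T.flip c).flip c' c = true := by
    rw [KauffmanState.flip_apply_of_ne _ hcc'.symm, KauffmanState.flip_apply_self, hTc, Bool.not_false]
  have hT'c' : (T.flip c).flip c' c' = false := by
    rw [KauffmanState.flip_apply_self, KauffmanState.flip_apply_of_ne _ hcc', hTc', Bool.not_true]
  refine hno ((T.flip c).flip c') (fun d hd hdc => ?_) hT'c
    ((mem_oneCircleStates_iff hA hK).2 ⟨?_, ?_⟩)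
  · rw [KauffmanState.flip_apply_of_ne, KauffmanState.flip_apply_of_ne _ hdc]
    rintro rfl
    exact hd hc'F
  · have hle := joined_mono (D := D) hW'T
    have hpq := joined_fst_snd (D := D) hT'c
    set J := D.joined ((T.flip c).flip c') with hJ
    -- By minimality `c'` is needed in `W` to connect the ends of `c`, so `W` without `c'` links the
    -- ends of `c'` to those of `c`, and the edge `c` closes the gap.
    have hpq' : J (D.fst c') (D.snd c') := by
      rw [hWg] at hWj
      rcases hWj with h | ⟨h, h'⟩ | ⟨h, h'⟩
      · exact absurd h hW'j
      · exact J.trans (J.symm (hle h)) (J.trans hpq (hle h'))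
      · exact J.trans (J.symm (hle h')) (J.trans (J.symm hpq) (hle h))
    have h1 := joined_flip (D := D) hT'c'
    rw [KauffmanState.flip_flip, ← hJ, Setoid.glue_eq_self hpq'] at h1
    intro x y
    rw [← h1]
    exact joined_mono (KauffmanState.le_flip hTc) (hT.1 x y)
  · have h1 := KauffmanState.oneCount_flip hTc
    have h2 := KauffmanState.oneCount_flip hT'c'
    rw [KauffmanState.flip_flip] at h2
    omega

/-- If some state with one circle that has a `1`-smoothing at `c` cannot be changed, at `c` and at
crossings in `F`, to a state with one circle having a `0`-smoothing at `c`, then changing the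
smoothing at `c` always merges two circles. -/
theorem not_circ_of_forall_notMem {F : Finset (Fin n)} {c : Fin n} {T : KauffmanState n}
    (hT : T ∈ D.oneCircleStates) (hTc : T c = true)
    (hno : ∀ T' : KauffmanState n, (∀ c' ∉ F, c' ≠ c → T' c' = T c') → T' c = false →
      T' ∉ D.oneCircleStates)
    {s : KauffmanState n} (hs : ∀ c' ∉ F, c' ≠ c → s c' = T c') (hsc : s c = false) :
    ¬ D.circ s (D.fst c) (D.snd c) := by
  have hT' := (mem_oneCircleStates_iff hA hK).1 hT
  rw [circ_iff_joined hA hK hsc]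
  intro hj
  have hT₀c : T.flip c c = false := by simp [KauffmanState.flip_apply_self, hTc]
  have hg := joined_flip (D := D) hT₀c
  have hcount := KauffmanState.oneCount_flip hT₀c
  rw [KauffmanState.flip_flip] at hg hcount
  set G := D.joined (T.flip c) with hG
  have htop : ∀ x y, Setoid.glue G (D.fst c) (D.snd c) x y := by
    rw [← hg]
    exact hT'.1
  -- Otherwise the tree without `c` would still be connected, and the constant excess would leave
  -- its state with no circle at all.
  have hGc : ¬ G (D.fst c) (D.snd c) := by
    intro h
    rw [Setoid.glue_eq_self h] at htop
    have h1 := joinedCard_eq_one hK (s := T.flip c) htop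
    have h2 := excess_eq hA hK (T.flip c)
    have h3 : Nat.card (D.Circle (T.flip c)) ≠ 0 := by
      have := hK.nonempty_point.map (D.pt (T.flip c))
      exact Nat.card_pos.ne'
    unfold excess at h2
    omega
  have hor : ∀ x, G x (D.fst c) ∨ G x (D.snd c) := by
    intro x
    rcases htop x (D.fst c) with h | ⟨h, -⟩ | ⟨h, -⟩
    exacts [Or.inl h, Or.inl h, Or.inr h]
  -- Removing `c` cuts the tree in two. Since `s` connects the ends of `c` it has an edge `c'`
  -- across the cut, and `c'` can replace `c`.
  obtain ⟨c', hsc', hGc'⟩ : ∃ c', s c' = true ∧ ¬ G (D.fst c') (D.snd c') := by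
    by_contra! hne
    exact hGc (joined_le (circ_false_le_joined _) hne hj)
  have hT₀c' : T.flip c c' = false := by
    by_contra h
    exact hGc' (joined_fst_snd (by simpa using h))
  have hcc' : c' ≠ c := by
    rintro rfl
    simp [hsc] at hsc'
  have hc'F : c' ∈ F := by
    by_contra h
    rw [KauffmanState.flip_apply_of_ne _ hcc', ← hs c' h hcc', hsc'] at hT₀c'
    simp at hT₀c'
  have hg' := joined_flip (D := D) hT₀c'
  refine hno ((T.flip c).flip c') (fun d hd hdc => ?_) ?_
    ((mem_oneCircleStates_iff hA hK).2 ⟨?_, ?_⟩)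
  · rw [KauffmanState.flip_apply_of_ne, KauffmanState.flip_apply_of_ne _ hdc]
    rintro rfl
    exact hd hc'F
  · rw [KauffmanState.flip_apply_of_ne _ hcc'.symm, hT₀c]
  · rw [hg', ← hG]
    set G' := Setoid.glue G (D.fst c') (D.snd c') with hG'
    have hle : G ≤ G' := Setoid.le_glue
    have h' : G' (D.fst c) (D.snd c) := by
      have hpair : G' (D.fst c') (D.snd c') := Setoid.glue_pair
      rcases hor (D.fst c') with h1 | h1 <;> rcases hor (D.snd c') with h2 | h2
      · exact absurd (G.trans h1 (G.symm h2)) hGc'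
      · exact G'.trans (G'.symm (hle h1)) (G'.trans hpair (hle h2))
      · exact G'.trans (G'.symm (hle h2)) (G'.trans (G'.symm hpair) (hle h1))
      · exact absurd (G.trans h1 (G.symm h2)) hGc'
    intro x y
    exact Setoid.glue_le_iff.2 ⟨hle, h'⟩ (htop x y)
  · have := KauffmanState.oneCount_flip hT₀c'
    omega

/-- Walking along the circle of a one-circle state one meets a crossing at which the smoothing may
be changed; it is met by the circle through the starting point for all possible changes. -/
theorem exists_forall_circ {F : Finset (Fin n)} (hF : F.Nonempty) {T : KauffmanState n}
    (hT : T ∈ D.oneCircleStates) (b : D.Point) :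
    ∃ c ∈ F, ∀ s : KauffmanState n, (∀ c' ∉ F, s c' = T c') →
      D.circ s b (D.fst c) ∨ D.circ s b (D.snd c) := by
  rw [mem_oneCircleStates_iff_circ hK] at hT
  obtain ⟨c₀, hc₀⟩ := hF
  obtain ⟨d, rfl⟩ : ∃ d, b = Sum.inl d := by
    rcases b with d | k
    · exact ⟨d, rfl⟩
    · exact absurd (hT (Sum.inr k) (D.fst c₀)) Sum.inr_ne_inl
  set x := hA.toUnder d with hx
  have hex : ∃ k, ((hA.circlePerm T ^ k) x : Dart n).1 ∈ F := by
    have := hT (Sum.inl d) (D.fst c₀)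
    change D.circleAt T d = D.circleAt T (c₀, 0) at this
    rw [← hA.circleAt_toUnder T d] at this
    obtain ⟨k, hk⟩ :=
      ((hA.circleAt_eq_iff_sameCycle T x ⟨(c₀, 0), Or.inl rfl⟩).1 this).exists_nat_pow_eq
    exact ⟨k, by rw [hk]; exact hc₀⟩
  -- The walk up to the first crossing in `F` uses only smoothings shared by all the states `s`
  -- considered.
  obtain ⟨k, hk, hmin⟩ : ∃ k, ((hA.circlePerm T ^ k) x : Dart n).1 ∈ F ∧
      ∀ i < k, ((hA.circlePerm T ^ i) x : Dart n).1 ∉ F :=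
    ⟨Nat.find hex, Nat.find_spec hex, fun i hi => Nat.find_min hex hi⟩
  refine ⟨_, hk, fun s hs => ?_⟩
  have hcirc : ∀ i, D.circ s (Sum.inl d) (Sum.inl ((hA.circlePerm s ^ i) x)) := by
    intro i
    change D.circleAt s d = D.circleAt s _
    rw [← hA.circleAt_toUnder s d, hA.circleAt_eq_iff_sameCycle]
    exact ⟨i, by rw [zpow_natCast]⟩
  have hpow : ∀ i, i < k → (hA.circlePerm s ^ i) x = (hA.circlePerm T ^ i) x := by
    intro i hi
    refine Equiv.Perm.pow_eq_of_forall_lt (k := i) (fun j hj => ?_) i le_rfl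
    apply Subtype.ext
    have := hmin (j + 1) (by omega)
    rw [pow_succ', Equiv.Perm.mul_apply, hA.circlePerm_apply, KauffmanState.arcs_apply] at this
    rw [hA.circlePerm_apply, hA.circlePerm_apply, KauffmanState.arcs_apply,
      KauffmanState.arcs_apply, hs _ this]
  -- The last step may leave by the other under-end, but at the same crossing, since arcs do not
  -- change the crossing.
  have hcross : ((hA.circlePerm s ^ k) x : Dart n).1 = ((hA.circlePerm T ^ k) x : Dart n).1 := by
    rcases k with - | k
    · rfl
    · rw [pow_succ', pow_succ', Equiv.Perm.mul_apply, Equiv.Perm.mul_apply, hpow k (by omega)]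
      rfl
  have := hcirc k
  rw [← hcross]
  rcases ((hA.circlePerm s ^ k) x).2.eq with h | h
  · left
    rwa [h] at this
  · right
    rwa [h] at this

end Planarity

end LinkDiagram

/-! ### Enhanced states -/

namespace LinkDiagram

variable {n : ℕ} (D : LinkDiagram n)

noncomputable instance (s : KauffmanState n) : DecidableEq (D.Circle s) := Classical.decEq _

noncomputable instance : DecidableEq D.EnhancedState := Classical.decEq _

noncomputable instance : Fintype D.EnhancedState := Fintype.ofFinite _

variable {D}

namespace EnhancedState

/-- The label of the circle through a point. -/
def val (x : D.EnhancedState) (z : D.Point) : ℤˣ := x.2 (D.pt x.1 z)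

/-- Change the label of the circle through a point. -/
noncomputable def upd (x : D.EnhancedState) (z : D.Point) (u : ℤˣ) : D.EnhancedState :=
  ⟨x.1, Function.update x.2 (D.pt x.1 z) u⟩

/-- The enhanced state with a given labelling of points. -/
noncomputable def ofVal (s : KauffmanState n) (l : D.Point → ℤˣ) : D.EnhancedState :=
  ⟨s, fun a => l (Function.surjInv (D.pt_surjective s) a)⟩

/-- The enhanced state with all labels `v_1`. -/
def one (s : KauffmanState n) : D.EnhancedState := ⟨s, fun _ => 1⟩

variable {x y : D.EnhancedState} {z w : D.Point} {u : ℤˣ}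

theorem val_congr (h : D.circ x.1 z w) : x.val z = x.val w := congrArg x.2 h

theorem val_congr_of_eq {s : KauffmanState n} (hx : x.1 = s) (h : D.circ s z w) :
    x.val z = x.val w := by
  subst hx
  exact val_congr h

theorem ext_val (h : x.1 = y.1) (h' : ∀ z, x.val z = y.val z) : x = y := by
  obtain ⟨s, x⟩ := x
  obtain ⟨t, y⟩ := y
  obtain rfl : s = t := h
  congr 1
  funext a
  obtain ⟨z, rfl⟩ := D.pt_surjective s a
  exact h' z

theorem val_ofVal {s : KauffmanState n} {l : D.Point → ℤˣ}
    (h : ∀ z w, D.circ s z w → l z = l w) (z : D.Point) : (ofVal s l).val z = l z :=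
  h _ _ (Function.surjInv_eq (D.pt_surjective s) _)

theorem val_one (s : KauffmanState n) (z : D.Point) : (one s).val z = 1 := rfl

theorem val_upd_of_circ (h : D.circ x.1 w z) : (x.upd z u).val w = u := by
  unfold val upd
  dsimp only
  rw [show D.pt x.1 w = D.pt x.1 z from h, Function.update_self]

theorem val_upd_of_not (h : ¬ D.circ x.1 w z) : (x.upd z u).val w = x.val w :=
  Function.update_of_ne h _ _

theorem val_upd_self : (x.upd z u).val z = u := val_upd_of_circ rfl

theorem upd_congr (h : D.circ x.1 z w) : x.upd z u = x.upd w u := by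
  unfold upd
  rw [show D.pt x.1 z = D.pt x.1 w from h]

theorem upd_upd {v : ℤˣ} : (x.upd z u).upd z v = x.upd z v := by
  unfold upd
  dsimp only
  rw [Function.update_idem]

theorem upd_val : x.upd z (x.val z) = x := by
  simp [upd, val]

theorem upd_comm {v : ℤˣ} (h : ¬ D.circ x.1 z w) :
    (x.upd z u).upd w v = (x.upd w v).upd z u := by
  unfold upd
  dsimp only
  rw [Function.update_comm (show D.pt x.1 z ≠ D.pt x.1 w from h)]

theorem upd_eq_iff (h : x.val z = u) {v : ℤˣ} : x.upd z v = y ↔ x = y.upd z u ∧ y.val z = v := by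
  constructor
  · rintro rfl
    rw [upd_upd, val_upd_self, ← h, upd_val]
    exact ⟨rfl, rfl⟩
  · rintro ⟨rfl, rfl⟩
    rw [upd_upd, upd_val]

end EnhancedState

open EnhancedState

/-! ### The effect of one surgery on circles and labels -/

theorem circ_le_glue_flip (s : KauffmanState n) (c : Fin n) :
    D.circ s ≤ Setoid.glue (D.circ (s.flip c)) (D.fst c) (D.snd c) := by
  have := D.circ_flip_le (s.flip c) c
  rwa [KauffmanState.flip_flip] at this

/-- Whether a circle through a point meets the crossing `c` does not depend on the smoothing at
`c`. -/
theorem circ_or_of_flip {s : KauffmanState n} {c : Fin n} {z : D.Point}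
    (h : D.circ (s.flip c) z (D.fst c) ∨ D.circ (s.flip c) z (D.snd c)) :
    D.circ s z (D.fst c) ∨ D.circ s z (D.snd c) := by
  rcases h with h | h <;> rcases D.circ_flip_le s c h with h | ⟨h, -⟩ | ⟨h, -⟩ <;> tauto

theorem circ_or_flip_iff {s : KauffmanState n} {c : Fin n} {z : D.Point} :
    (D.circ (s.flip c) z (D.fst c) ∨ D.circ (s.flip c) z (D.snd c)) ↔
      (D.circ s z (D.fst c) ∨ D.circ s z (D.snd c)) := by
  refine ⟨circ_or_of_flip, fun h => circ_or_of_flip ?_⟩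
  rwa [KauffmanState.flip_flip]

theorem circ_flip_of_not {s : KauffmanState n} {c : Fin n} {z w : D.Point}
    (h : ¬ (D.circ s z (D.fst c) ∨ D.circ s z (D.snd c))) (h' : D.circ s z w) :
    D.circ (s.flip c) z w := by
  rcases circ_le_glue_flip s c h' with k | ⟨k, -⟩ | ⟨k, -⟩
  · exact k
  · exact absurd (circ_or_of_flip (Or.inl k)) h
  · exact absurd (circ_or_of_flip (Or.inr k)) h

theorem circ_flip_iff_of_not {s : KauffmanState n} {c : Fin n} {z w : D.Point}
    (h : ¬ (D.circ s z (D.fst c) ∨ D.circ s z (D.snd c))) :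
    D.circ (s.flip c) z w ↔ D.circ s z w := by
  refine ⟨fun h' => ?_, circ_flip_of_not h⟩
  have := circ_flip_of_not (s := s.flip c) (by rwa [circ_or_flip_iff]) h'
  rwa [KauffmanState.flip_flip] at this

-- The relation of the two arcs at `c` before the change determines the one after it, so the
-- residual zero case of `surgeryCoeff` does not occur. Using points puts loops and darts under a
-- single condition.
open scoped Classical in
theorem surgeryCoeff_eq (hA : D.IsAlternating) {c : Fin n} {x y : D.EnhancedState}
    (h : y.1 = x.1.flip c) : D.surgeryCoeff c x y =
      if ∀ z, ¬ (D.circ x.1 z (D.fst c) ∨ D.circ x.1 z (D.snd c)) → x.val z = y.val z then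
        if D.circ x.1 (D.fst c) (D.snd c) then
          comulCoeff (x.val (D.fst c)) (y.val (D.fst c)) (y.val (D.snd c))
        else mulCoeff (x.val (D.fst c)) (x.val (D.snd c)) (y.val (D.fst c))
      else 0 := by
  have hy := hA.circ_flip_iff x.1 c
  rw [← h] at hy
  unfold surgeryCoeff
  dsimp only
  have hiff : ((∀ d, D.circleAt x.1 d ≠ D.circleAt x.1 (c, 0) →
      D.circleAt x.1 d ≠ D.circleAt x.1 (c, 2) →
        x.2 (D.circleAt x.1 d) = y.2 (D.circleAt y.1 d)) ∧
      (∀ k : Fin D.loops, x.2 (Sum.inr k) = y.2 (Sum.inr k))) ↔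
      ∀ z, ¬ (D.circ x.1 z (D.fst c) ∨ D.circ x.1 z (D.snd c)) → x.val z = y.val z := by
    constructor
    · rintro ⟨h1, h2⟩ (d | k) hz
      · rw [not_or] at hz
        exact h1 d hz.1 hz.2
      · exact h2 k
    · intro h
      refine ⟨fun d h1 h2 => h (Sum.inl d) (not_or.2 ⟨h1, h2⟩), fun k => h (Sum.inr k) ?_⟩
      rintro (h | h) <;> exact absurd h Sum.inr_ne_inl
  have hx' : D.circ x.1 (D.fst c) (D.snd c) ↔ D.circleAt x.1 (c, 0) = D.circleAt x.1 (c, 2) :=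
    Iff.rfl
  have hy' : D.circ y.1 (D.fst c) (D.snd c) ↔ D.circleAt y.1 (c, 0) = D.circleAt y.1 (c, 2) :=
    Iff.rfl
  rw [hx', hy'] at hy
  simp only [hiff]
  rw [hx']
  refine if_congr Iff.rfl ?_ rfl
  by_cases hc : D.circleAt x.1 (c, 0) = D.circleAt x.1 (c, 2)
  · have hc' : ¬ D.circleAt y.1 (c, 0) = D.circleAt y.1 (c, 2) := fun h => hy.1 h hc
    rw [if_neg (fun h => h.1 hc), if_pos ⟨hc, hc'⟩, if_pos hc]
    rfl
  · rw [if_pos ⟨hc, hy.2 hc⟩, if_neg hc]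
    rfl

open scoped Classical in
/-- The matrix coefficient of the map induced by changing the smoothing at a crossing, in either
direction. -/
noncomputable def flipCoeff (c : Fin n) (x y : D.EnhancedState) : ℤ :=
  if y.1 = x.1.flip c then D.surgeryCoeff c x y else 0

theorem flipCoeff_of_ne {c : Fin n} {x y : D.EnhancedState} (h : y.1 ≠ x.1.flip c) :
    flipCoeff c x y = 0 := if_neg h

open scoped Classical in
theorem flipCoeff_eq (hA : D.IsAlternating) {c : Fin n} {x y : D.EnhancedState}
    {s : KauffmanState n} (hx : x.1 = s) (h : y.1 = s.flip c) : flipCoeff c x y =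
      if ∀ z, ¬ (D.circ s z (D.fst c) ∨ D.circ s z (D.snd c)) → x.val z = y.val z then
        if D.circ s (D.fst c) (D.snd c) then
          comulCoeff (x.val (D.fst c)) (y.val (D.fst c)) (y.val (D.snd c))
        else mulCoeff (x.val (D.fst c)) (x.val (D.snd c)) (y.val (D.fst c))
      else 0 := by
  subst hx
  rw [flipCoeff, if_pos h, surgeryCoeff_eq hA h]

theorem flipCoeff_upd_of_far (hA : D.IsAlternating) {c : Fin n} {x y : D.EnhancedState}
    (h : y.1 = x.1.flip c) {z : D.Point}
    (hz : ¬ (D.circ x.1 z (D.fst c) ∨ D.circ x.1 z (D.snd c))) :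
    (if x.val z = 1 then flipCoeff c (x.upd z (-1)) y else 0) =
      if y.val z = -1 then flipCoeff c x (y.upd z 1) else 0 := by
  classical
  have hzx : ∀ {w}, (D.circ x.1 w (D.fst c) ∨ D.circ x.1 w (D.snd c)) → ¬ D.circ x.1 w z := by
    intro w hw hwz
    exact hz (hw.imp ((D.circ x.1).trans ((D.circ x.1).symm hwz))
      ((D.circ x.1).trans ((D.circ x.1).symm hwz)))
  have hzy : ∀ {w}, (D.circ x.1 w (D.fst c) ∨ D.circ x.1 w (D.snd c)) → ¬ D.circ y.1 w z := by
    intro w hw hwz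
    rw [h] at hwz
    exact hzx hw ((D.circ x.1).symm ((circ_flip_iff_of_not hz).1 ((D.circ _).symm hwz)))
  have hp : D.circ x.1 (D.fst c) (D.fst c) ∨ D.circ x.1 (D.fst c) (D.snd c) := Or.inl rfl
  have hq : D.circ x.1 (D.snd c) (D.fst c) ∨ D.circ x.1 (D.snd c) (D.snd c) := Or.inr rfl
  rw [flipCoeff_eq hA (y := y) (x := x.upd z (-1)) (s := x.1) rfl h,
    flipCoeff_eq hA (x := x) (y := y.upd z 1) rfl h]
  rw [val_upd_of_not (hzx hp), val_upd_of_not (hzx hq), val_upd_of_not (hzy hp),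
    val_upd_of_not (hzy hq)]
  generalize (if D.circ x.1 (D.fst c) (D.snd c) then _ else _ : ℤ) = r
  rw [← ite_and, ← ite_and]
  refine if_congr ?_ rfl rfl
  have hw : ∀ w, ¬ (D.circ x.1 w (D.fst c) ∨ D.circ x.1 w (D.snd c)) →
      (D.circ y.1 w z ↔ D.circ x.1 w z) := by
    intro w hw
    rw [h, circ_flip_iff_of_not hw]
  constructor
  · rintro ⟨h1, h2⟩
    have h3 := h2 z hz
    rw [val_upd_self] at h3
    refine ⟨h3.symm, fun w hwf => ?_⟩
    by_cases hwz : D.circ x.1 w z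
    · rw [val_upd_of_circ ((hw w hwf).2 hwz), val_congr hwz, h1]
    · rw [val_upd_of_not (mt (hw w hwf).1 hwz), ← h2 w hwf, val_upd_of_not hwz]
  · rintro ⟨h1, h2⟩
    have h3 := h2 z hz
    rw [val_upd_self] at h3
    refine ⟨h3, fun w hwf => ?_⟩
    by_cases hwz : D.circ x.1 w z
    · rw [val_upd_of_circ hwz, val_congr ((hw w hwf).2 hwz), h1]
    · rw [val_upd_of_not hwz, h2 w hwf, val_upd_of_not (mt (hw w hwf).1 hwz)]

/-- These four identities express that `m` and `Δ` are linear over multiplication by `v_{-1}` on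
either tensor factor. -/
theorem mulCoeff_upd_left (a b d : ℤˣ) : (if a = 1 then mulCoeff (-1) b d else 0) =
    if d = -1 then mulCoeff a b 1 else 0 := by
  revert a b d; decide

theorem mulCoeff_upd_right (a b d : ℤˣ) : (if b = 1 then mulCoeff a (-1) d else 0) =
    if d = -1 then mulCoeff a b 1 else 0 := by
  revert a b d; decide

theorem comulCoeff_upd_left (a b d : ℤˣ) : (if a = 1 then comulCoeff (-1) b d else 0) =
    if b = -1 then comulCoeff a 1 d else 0 := by
  revert a b d; decide

theorem comulCoeff_upd_right (a b d : ℤˣ) : (if a = 1 then comulCoeff (-1) b d else 0) =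
    if d = -1 then comulCoeff a b 1 else 0 := by
  revert a b d; decide

theorem flipCoeff_upd_of_near (hA : D.IsAlternating) {c : Fin n} {x y : D.EnhancedState}
    (h : y.1 = x.1.flip c) {z : D.Point} (hz : z = D.fst c ∨ z = D.snd c) :
    (if x.val z = 1 then flipCoeff c (x.upd z (-1)) y else 0) =
      if y.val z = -1 then flipCoeff c x (y.upd z 1) else 0 := by
  classical
  rw [flipCoeff_eq hA (y := y) (x := x.upd z (-1)) (s := x.1) rfl h,
    flipCoeff_eq hA (x := x) (y := y.upd z 1) rfl h]
  have hx : ∀ w, ¬ (D.circ x.1 w (D.fst c) ∨ D.circ x.1 w (D.snd c)) → ¬ D.circ x.1 w z := by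
    rintro w hw hwz
    rcases hz with rfl | rfl <;> tauto
  have hy : ∀ w, ¬ (D.circ x.1 w (D.fst c) ∨ D.circ x.1 w (D.snd c)) → ¬ D.circ y.1 w z := by
    intro w hw
    rw [h, circ_flip_iff_of_not hw]
    exact hx w hw
  by_cases hfar : ∀ w, ¬ (D.circ x.1 w (D.fst c) ∨ D.circ x.1 w (D.snd c)) → x.val w = y.val w
  · rw [if_pos (fun w hw => (val_upd_of_not (hx w hw)).trans (hfar w hw)),
      if_pos (fun w hw => (hfar w hw).trans (val_upd_of_not (hy w hw)).symm)]
    have hfl := hA.circ_flip_iff x.1 c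
    rw [← h] at hfl
    by_cases hc : D.circ x.1 (D.fst c) (D.snd c)
    · have hc' : ¬ D.circ y.1 (D.fst c) (D.snd c) := fun h => hfl.1 h hc
      have hc'' : ¬ D.circ y.1 (D.snd c) (D.fst c) := fun h => hc' ((D.circ _).symm h)
      rw [if_pos hc, if_pos hc]
      rcases hz with rfl | rfl
      · rw [val_upd_self, val_upd_self, val_upd_of_not hc'']
        exact comulCoeff_upd_left _ _ _
      · rw [val_upd_self, val_upd_of_circ hc, val_upd_of_not hc', ← val_congr hc]
        exact comulCoeff_upd_right _ _ _
    · have hc' := hfl.2 hc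
      have hc'' : ¬ D.circ x.1 (D.snd c) (D.fst c) := fun h => hc ((D.circ _).symm h)
      rw [if_neg hc, if_neg hc]
      rcases hz with rfl | rfl
      · rw [val_upd_self, val_upd_self, val_upd_of_not hc'']
        exact mulCoeff_upd_left _ _ _
      · rw [val_upd_self, val_upd_of_circ hc', val_upd_of_not hc, ← val_congr hc']
        exact mulCoeff_upd_right _ _ _
  · have h1 : ¬ ∀ w, ¬ (D.circ x.1 w (D.fst c) ∨ D.circ x.1 w (D.snd c)) →
        (x.upd z (-1)).val w = y.val w :=
      fun h => hfar fun w hw => (val_upd_of_not (hx w hw)).symm.trans (h w hw)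
    have h2 : ¬ ∀ w, ¬ (D.circ x.1 w (D.fst c) ∨ D.circ x.1 w (D.snd c)) →
        x.val w = (y.upd z 1).val w :=
      fun h => hfar fun w hw => (h w hw).trans (val_upd_of_not (hy w hw))
    rw [if_neg h1, if_neg h2, ite_self, ite_self]

/-- The matrix form of `surgery_mulX`. A circle that misses `c` is untouched; otherwise `z` may be
moved to an end of `c`, where the Frobenius identities apply. -/
theorem flipCoeff_upd (hA : D.IsAlternating) (c : Fin n) (x y : D.EnhancedState) (z : D.Point) :
    (if x.val z = 1 then flipCoeff c (x.upd z (-1)) y else 0) =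
      if y.val z = -1 then flipCoeff c x (y.upd z 1) else 0 := by
  by_cases h : y.1 = x.1.flip c
  swap
  · rw [flipCoeff_of_ne (x := x.upd z (-1)) h, flipCoeff_of_ne (y := y.upd z 1) h]
    simp
  by_cases hz : D.circ x.1 z (D.fst c) ∨ D.circ x.1 z (D.snd c)
  swap
  · exact flipCoeff_upd_of_far hA h hz
  -- In one of the two states both ends lie on the same circle, so the other state decides which end
  -- to take.
  obtain ⟨w, hw, hxw, hyw⟩ : ∃ w, (w = D.fst c ∨ w = D.snd c) ∧ D.circ x.1 z w ∧
      D.circ y.1 z w := by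
    have hz' := circ_or_flip_iff.2 hz
    have hfl := hA.circ_flip_iff x.1 c
    rw [← h] at hfl hz'
    by_cases hc : D.circ x.1 (D.fst c) (D.snd c)
    · rcases hz' with hz' | hz'
      · exact ⟨_, Or.inl rfl, hz.elim id fun k => (D.circ _).trans k ((D.circ _).symm hc), hz'⟩
      · exact ⟨_, Or.inr rfl, hz.elim (fun k => (D.circ _).trans k hc) id, hz'⟩
    · have hc' := hfl.2 hc
      rcases hz with hz | hz
      · exact ⟨_, Or.inl rfl, hz, hz'.elim id fun k => (D.circ _).trans k ((D.circ _).symm hc')⟩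
      · exact ⟨_, Or.inr rfl, hz, hz'.elim (fun k => (D.circ _).trans k hc') id⟩
  rw [val_congr hxw, upd_congr hxw, val_congr hyw, upd_congr hyw]
  exact flipCoeff_upd_of_near hA h hw

/-- The sum of the labels of an enhanced state. -/
noncomputable def labelSum (x : D.EnhancedState) : ℤ := ∑ a : D.Circle x.1, (x.2 a : ℤ)

/-- Both `m` and `Δ` have degree `-1`, and circles away from `c` contribute equally to both sums. -/
theorem labelSum_of_flipCoeff_ne_zero (hA : D.IsAlternating) {c : Fin n} {x y : D.EnhancedState}
    (h : flipCoeff c x y ≠ 0) : labelSum y + 1 = labelSum x := by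
  have hxy : y.1 = x.1.flip c := by
    by_contra hne
    exact h (flipCoeff_of_ne hne)
  rw [flipCoeff_eq hA rfl hxy] at h
  have hfar : ∀ z, ¬ (D.circ x.1 z (D.fst c) ∨ D.circ x.1 z (D.snd c)) → x.val z = y.val z := by
    by_contra hne
    exact h (if_neg hne)
  rw [if_pos hfar] at h
  by_cases hc : D.circ x.1 (D.fst c) (D.snd c)
  · have hg := hA.circ_eq_glue_flip hc
    have hc' : ¬ D.circ y.1 (D.fst c) (D.snd c) := by
      rw [hxy, hA.circ_flip_iff]
      exact not_not.2 hc
    rw [← hxy] at hg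
    have := sum_glue (D.pt_surjective y.1) (D.pt_surjective x.1) (p := D.fst c) (q := D.snd c) hc'
      hg (fun a => (y.2 a : ℤ)) (fun a => (x.2 a : ℤ)) (fun z h1 h2 => by
        have h3 : ¬ (D.circ y.1 z (D.fst c) ∨ D.circ y.1 z (D.snd c)) := not_or.2 ⟨h1, h2⟩
        rw [hxy, circ_or_flip_iff] at h3
        exact congrArg _ (hfar z h3).symm)
    change labelSum x + (y.val (D.fst c) : ℤ) + (y.val (D.snd c) : ℤ) =
      labelSum y + (x.val (D.fst c) : ℤ) at this
    rw [if_pos hc] at h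
    have key : ∀ a b d : ℤˣ, comulCoeff a b d ≠ 0 → (b : ℤ) + d + 1 = a := by decide
    have := key _ _ _ h
    omega
  · have hg := hA.circ_flip_eq_glue hc
    rw [← hxy] at hg
    have := sum_glue (D.pt_surjective x.1) (D.pt_surjective y.1) (p := D.fst c) (q := D.snd c) hc
      hg (fun a => (x.2 a : ℤ)) (fun a => (y.2 a : ℤ)) (fun z h1 h2 =>
        congrArg _ (hfar z (not_or.2 ⟨h1, h2⟩)))
    change labelSum y + (x.val (D.fst c) : ℤ) + (x.val (D.snd c) : ℤ) =
      labelSum x + (y.val (D.fst c) : ℤ) at this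
    rw [if_neg hc] at h
    have key : ∀ a b d : ℤˣ, mulCoeff a b d ≠ 0 → (d : ℤ) + 1 = a + b := by decide
    have := key _ _ _ h
    omega

end LinkDiagram

/-! ### Operators on the Khovanov complex -/

namespace LinkDiagram

open EnhancedState

variable {n : ℕ} (D : LinkDiagram n) (k : Type) [CommRing k]

/-- The sum of the maps induced by changing the smoothing at a crossing, in either direction. -/
noncomputable def surgery (c : Fin n) : (D.EnhancedState → k) →ₗ[k] (D.EnhancedState → k) :=
  Matrix.mulVecLin (Matrix.of fun y x => (flipCoeff c x y : k))

/-- Multiplication by `v_{-1}` at the circle through a point. -/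
noncomputable def mulX (z : D.Point) : (D.EnhancedState → k) →ₗ[k] (D.EnhancedState → k) where
  toFun φ y := if y.val z = -1 then φ (y.upd z 1) else 0
  map_add' φ ψ := by
    funext y
    simp only [Pi.add_apply]
    split_ifs <;> simp
  map_smul' r φ := by
    funext y
    simp only [Pi.smul_apply, RingHom.id_apply]
    split_ifs <;> simp

/-- Multiplication by a function of the Kauffman state. -/
noncomputable def mulState (g : KauffmanState n → k) :
    (D.EnhancedState → k) →ₗ[k] (D.EnhancedState → k) :=
  LinearMap.mulLeft k fun y => g y.1

variable {D k}

theorem surgery_apply (c : Fin n) (φ : D.EnhancedState → k) (y : D.EnhancedState) :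
    D.surgery k c φ y = ∑ x, (flipCoeff c x y : k) * φ x := rfl

theorem mulX_apply (z : D.Point) (φ : D.EnhancedState → k) (y : D.EnhancedState) :
    D.mulX k z φ y = if y.val z = -1 then φ (y.upd z 1) else 0 := rfl

theorem mulState_apply (g : KauffmanState n → k) (φ : D.EnhancedState → k) (y : D.EnhancedState) :
    D.mulState k g φ y = g y.1 * φ y := rfl

theorem surgery_single (c : Fin n) (x y : D.EnhancedState) :
    D.surgery k c (Pi.single x 1) y = flipCoeff c x y := by
  simp [surgery_apply, Pi.single_apply]

theorem units_ne_one_iff {u : ℤˣ} : u ≠ 1 ↔ u = -1 := by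
  revert u; decide

theorem mulX_single (z : D.Point) (x : D.EnhancedState) : D.mulX k z (Pi.single x 1) =
    if x.val z = 1 then Pi.single (x.upd z (-1)) 1 else 0 := by
  funext y
  rw [mulX_apply, Pi.single_apply]
  by_cases hx : x.val z = 1
  · rw [if_pos hx, Pi.single_apply, ← ite_and]
    refine if_congr ?_ rfl rfl
    rw [eq_comm (a := y), upd_eq_iff hx, and_comm, eq_comm (a := x)]
  · rw [if_neg hx, Pi.zero_apply]
    split_ifs with h1 h2
    · exact absurd (by rw [← h2, val_upd_self]) hx
    · rfl
    · rfl

theorem mulX_mulX_comm (z w : D.Point) (φ : D.EnhancedState → k) :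
    D.mulX k z (D.mulX k w φ) = D.mulX k w (D.mulX k z φ) := by
  funext y
  simp only [mulX_apply]
  by_cases h : D.circ y.1 z w
  · rw [val_upd_of_circ (D.circ y.1 |>.symm h), val_upd_of_circ h]
    simp
  · have h' : ¬ D.circ y.1 w z := fun h' => h ((D.circ y.1).symm h')
    rw [val_upd_of_not h, val_upd_of_not h', upd_comm h, ← ite_and, ← ite_and]
    exact if_congr and_comm rfl rfl

theorem surgery_mulX (hA : D.IsAlternating) (c : Fin n) (z : D.Point) (φ : D.EnhancedState → k) :
    D.surgery k c (D.mulX k z φ) = D.mulX k z (D.surgery k c φ) := by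
  suffices h : D.surgery k c ∘ₗ D.mulX k z = D.mulX k z ∘ₗ D.surgery k c from
    LinearMap.congr_fun h φ
  refine (Pi.basisFun k D.EnhancedState).ext fun x => ?_
  funext y
  rw [Pi.basisFun_apply, LinearMap.comp_apply, LinearMap.comp_apply, mulX_single, mulX_apply,
    surgery_single]
  have := congrArg (Int.cast : ℤ → k) (flipCoeff_upd hA c x y z)
  push_cast at this
  rw [← this]
  split_ifs
  · rw [surgery_single]
  · simp

theorem card_filter_update_one {A : Type*} [Fintype A] [DecidableEq A] (l : A → ℤˣ) {a : A}
    (ha : l a = -1) : (Finset.univ.filter fun b => Function.update l a 1 b = -1).card + 1 =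
      (Finset.univ.filter fun b => l b = -1).card := by
  have : (Finset.univ.filter fun b => Function.update l a 1 b = -1) =
      (Finset.univ.filter fun b => l b = -1).erase a := by
    ext b
    by_cases hb : b = a
    · subst hb
      simp
    · simp [hb]
  rw [this, Finset.card_erase_add_one (by simpa using ha)]

/-- The enhanced states of a Kauffman state are obtained from the one labelled by `v_1` only by
multiplications by `v_{-1}`. -/
theorem eq_on_state_of_comm {F G : (D.EnhancedState → k) →ₗ[k] (D.EnhancedState → k)}
    (hF : ∀ z φ, F (D.mulX k z φ) = D.mulX k z (F φ))
    (hG : ∀ z φ, G (D.mulX k z φ) = D.mulX k z (G φ)) {s : KauffmanState n}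
    (h : F (Pi.single (one s) 1) = G (Pi.single (one s) 1)) {x : D.EnhancedState} (hx : x.1 = s) :
    F (Pi.single x 1) = G (Pi.single x 1) := by
  induction hm : (Finset.univ.filter fun a => x.2 a = -1).card generalizing x with
  | zero =>
    have : x = one s := by
      refine ext_val hx fun z => ?_
      have := (Finset.filter_eq_empty_iff.1 (Finset.card_eq_zero.1 hm))
        (Finset.mem_univ (D.pt x.1 z))
      rw [val_one]
      by_contra hne
      exact this (units_ne_one_iff.1 hne)
    rw [this, h]
  | succ m ih =>
    obtain ⟨a, ha⟩ := Finset.card_pos.1 (by rw [hm]; exact Nat.succ_pos m)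
    obtain ⟨z, rfl⟩ := D.pt_surjective _ a
    have hz : x.val z = -1 := (Finset.mem_filter.1 ha).2
    have hcard : (Finset.univ.filter fun a => (x.upd z 1).2 a = -1).card = m := by
      refine Nat.succ_injective (Eq.trans ?_ hm)
      exact card_filter_update_one x.2 hz
    have := ih (x := x.upd z 1) hx hcard
    have hs := mulX_single (k := k) z (x.upd z 1)
    rw [if_pos val_upd_self, upd_upd, ← hz, upd_val] at hs
    rw [← hs, hF, hG, this]

theorem mulX_single_one_congr {s : KauffmanState n} {z w : D.Point} (h : D.circ s z w) :
    D.mulX k z (Pi.single (one s) 1) = D.mulX k w (Pi.single (one s) 1) := by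
  rw [mulX_single, mulX_single, val_one, val_one, upd_congr (x := one s) h]

-- On units, `m` gives the unit and `Δ` gives X ⊗ 1 + 1 ⊗ X. Together with `eq_on_state_of_comm`
-- this determines the surgery.
open scoped Classical in
theorem surgery_single_one (hA : D.IsAlternating) (c : Fin n) (s : KauffmanState n) :
    D.surgery k c (Pi.single (one s) 1) = if D.circ s (D.fst c) (D.snd c) then
      D.mulX k (D.fst c) (Pi.single (one (s.flip c)) 1) +
        D.mulX k (D.snd c) (Pi.single (one (s.flip c)) 1)
      else Pi.single (one (s.flip c)) 1 := by
  funext y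
  rw [surgery_single]
  by_cases hy : y.1 = s.flip c
  swap
  · rw [flipCoeff_of_ne hy]
    have h1 : ∀ z u, (one (s.flip c)).upd z u ≠ y := by
      rintro z u rfl
      exact hy rfl
    have h2 : y ≠ one (s.flip c) := by
      rintro rfl
      exact hy rfl
    rw [mulX_single, mulX_single, val_one, val_one, if_pos rfl, if_pos rfl]
    split_ifs <;> simp [h2, Ne.symm (h1 _ _)]
  have hnear : ∀ z, (D.circ s z (D.fst c) ∨ D.circ s z (D.snd c)) ↔
      (D.circ y.1 z (D.fst c) ∨ D.circ y.1 z (D.snd c)) := by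
    intro z
    rw [hy, circ_or_flip_iff]
  have hflip := hA.circ_flip_iff s c
  rw [← hy] at hflip
  rw [flipCoeff_eq hA (x := one s) (s := s) rfl hy]
  by_cases hfar : ∀ z, ¬ (D.circ s z (D.fst c) ∨ D.circ s z (D.snd c)) →
      (one s).val z = y.val z
  · rw [if_pos hfar]
    simp only [val_one]
    by_cases hc : D.circ s (D.fst c) (D.snd c)
    · have hc' : ¬ D.circ y.1 (D.fst c) (D.snd c) := fun h => hflip.1 h hc
      have hc'' : ¬ D.circ y.1 (D.snd c) (D.fst c) := fun h => hc' ((D.circ _).symm h)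
      rw [if_pos hc, if_pos hc, Pi.add_apply, mulX_apply, mulX_apply, Pi.single_apply,
        Pi.single_apply]
      have e1 : y.upd (D.fst c) 1 = one (s.flip c) ↔ y.val (D.snd c) = 1 := by
        constructor
        · intro h
          rw [← val_upd_of_not (x := y) (u := 1) hc'', h, val_one]
        · intro h
          refine ext_val hy fun z => ?_
          rw [val_one]
          by_cases h1 : D.circ y.1 z (D.fst c)
          · rw [val_upd_of_circ h1]
          · rw [val_upd_of_not h1]
            by_cases h2 : D.circ y.1 z (D.snd c)
            · rw [val_congr h2, h]
            · exact (hfar z (by rw [hnear]; exact not_or.2 ⟨h1, h2⟩)).symm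
      have e2 : y.upd (D.snd c) 1 = one (s.flip c) ↔ y.val (D.fst c) = 1 := by
        constructor
        · intro h
          rw [← val_upd_of_not (x := y) (u := 1) hc', h, val_one]
        · intro h
          refine ext_val hy fun z => ?_
          rw [val_one]
          by_cases h1 : D.circ y.1 z (D.snd c)
          · rw [val_upd_of_circ h1]
          · rw [val_upd_of_not h1]
            by_cases h2 : D.circ y.1 z (D.fst c)
            · rw [val_congr h2, h]
            · exact (hfar z (by rw [hnear]; exact not_or.2 ⟨h2, h1⟩)).symm
      simp only [e1, e2]
      generalize y.val (D.fst c) = a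
      generalize y.val (D.snd c) = b
      have key : ∀ a b : ℤˣ, comulCoeff 1 a b = (if a = -1 then if b = 1 then 1 else 0 else 0) +
          if b = -1 then if a = 1 then 1 else 0 else 0 := by decide
      rw [key]
      push_cast
      rfl
    · have hc' := hflip.2 hc
      rw [if_neg hc, if_neg hc, Pi.single_apply]
      have e : y = one (s.flip c) ↔ y.val (D.fst c) = 1 := by
        constructor
        · rintro rfl
          rfl
        · intro h
          refine ext_val hy fun z => ?_
          rw [val_one]
          by_cases h1 : D.circ y.1 z (D.fst c)
          · rw [val_congr h1, h]
          · by_cases h2 : D.circ y.1 z (D.snd c)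
            · rw [val_congr h2, ← val_congr hc', h]
            · exact (hfar z (by rw [hnear]; exact not_or.2 ⟨h1, h2⟩)).symm
      simp only [e]
      generalize y.val (D.fst c) = a
      have key : ∀ a : ℤˣ, mulCoeff 1 1 a = if a = 1 then 1 else 0 := by decide
      rw [key]
      push_cast
      rfl
  · rw [if_neg hfar]
    push Not at hfar
    obtain ⟨z, hz, hz1⟩ := hfar
    have hz' := mt (hnear z).2 (not_or.2 hz)
    rw [not_or] at hz'
    have h1 : ∀ w, ¬ D.circ y.1 z w → y.upd w 1 ≠ one (s.flip c) := by
      intro w hw h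
      apply hz1
      rw [← val_upd_of_not (x := y) (u := 1) hw, h, val_one, val_one]
    have h2 : y ≠ one (s.flip c) := by
      rintro rfl
      exact hz1 rfl
    split_ifs
    · simp [mulX_apply, h1 _ hz'.1, h1 _ hz'.2]
    · simp [h2]

/-- Surgeries at different crossings commute. -/
theorem surgery_comm (hA : D.IsAlternating) (c c' : Fin n)
    (φ : D.EnhancedState → k) :
    D.surgery k c' (D.surgery k c φ) = D.surgery k c (D.surgery k c' φ) := by
  suffices h : D.surgery k c' ∘ₗ D.surgery k c = D.surgery k c ∘ₗ D.surgery k c' from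
    LinearMap.congr_fun h φ
  refine (Pi.basisFun k D.EnhancedState).ext fun x => ?_
  rw [Pi.basisFun_apply]
  refine eq_on_state_of_comm (s := x.1) ?_ ?_ ?_ rfl
  · intro z φ
    simp only [LinearMap.comp_apply, surgery_mulX hA]
  · intro z φ
    simp only [LinearMap.comp_apply, surgery_mulX hA]
  generalize x.1 = s
  rw [LinearMap.comp_apply, LinearMap.comp_apply, surgery_single_one hA, surgery_single_one hA]
  classical
  -- Both orders of surgery end with the same number of circles, which rules out most combinations
  -- of splits and merges.
  have e : ∀ s c, (Nat.card (D.Circle (s.flip c)) : ℤ) = Nat.card (D.Circle s) +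
      if D.circ s (D.fst c) (D.snd c) then 1 else -1 := by
    intro s c
    split_ifs with h
    · have := hA.card_circle_flip_of_circ h
      omega
    · have := hA.card_circle_flip_of_not h
      omega
  have e1 := e (s.flip c) c'
  have e2 := e (s.flip c') c
  rw [e s c] at e1
  rw [KauffmanState.flip_comm, e s c'] at e2
  have hu : (one ((s.flip c').flip c) : D.EnhancedState) = one ((s.flip c).flip c') := by
    rw [KauffmanState.flip_comm]
  by_cases a : D.circ s (D.fst c) (D.snd c) <;> by_cases b : D.circ s (D.fst c') (D.snd c') <;>
    by_cases b' : D.circ (s.flip c) (D.fst c') (D.snd c') <;>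
    by_cases a' : D.circ (s.flip c') (D.fst c) (D.snd c)
  all_goals
    simp only [a, b, a', b', if_true, if_false] at e1 e2
    try omega
  all_goals
    simp only [if_true, if_false, a, b, map_add, surgery_mulX hA, surgery_single_one hA, a', b', hu]
  · rw [mulX_mulX_comm (D.fst c) (D.fst c'), mulX_mulX_comm (D.fst c) (D.snd c'),
      mulX_mulX_comm (D.snd c) (D.fst c'), mulX_mulX_comm (D.snd c) (D.snd c')]
    abel
  -- Both orders split a circle and merge it again. The second crossing joins the pieces separated
  -- by the first, so its two ends lie on these pieces, one on each.
  · have h1 := hA.circ_flip_eq_glue b'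
    have hs : Setoid.glue (D.circ (s.flip c)) (D.fst c) (D.snd c) (D.fst c') (D.snd c') := by
      rw [← hA.circ_eq_glue_flip a]
      exact b
    have hle : D.circ (s.flip c) ≤ D.circ ((s.flip c).flip c') := by
      rw [h1]
      exact Setoid.le_glue
    have hc' : D.circ ((s.flip c).flip c') (D.fst c') (D.snd c') := by
      rw [h1]
      exact Setoid.glue_pair
    rcases hs with h | ⟨h, h'⟩ | ⟨h, h'⟩
    · exact absurd h b'
    · rw [mulX_single_one_congr (z := D.fst c') (w := D.fst c) (hle h),
        mulX_single_one_congr (z := D.snd c') (w := D.snd c) (hle h')]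
    · rw [mulX_single_one_congr (z := D.fst c') (w := D.snd c) (hle h),
        mulX_single_one_congr (z := D.snd c') (w := D.fst c) (hle h'), add_comm]
  -- Both orders merge and then split. The ends of `c` and the ends of `c'` mark the same two final
  -- circles.
  · have hs : Setoid.glue (D.circ ((s.flip c).flip c')) (D.fst c') (D.snd c') (D.fst c)
        (D.snd c) := by
      rw [← hA.circ_eq_glue_flip b']
      exact (hA.circ_flip_iff s c).2 a
    rcases hs with h | ⟨h, h'⟩ | ⟨h, h'⟩
    · rw [KauffmanState.flip_comm, hA.circ_flip_iff] at h
      exact absurd a' h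
    · rw [mulX_single_one_congr (z := D.fst c) (w := D.fst c') h,
        mulX_single_one_congr (z := D.snd c) (w := D.snd c') h']
    · rw [mulX_single_one_congr (z := D.fst c) (w := D.snd c') h,
        mulX_single_one_congr (z := D.snd c) (w := D.fst c') h', add_comm]

end LinkDiagram

/-! ### Chains with prescribed support, and reduced chains -/

namespace LinkDiagram

open EnhancedState

variable {n : ℕ} (D : LinkDiagram n) (k : Type) [CommRing k]

/-- The chains supported on the enhanced states whose Kauffman state satisfies `Q` and whose labels
add up to `l`. -/
def degSupp (Q : KauffmanState n → Prop) (l : ℤ) : Submodule k (D.EnhancedState → k) where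
  carrier := {φ | ∀ y : D.EnhancedState, ¬ (Q y.1 ∧ labelSum y = l) → φ y = 0}
  add_mem' h h' y hy := by rw [Pi.add_apply, h y hy, h' y hy, add_zero]
  zero_mem' _ _ := rfl
  smul_mem' r φ h y hy := by rw [Pi.smul_apply, h y hy, smul_zero]

/-- The chains as in `degSupp` for which moreover the circle through the base point has label
`v_{-1}`. -/
noncomputable def redSupp (Q : KauffmanState n → Prop) (l : ℤ) (b : D.Point) :
    Submodule k (D.EnhancedState → k) :=
  D.degSupp k Q l ⊓ LinearMap.ker (D.mulX k b)

variable {D k} {Q Q' : KauffmanState n → Prop} {l : ℤ} {b : D.Point} {φ : D.EnhancedState → k}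
  {c c' : Fin n}

theorem mem_degSupp : φ ∈ D.degSupp k Q l ↔
    ∀ y : D.EnhancedState, ¬ (Q y.1 ∧ labelSum y = l) → φ y = 0 := Iff.rfl

/-- Multiplication by `v_{-1}` is injective on chains with base label `v_1` and kills the rest. In
kernel form, stability of reduced chains under surgery follows at once from `surgery_mulX`. -/
theorem mulX_eq_zero_iff : D.mulX k b φ = 0 ↔ ∀ y : D.EnhancedState, y.val b ≠ -1 → φ y = 0 := by
  constructor
  · intro h y hy
    have hy' : y.val b = 1 := by
      by_contra h'
      exact hy (units_ne_one_iff.1 h')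
    have := congrFun h (y.upd b (-1))
    rwa [mulX_apply, if_pos val_upd_self, upd_upd, ← hy', upd_val] at this
  · intro h
    funext y
    rw [mulX_apply, Pi.zero_apply]
    split_ifs
    · exact h _ (by rw [val_upd_self]; decide)
    · rfl

theorem mem_redSupp : φ ∈ D.redSupp k Q l b ↔
    ∀ y : D.EnhancedState, ¬ (Q y.1 ∧ labelSum y = l ∧ y.val b = -1) → φ y = 0 := by
  rw [redSupp, Submodule.mem_inf, LinearMap.mem_ker, mulX_eq_zero_iff, mem_degSupp]
  constructor
  · rintro ⟨h1, h2⟩ y hy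
    by_cases hb : y.val b = -1
    · exact h1 y (by tauto)
    · exact h2 y hb
  · intro h
    exact ⟨fun y hy => h y (by tauto), fun y hy => h y (by tauto)⟩

theorem redSupp_le_degSupp : D.redSupp k Q l b ≤ D.degSupp k Q l := inf_le_left

theorem mulX_of_mem_redSupp (h : φ ∈ D.redSupp k Q l b) : D.mulX k b φ = 0 :=
  (Submodule.mem_inf.1 h).2

theorem mulState_mulX (g : KauffmanState n → k) (z : D.Point) :
    D.mulX k z (D.mulState k g φ) = D.mulState k g (D.mulX k z φ) := by
  funext y
  simp only [mulX_apply, mulState_apply]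
  split_ifs
  · rfl
  · rw [mul_zero]

theorem mulState_mem_degSupp {g : KauffmanState n → k} (h : φ ∈ D.degSupp k Q l)
    (hg : ∀ s, Q s → g s ≠ 0 → Q' s) : D.mulState k g φ ∈ D.degSupp k Q' l := by
  intro y hy
  rw [mulState_apply]
  by_cases hQ : Q y.1 ∧ labelSum y = l
  · by_cases h0 : g y.1 = 0
    · rw [h0, zero_mul]
    · exact absurd ⟨hg _ hQ.1 h0, hQ.2⟩ hy
  · rw [h y hQ, mul_zero]

theorem mulState_mem_redSupp {g : KauffmanState n → k} (h : φ ∈ D.redSupp k Q l b)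
    (hg : ∀ s, Q s → g s ≠ 0 → Q' s) : D.mulState k g φ ∈ D.redSupp k Q' l b := by
  refine ⟨mulState_mem_degSupp (redSupp_le_degSupp h) hg, ?_⟩
  change D.mulX k b _ = 0
  rw [mulState_mulX, mulX_of_mem_redSupp h, map_zero]

theorem surgery_mem_degSupp (hA : D.IsAlternating) (h : φ ∈ D.degSupp k Q l)
    (hQ : ∀ s, Q (s.flip c) → Q' s) : D.surgery k c φ ∈ D.degSupp k Q' (l - 1) := by
  intro y hy
  rw [surgery_apply]
  refine Finset.sum_eq_zero fun x _ => ?_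
  by_cases h0 : flipCoeff c x y = 0
  · rw [h0, Int.cast_zero, zero_mul]
  · have hxy : y.1 = x.1.flip c := by
      by_contra hne
      exact h0 (flipCoeff_of_ne hne)
    rw [h x, mul_zero]
    rintro ⟨hx, hl⟩
    refine hy ⟨hQ _ ?_, ?_⟩
    · rwa [hxy, KauffmanState.flip_flip]
    · have := labelSum_of_flipCoeff_ne_zero hA h0
      omega

theorem surgery_mem_redSupp (hA : D.IsAlternating) (h : φ ∈ D.redSupp k Q l b)
    (hQ : ∀ s, Q (s.flip c) → Q' s) : D.surgery k c φ ∈ D.redSupp k Q' (l - 1) b := by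
  refine ⟨surgery_mem_degSupp hA (redSupp_le_degSupp h) hQ, ?_⟩
  change D.mulX k b _ = 0
  rw [← surgery_mulX hA, mulX_of_mem_redSupp h, map_zero]

theorem surgery_mulState (g : KauffmanState n → k) :
    D.surgery k c (D.mulState k g φ) =
      D.mulState k (fun s => g (s.flip c)) (D.surgery k c φ) := by
  funext y
  rw [mulState_apply, surgery_apply, surgery_apply, Finset.mul_sum]
  refine Finset.sum_congr rfl fun x _ => ?_
  rw [mulState_apply]
  by_cases hxy : y.1 = x.1.flip c
  · rw [hxy, KauffmanState.flip_flip]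
    ring
  · rw [flipCoeff_of_ne hxy]
    simp

theorem mulState_mulState (g g' : KauffmanState n → k) :
    D.mulState k g (D.mulState k g' φ) = D.mulState k (fun s => g s * g' s) φ := by
  funext y
  simp only [mulState_apply, mul_assoc]

/-! ### Splitting a circle through the base point -/

open scoped Classical in
/-- The end of the under-strand at `c` which is not joined to the base point, in a state in which
the other one is. -/
noncomputable def otherEnd (D : LinkDiagram n) (c : Fin n) (b : D.Point) (t : KauffmanState n) :
    D.Point :=
  if D.circ t b (D.fst c) then D.snd c else D.fst c

section Split

variable (hA : D.IsAlternating) {s t : KauffmanState n} (ht : t = s.flip c)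
  (h₁ : D.circ s (D.fst c) (D.snd c)) (h₂ : D.circ s b (D.fst c))
include hA ht h₁ h₂

omit hA h₁ in
theorem otherEnd_cases : (D.circ t b (D.fst c) ∧ D.otherEnd c b t = D.snd c) ∨
    (D.circ t b (D.snd c) ∧ D.otherEnd c b t = D.fst c) := by
  have : D.circ t b (D.fst c) ∨ D.circ t b (D.snd c) := by
    rw [ht, circ_or_flip_iff]
    exact Or.inl h₂
  unfold otherEnd
  split_ifs with h
  · exact Or.inl ⟨h, rfl⟩
  · exact Or.inr ⟨this.resolve_left h, rfl⟩

theorem not_circ_otherEnd : ¬ D.circ t b (D.otherEnd c b t) := by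
  have hc : ¬ D.circ t (D.fst c) (D.snd c) := by
    rw [ht, hA.circ_flip_iff]
    exact not_not.2 h₁
  rcases otherEnd_cases ht h₂ with ⟨h, e⟩ | ⟨h, e⟩ <;> rw [e] <;> intro h'
  · exact hc ((D.circ t).trans ((D.circ t).symm h) h')
  · exact hc ((D.circ t).trans ((D.circ t).symm h') h)

omit h₂ in
theorem circ_le_of_split : D.circ t ≤ D.circ s := by
  rw [hA.circ_eq_glue_flip h₁, ht]
  exact Setoid.le_glue

omit hA ht in
theorem near_iff_circ_base (z : D.Point) :
    (D.circ s z (D.fst c) ∨ D.circ s z (D.snd c)) ↔ D.circ s z b := by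
  constructor
  · rintro (h | h)
    · exact (D.circ s).trans h ((D.circ s).symm h₂)
    · exact (D.circ s).trans h ((D.circ s).symm ((D.circ s).trans h₂ h₁))
  · exact fun h => Or.inl ((D.circ s).trans h h₂)

omit hA in
theorem circ_base_iff (z : D.Point) :
    D.circ s z b ↔ D.circ t z b ∨ D.circ t z (D.otherEnd c b t) := by
  rw [← near_iff_circ_base h₁ h₂, ← circ_or_flip_iff, ← ht]
  rcases otherEnd_cases ht h₂ with ⟨h, e⟩ | ⟨h, e⟩ <;> rw [e]
  · exact or_congr ⟨fun k => (D.circ t).trans k ((D.circ t).symm h), fun k => (D.circ t).trans k h⟩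
      Iff.rfl
  · rw [or_comm]
    exact or_congr ⟨fun k => (D.circ t).trans k ((D.circ t).symm h), fun k => (D.circ t).trans k h⟩
      Iff.rfl

omit hA in
theorem circ_of_not_circ_base {z w : D.Point} (hz : ¬ D.circ s z b) (h : D.circ s z w) :
    D.circ t z w := by
  rw [ht]
  refine circ_flip_of_not ?_ h
  rwa [near_iff_circ_base h₁ h₂]

-- Cocommutativity of `Δ`, and commutativity of `m` in `flipCoeff_merge`, allow naming the two new
-- circles by `b` and `otherEnd` instead of by the ends of `c`.
open scoped Classical in
theorem flipCoeff_split {x y : D.EnhancedState} (hx : x.1 = s) (hy : y.1 = t) :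
    flipCoeff c x y = if ∀ z, ¬ D.circ s z b → x.val z = y.val z then
      comulCoeff (x.val b) (y.val b) (y.val (D.otherEnd c b t)) else 0 := by
  rw [flipCoeff_eq hA hx (hy.trans ht), if_pos h₁]
  refine if_congr (forall_congr' fun z => ?_) ?_ rfl
  · rw [near_iff_circ_base h₁ h₂]
  · have key : ∀ u v w, comulCoeff u v w = comulCoeff u w v := by decide
    have hxb : x.val b = x.val (D.fst c) := val_congr_of_eq hx h₂
    rw [hxb]
    rcases otherEnd_cases ht h₂ with ⟨h, e⟩ | ⟨h, e⟩
    · rw [e, val_congr_of_eq hy h]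
    · rw [e, val_congr_of_eq hy h, key]

open scoped Classical in
theorem flipCoeff_merge {x y : D.EnhancedState} (hx : x.1 = s) (hy : y.1 = t) :
    flipCoeff c y x = if ∀ z, ¬ D.circ s z b → x.val z = y.val z then
      mulCoeff (y.val b) (y.val (D.otherEnd c b t)) (x.val b) else 0 := by
  have hc : ¬ D.circ t (D.fst c) (D.snd c) := by
    rw [ht, hA.circ_flip_iff]
    exact not_not.2 h₁
  have hst : x.1 = t.flip c := by rw [hx, ht, KauffmanState.flip_flip]
  rw [flipCoeff_eq hA hy hst, if_neg hc]
  refine if_congr (forall_congr' fun z => ?_) ?_ rfl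
  · rw [ht, circ_or_flip_iff, near_iff_circ_base h₁ h₂, eq_comm]
  · have key : ∀ u v w, mulCoeff u v w = mulCoeff v u w := by decide
    have hxb : x.val b = x.val (D.fst c) := val_congr_of_eq hx h₂
    rw [hxb]
    rcases otherEnd_cases ht h₂ with ⟨h, e⟩ | ⟨h, e⟩
    · rw [e, val_congr_of_eq hy h]
    · rw [e, val_congr_of_eq hy h, key]

end Split

open scoped Classical in
/-- Split the circle through the base point, giving the label `u` to the new circle not containing
the base point. -/
noncomputable def splitBase (c : Fin n) (b : D.Point) (u : ℤˣ) (x : D.EnhancedState) :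
    D.EnhancedState :=
  ofVal (x.1.flip c) fun z =>
    if D.circ (x.1.flip c) z (D.otherEnd c b (x.1.flip c)) then u else x.val z

open scoped Classical in
/-- Merge two circles to a circle through the base point, giving it the label `v_{-1}`. -/
noncomputable def mergeBase (c : Fin n) (b : D.Point) (y : D.EnhancedState) : D.EnhancedState :=
  ofVal (y.1.flip c) fun z => if D.circ (y.1.flip c) z b then -1 else y.val z

section Split

variable (hA : D.IsAlternating) {s t : KauffmanState n} (ht : t = s.flip c)
  (h₁ : D.circ s (D.fst c) (D.snd c)) (h₂ : D.circ s b (D.fst c))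
include hA ht h₁ h₂

open scoped Classical in
theorem val_splitBase {u : ℤˣ} {x : D.EnhancedState} (hx : x.1 = s) (z : D.Point) :
    (splitBase c b u x).val z = if D.circ t z (D.otherEnd c b t) then u else x.val z := by
  subst hx
  subst ht
  refine val_ofVal (fun z w h => ?_) z
  refine if_congr ⟨fun k => (D.circ _).trans ((D.circ _).symm h) k,
    fun k => (D.circ _).trans h k⟩ rfl (val_congr (circ_le_of_split hA rfl h₁ h))

open scoped Classical in
omit hA in
theorem val_mergeBase {y : D.EnhancedState} (hy : y.1 = t) (z : D.Point) :
    (mergeBase c b y).val z = if D.circ s z b then -1 else y.val z := by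
  have hs : s = y.1.flip c := by rw [hy, ht, KauffmanState.flip_flip]
  subst hy
  subst hs
  refine val_ofVal (fun z w h => ?_) z
  by_cases hz : D.circ (y.1.flip c) z b
  · rw [if_pos hz, if_pos ((D.circ _).trans ((D.circ _).symm h) hz)]
  · rw [if_neg hz, if_neg (fun k => hz ((D.circ _).trans h k))]
    exact val_congr (circ_of_not_circ_base ht h₁ h₂ hz h)

theorem eq_splitBase {u : ℤˣ} {x y : D.EnhancedState} (hx : x.1 = s) (hy : y.1 = t)
    (hfar : ∀ z, ¬ D.circ s z b → x.val z = y.val z) (hb : y.val b = x.val b)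
    (hu : y.val (D.otherEnd c b t) = u) : y = splitBase c b u x := by
  refine ext_val (by rw [hy, ht, ← hx]; rfl) fun z => ?_
  rw [val_splitBase hA ht h₁ h₂ hx]
  split_ifs with h
  · rw [val_congr_of_eq hy h, hu]
  · by_cases hz : D.circ s z b
    · rw [val_congr_of_eq hx hz, ← hb]
      refine val_congr ?_
      rw [hy]
      exact ((circ_base_iff ht h₁ h₂ z).1 hz).resolve_right h
    · exact (hfar z hz).symm

omit hA in
theorem eq_mergeBase {x y : D.EnhancedState} (hx : x.1 = s) (hy : y.1 = t)
    (hfar : ∀ z, ¬ D.circ s z b → x.val z = y.val z) (hb : x.val b = -1) :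
    x = mergeBase c b y := by
  refine ext_val ?_ fun z => ?_
  · rw [hx]
    change s = y.1.flip c
    rw [hy, ht, KauffmanState.flip_flip]
  · rw [val_mergeBase ht h₁ h₂ hy]
    split_ifs with h
    · rw [val_congr_of_eq hx h, hb]
    · exact hfar z h

theorem splitBase_far {u : ℤˣ} {x : D.EnhancedState} (hx : x.1 = s) {z : D.Point}
    (hz : ¬ D.circ s z b) : x.val z = (splitBase c b u x).val z := by
  rw [val_splitBase hA ht h₁ h₂ hx, if_neg]
  exact fun h => hz ((circ_base_iff ht h₁ h₂ z).2 (Or.inr h))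

theorem val_splitBase_base {u : ℤˣ} {x : D.EnhancedState} (hx : x.1 = s) :
    (splitBase c b u x).val b = x.val b := by
  rw [val_splitBase hA ht h₁ h₂ hx, if_neg (not_circ_otherEnd hA ht h₁ h₂)]

theorem val_splitBase_otherEnd {u : ℤˣ} {x : D.EnhancedState} (hx : x.1 = s) :
    (splitBase c b u x).val (D.otherEnd c b t) = u := by
  rw [val_splitBase hA ht h₁ h₂ hx, if_pos ((D.circ t).refl _)]

omit hA in
theorem mergeBase_far {y : D.EnhancedState} (hy : y.1 = t) {z : D.Point}
    (hz : ¬ D.circ s z b) : (mergeBase c b y).val z = y.val z := by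
  rw [val_mergeBase ht h₁ h₂ hy, if_neg hz]

omit hA in
theorem val_mergeBase_base {y : D.EnhancedState} (hy : y.1 = t) :
    (mergeBase c b y).val b = -1 := by
  rw [val_mergeBase ht h₁ h₂ hy, if_pos ((D.circ s).refl _)]

omit hA h₁ h₂ in
theorem mergeBase_fst {y : D.EnhancedState} (hy : y.1 = t) : (mergeBase c b y).1 = s := by
  change y.1.flip c = s
  rw [hy, ht, KauffmanState.flip_flip]

theorem flipCoeff_splitBase {x : D.EnhancedState} (hx : x.1 = s) (hb : x.val b = -1) :
    flipCoeff c x (splitBase c b (-1) x) = 1 := by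
  have hy : (splitBase c b (-1) x).1 = t := by rw [ht, ← hx]; rfl
  rw [flipCoeff_split hA ht h₁ h₂ hx hy, if_pos fun z hz => splitBase_far hA ht h₁ h₂ hx hz,
    val_splitBase_base hA ht h₁ h₂ hx, val_splitBase_otherEnd hA ht h₁ h₂ hx, hb]
  decide

theorem flipCoeff_mergeBase {y : D.EnhancedState} (hy : y.1 = t) (hb : y.val b = -1)
    (hu : y.val (D.otherEnd c b t) = 1) : flipCoeff c y (mergeBase c b y) = 1 := by
  rw [flipCoeff_merge hA ht h₁ h₂ (mergeBase_fst ht hy) hy,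
    if_pos fun z hz => mergeBase_far ht h₁ h₂ hy hz,
    val_mergeBase_base ht h₁ h₂ hy, hu, hb]
  decide

/-- On reduced chains splitting the circle through the base point is an isomorphism to the chains
giving the label `v_{-1}` to the new circle. -/
theorem surgery_apply_split (hφ : D.mulX k b φ = 0) {y : D.EnhancedState} (hy : y.1 = t)
    (hb : y.val b = -1) : D.surgery k c φ y =
      if y.val (D.otherEnd c b t) = -1 then φ (mergeBase c b y) else 0 := by
  classical
  rw [mulX_eq_zero_iff] at hφ
  have hs : s = y.1.flip c := by rw [hy, ht, KauffmanState.flip_flip]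
  rw [surgery_apply, Finset.sum_eq_single (mergeBase c b y)]
  · rw [flipCoeff_split hA ht h₁ h₂ (mergeBase_fst ht hy) hy,
      if_pos fun z hz => mergeBase_far ht h₁ h₂ hy hz,
      val_mergeBase_base ht h₁ h₂ hy, hb]
    generalize y.val (D.otherEnd c b t) = u
    have key : ∀ u, comulCoeff (-1) (-1) u = if u = -1 then 1 else 0 := by decide
    rw [key]
    split_ifs <;> simp
  · intro x _ hne
    by_cases hx : x.1 = s
    · by_cases hxb : x.val b = -1
      · rw [flipCoeff_split hA ht h₁ h₂ hx hy, if_neg, Int.cast_zero, zero_mul]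
        exact fun hfar => hne (eq_mergeBase ht h₁ h₂ hx hy hfar hxb)
      · rw [hφ x hxb, mul_zero]
    · rw [flipCoeff_of_ne, Int.cast_zero, zero_mul]
      intro h
      apply hx
      rw [hs, h, KauffmanState.flip_flip]
  · intro h
    exact absurd (Finset.mem_univ _) h

/-- On reduced chains merging a circle to the circle through the base point is the restriction to
the chains giving the label `v_1` to this circle. -/
theorem surgery_apply_merge (hφ : D.mulX k b φ = 0) {x : D.EnhancedState} (hx : x.1 = s)
    (hb : x.val b = -1) : D.surgery k c φ x = φ (splitBase c b 1 x) := by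
  classical
  rw [mulX_eq_zero_iff] at hφ
  have hy' : (splitBase c b 1 x).1 = t := by rw [ht, ← hx]; rfl
  rw [surgery_apply, Finset.sum_eq_single (splitBase c b 1 x)]
  · rw [flipCoeff_merge hA ht h₁ h₂ hx hy', if_pos fun z hz => splitBase_far hA ht h₁ h₂ hx hz,
      val_splitBase_base hA ht h₁ h₂ hx, val_splitBase_otherEnd hA ht h₁ h₂ hx, hb]
    have key : mulCoeff (-1) 1 (-1) = 1 := by decide
    rw [key, Int.cast_one, one_mul]
  · intro y _ hne
    by_cases hy : y.1 = t
    · by_cases hyb : y.val b = -1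
      · rw [flipCoeff_merge hA ht h₁ h₂ hx hy]
        split_ifs with hfar
        · have hu : y.val (D.otherEnd c b t) ≠ 1 := fun hu =>
            hne (eq_splitBase hA ht h₁ h₂ hx hy hfar (by rw [hyb, hb]) hu)
          rw [hyb, hb, units_ne_one_iff.1 hu]
          have key : mulCoeff (-1) (-1) (-1) = 0 := by decide
          rw [key, Int.cast_zero, zero_mul]
        · rw [Int.cast_zero, zero_mul]
      · rw [hφ y hyb, mul_zero]
    · rw [flipCoeff_of_ne, Int.cast_zero, zero_mul]
      intro h
      apply hy
      rw [ht, ← hx, h, KauffmanState.flip_flip]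
  · intro h
    exact absurd (Finset.mem_univ _) h

end Split

/-! ### The exact sequence of a split and a merge -/

section Exact

variable (hA : D.IsAlternating)
  (hQ : ∀ s, Q s → D.circ s (D.fst c) (D.snd c) ∧ D.circ s b (D.fst c))
include hA hQ

/-- With base label `v_{-1}`, splitting is φ ↦ φ ⊗ `v_{-1}` and merging back reads off the
coefficient of `v_1` on the new circle. This lemma and the next three give exactness of 0 → C → C ⊗
A → C → 0. -/
theorem eq_zero_of_surgery_split (hφ : φ ∈ D.redSupp k Q l b) (h : D.surgery k c φ = 0) :
    φ = 0 := by
  funext x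
  by_cases hx : Q x.1 ∧ labelSum x = l ∧ x.val b = -1
  swap
  · exact mem_redSupp.1 hφ x hx
  obtain ⟨h₁, h₂⟩ := hQ _ hx.1
  have hb := val_splitBase_base hA rfl h₁ h₂ (u := -1) rfl
  have hy := congrFun h (splitBase c b (-1) x)
  rw [surgery_apply_split hA rfl h₁ h₂ (mulX_of_mem_redSupp hφ) rfl (hb.trans hx.2.2),
    if_pos (val_splitBase_otherEnd hA rfl h₁ h₂ rfl), ← eq_mergeBase rfl h₁ h₂ rfl rfl
      (fun z hz => splitBase_far hA rfl h₁ h₂ rfl hz) hx.2.2] at hy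
  exact hy

theorem surgery_surgery_split (hφ : φ ∈ D.redSupp k Q l b) :
    D.surgery k c (D.surgery k c φ) = 0 := by
  funext x
  have h' := surgery_mem_redSupp (Q' := fun s => Q (s.flip c)) hA hφ fun _ h => h
  have h'' := surgery_mem_redSupp (Q' := Q) hA h' fun s h => by
    rwa [KauffmanState.flip_flip] at h
  by_cases hx : Q x.1 ∧ labelSum x = l - 1 - 1 ∧ x.val b = -1
  swap
  · exact mem_redSupp.1 h'' x hx
  obtain ⟨h₁, h₂⟩ := hQ _ hx.1
  have hb := val_splitBase_base hA rfl h₁ h₂ (u := 1) (x := x) rfl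
  rw [surgery_apply_merge hA rfl h₁ h₂ (mulX_of_mem_redSupp h') rfl hx.2.2,
    surgery_apply_split hA rfl h₁ h₂ (mulX_of_mem_redSupp hφ) rfl (hb.trans hx.2.2),
    val_splitBase_otherEnd hA rfl h₁ h₂ rfl, if_neg (by decide), Pi.zero_apply]

theorem exists_surgery_merge (hφ : φ ∈ D.redSupp k Q l b) :
    ∃ ψ ∈ D.redSupp k (fun s => Q (s.flip c)) (l + 1) b, D.surgery k c ψ = φ := by
  classical
  -- The preimage is φ ⊗ `v_1`.
  set ψ : D.EnhancedState → k := fun y => if y.val b = -1 ∧ y.val (D.otherEnd c b y.1) = 1 then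
    φ (mergeBase c b y) else 0 with hψ
  have hmem : ψ ∈ D.redSupp k (fun s => Q (s.flip c)) (l + 1) b := by
    rw [mem_redSupp] at hφ ⊢
    intro y hy
    rw [hψ]
    dsimp only
    split_ifs with h
    · refine hφ _ ?_
      rintro ⟨hq, hl, -⟩
      obtain ⟨h₁, h₂⟩ := hQ _ hq
      have ht : y.1 = (mergeBase c b y).1.flip c := (KauffmanState.flip_flip _).symm
      have := labelSum_of_flipCoeff_ne_zero hA (c := c) (x := y) (y := mergeBase c b y) (by
        rw [flipCoeff_mergeBase hA ht h₁ h₂ rfl h.1 h.2]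
        decide)
      exact hy ⟨hq, by omega, h.1⟩
    · rfl
  refine ⟨ψ, hmem, ?_⟩
  have h' := surgery_mem_redSupp (Q' := Q) hA hmem fun s h => by
    rwa [KauffmanState.flip_flip] at h
  rw [add_sub_cancel_right] at h'
  funext x
  by_cases hx : Q x.1 ∧ labelSum x = l ∧ x.val b = -1
  swap
  · rw [mem_redSupp.1 h' x hx, mem_redSupp.1 hφ x hx]
  obtain ⟨h₁, h₂⟩ := hQ _ hx.1
  rw [surgery_apply_merge hA rfl h₁ h₂ (mulX_of_mem_redSupp hmem) rfl hx.2.2, hψ]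
  dsimp only
  rw [if_pos ⟨(val_splitBase_base hA rfl h₁ h₂ rfl).trans hx.2.2,
    val_splitBase_otherEnd hA rfl h₁ h₂ rfl⟩, ← eq_mergeBase rfl h₁ h₂ rfl rfl
      (fun z hz => splitBase_far hA rfl h₁ h₂ rfl hz) hx.2.2]

theorem exists_surgery_split (hφ : φ ∈ D.redSupp k (fun s => Q (s.flip c)) l b)
    (h : D.surgery k c φ = 0) : ∃ ψ ∈ D.redSupp k Q (l + 1) b, D.surgery k c ψ = φ := by
  classical
  -- The preimage is the coefficient of `v_{-1}` on the new circle; the coefficient of `v_1`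
  -- vanishes because φ is killed by merging.
  set ψ : D.EnhancedState → k := fun x => if Q x.1 ∧ x.val b = -1 then
    φ (splitBase c b (-1) x) else 0 with hψ
  have hmem : ψ ∈ D.redSupp k Q (l + 1) b := by
    rw [mem_redSupp] at hφ ⊢
    intro x hx
    rw [hψ]
    dsimp only
    split_ifs with h
    · refine hφ _ ?_
      rintro ⟨-, hl, -⟩
      obtain ⟨h₁, h₂⟩ := hQ _ h.1
      have := labelSum_of_flipCoeff_ne_zero hA (c := c) (x := x) (y := splitBase c b (-1) x) (by
        rw [flipCoeff_splitBase hA rfl h₁ h₂ rfl h.2]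
        decide)
      exact hx ⟨h.1, by omega, h.2⟩
    · rfl
  refine ⟨ψ, hmem, ?_⟩
  have h' := surgery_mem_redSupp (Q' := fun s => Q (s.flip c)) hA hmem fun _ h => h
  rw [add_sub_cancel_right] at h'
  funext y
  by_cases hy : Q (y.1.flip c) ∧ labelSum y = l ∧ y.val b = -1
  swap
  · rw [mem_redSupp.1 h' y hy, mem_redSupp.1 hφ y hy]
  obtain ⟨h₁, h₂⟩ := hQ _ hy.1
  have ht : y.1 = (y.1.flip c).flip c := (KauffmanState.flip_flip _).symm
  have hmb := val_mergeBase_base ht h₁ h₂ rfl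
  have hmf : ∀ z, ¬ D.circ (y.1.flip c) z b → (mergeBase c b y).val z = y.val z :=
    fun z hz => mergeBase_far ht h₁ h₂ rfl hz
  rw [surgery_apply_split hA ht h₁ h₂ (mulX_of_mem_redSupp hmem) rfl hy.2.2]
  split_ifs with hu
  · rw [hψ]
    dsimp only
    rw [if_pos ⟨hy.1, hmb⟩, ← eq_splitBase hA ht h₁ h₂ rfl rfl hmf (hy.2.2.trans hmb.symm) hu]
  · have hu' : y.val (D.otherEnd c b y.1) = 1 := by
      by_contra h1
      exact hu (units_ne_one_iff.1 h1)
    have := congrFun h (mergeBase c b y)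
    rw [surgery_apply_merge hA ht h₁ h₂ (mulX_of_mem_redSupp hφ) rfl hmb,
      ← eq_splitBase hA ht h₁ h₂ rfl rfl hmf (hy.2.2.trans hmb.symm) hu'] at this
    exact this.symm

end Exact

end LinkDiagram

/-! ### The differential -/

namespace LinkDiagram

open EnhancedState

variable {n : ℕ} (D : LinkDiagram n) (k : Type) [CommRing k]

/-- The sign attached to changing the smoothing at a crossing. -/
def crossingSign (c : Fin n) (s : KauffmanState n) : k :=
  (-1) ^ (Finset.univ.filter fun c' => c' < c ∧ s c' = true).card

/-- The map of `surgery` with the signs of the Khovanov complex. -/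
noncomputable def signedSurgery (c : Fin n) : (D.EnhancedState → k) →ₗ[k] (D.EnhancedState → k) :=
  D.mulState k (crossingSign k c) ∘ₗ D.surgery k c

/-- The part of the Khovanov differential changing the smoothing at `c`. -/
noncomputable def edgeMap (c : Fin n) : (D.EnhancedState → k) →ₗ[k] (D.EnhancedState → k) :=
  D.mulState k (fun s => if s c = true then 1 else 0) ∘ₗ D.signedSurgery k c

/-- The part of the Khovanov differential changing smoothings at crossings in `F`. -/
noncomputable def partialDiff (F : Finset (Fin n)) :
    (D.EnhancedState → k) →ₗ[k] (D.EnhancedState → k) :=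
  ∑ c ∈ F, D.edgeMap k c

variable {D k} {Q Q' : KauffmanState n → Prop} {l : ℤ} {b : D.Point} {φ : D.EnhancedState → k}
  {c c' : Fin n} {F : Finset (Fin n)}

theorem crossingSign_mul_self (c : Fin n) (s : KauffmanState n) :
    crossingSign k c s * crossingSign k c s = 1 := by
  rw [crossingSign, ← mul_pow]
  simp

/-- Only crossings preceding `c'` enter the sign. For `c = c'` this lets the sign be read off at the
target as well as at the source. -/
theorem crossingSign_flip_of_not_lt {s : KauffmanState n} (h : ¬ c < c') :
    crossingSign k c' (s.flip c) = crossingSign k c' s := by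
  unfold crossingSign
  congr 2
  refine Finset.filter_congr fun d _ => and_congr_right fun hd => ?_
  rw [KauffmanState.flip_apply_of_ne]
  rintro rfl
  exact h hd

theorem crossingSign_flip_of_lt {s : KauffmanState n} (h : c < c') :
    crossingSign k c' (s.flip c) = -crossingSign k c' s := by
  wlog hc : s c = false generalizing s
  · have := this (s := s.flip c) (by
      rw [KauffmanState.flip_apply_self]
      simpa using hc)
    rw [KauffmanState.flip_flip] at this
    rw [this, neg_neg]
  · have : (Finset.univ.filter fun d => d < c' ∧ s.flip c d = true) =
        insert c (Finset.univ.filter fun d => d < c' ∧ s d = true) := by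
      ext d
      by_cases hd : d = c
      · subst hd
        simp [h, KauffmanState.flip_apply_self, hc]
      · simp [KauffmanState.flip_apply_of_ne s hd, hd]
    rw [crossingSign, this, Finset.card_insert_of_notMem (by simp [hc]), pow_succ, crossingSign]
    ring

theorem mulState_crossingSign_cancel (c : Fin n) (φ : D.EnhancedState → k) :
    D.mulState k (crossingSign k c) (D.mulState k (crossingSign k c) φ) = φ := by
  rw [mulState_mulState]
  funext y
  rw [mulState_apply, crossingSign_mul_self, one_mul]

theorem signedSurgery_apply (c : Fin n) (φ : D.EnhancedState → k) :
    D.signedSurgery k c φ = D.mulState k (crossingSign k c) (D.surgery k c φ) := rfl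

theorem surgery_eq_signedSurgery (c : Fin n) (φ : D.EnhancedState → k) :
    D.surgery k c φ = D.mulState k (crossingSign k c) (D.signedSurgery k c φ) := by
  rw [signedSurgery_apply, mulState_crossingSign_cancel]

theorem signedSurgery_eq_zero_iff : D.signedSurgery k c φ = 0 ↔ D.surgery k c φ = 0 := by
  constructor
  · intro h
    rw [surgery_eq_signedSurgery, h, map_zero]
  · intro h
    rw [signedSurgery_apply, h, map_zero]

theorem signedSurgery_mulState (g : KauffmanState n → k) :
    D.signedSurgery k c (D.mulState k g φ) =
      D.mulState k (fun s => g (s.flip c)) (D.signedSurgery k c φ) := by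
  rw [signedSurgery_apply, surgery_mulState, mulState_mulState, signedSurgery_apply,
    mulState_mulState]
  simp only [mul_comm]

theorem signedSurgery_mulX (hA : D.IsAlternating) (z : D.Point) :
    D.signedSurgery k c (D.mulX k z φ) = D.mulX k z (D.signedSurgery k c φ) := by
  rw [signedSurgery_apply, surgery_mulX hA, ← mulState_mulX]
  rfl

theorem signedSurgery_mem_degSupp (hA : D.IsAlternating) (h : φ ∈ D.degSupp k Q l)
    (hQ : ∀ s, Q (s.flip c) → Q' s) : D.signedSurgery k c φ ∈ D.degSupp k Q' (l - 1) :=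
  mulState_mem_degSupp (surgery_mem_degSupp hA h hQ) fun _ h _ => h

theorem signedSurgery_mem_redSupp (hA : D.IsAlternating) (h : φ ∈ D.redSupp k Q l b)
    (hQ : ∀ s, Q (s.flip c) → Q' s) : D.signedSurgery k c φ ∈ D.redSupp k Q' (l - 1) b :=
  mulState_mem_redSupp (surgery_mem_redSupp hA h hQ) fun _ h _ => h

/-- Surgeries commute, and of the two crossings exactly the earlier one affects the sign of the
other. -/
theorem signedSurgery_anticomm (hA : D.IsAlternating) (hc : c ≠ c') (φ : D.EnhancedState → k) :
    D.signedSurgery k c (D.signedSurgery k c' φ) =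
      -D.signedSurgery k c' (D.signedSurgery k c φ) := by
  rw [signedSurgery_apply c' φ, signedSurgery_mulState, signedSurgery_apply c φ,
    signedSurgery_mulState, signedSurgery_apply, signedSurgery_apply, surgery_comm hA c' c]
  funext y
  simp only [mulState_apply, Pi.neg_apply]
  rcases lt_or_gt_of_ne hc with h | h
  · rw [crossingSign_flip_of_lt h, crossingSign_flip_of_not_lt h.not_gt]
    ring
  · rw [crossingSign_flip_of_lt h, crossingSign_flip_of_not_lt h.not_gt]
    ring

section Exact

variable (hA : D.IsAlternating)
  (hQ : ∀ s, Q s → D.circ s (D.fst c) (D.snd c) ∧ D.circ s b (D.fst c))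

include hA hQ

theorem eq_zero_of_signedSurgery_split (hφ : φ ∈ D.redSupp k Q l b)
    (h : D.signedSurgery k c φ = 0) : φ = 0 :=
  eq_zero_of_surgery_split hA hQ hφ (signedSurgery_eq_zero_iff.1 h)

theorem signedSurgery_signedSurgery_split (hφ : φ ∈ D.redSupp k Q l b) :
    D.signedSurgery k c (D.signedSurgery k c φ) = 0 := by
  rw [signedSurgery_eq_zero_iff, signedSurgery_apply, surgery_mulState,
    surgery_surgery_split hA hQ hφ, map_zero]

theorem exists_signedSurgery_merge (hφ : φ ∈ D.redSupp k Q l b) :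
    ∃ ψ ∈ D.redSupp k (fun s => Q (s.flip c)) (l + 1) b, D.signedSurgery k c ψ = φ := by
  obtain ⟨ψ, hψ, h⟩ := exists_surgery_merge hA hQ
    (mulState_mem_redSupp (g := crossingSign k c) hφ fun _ h _ => h)
  exact ⟨ψ, hψ, by rw [signedSurgery_apply, h, mulState_crossingSign_cancel]⟩

theorem exists_signedSurgery_split (hφ : φ ∈ D.redSupp k (fun s => Q (s.flip c)) l b)
    (h : D.signedSurgery k c φ = 0) :
    ∃ ψ ∈ D.redSupp k Q (l + 1) b, D.signedSurgery k c ψ = φ := by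
  obtain ⟨ψ, hψ, h⟩ := exists_surgery_split hA hQ
    (mulState_mem_redSupp (g := crossingSign k c) hφ fun _ h _ => h)
    (by rw [surgery_mulState, signedSurgery_eq_zero_iff.1 h, map_zero])
  exact ⟨ψ, hψ, by rw [signedSurgery_apply, h, mulState_crossingSign_cancel]⟩

end Exact

theorem edgeMap_apply (c : Fin n) (φ : D.EnhancedState → k) : D.edgeMap k c φ =
    D.mulState k (fun s => if s c = true then 1 else 0) (D.signedSurgery k c φ) := rfl

theorem edgeMap_edgeMap_self (c : Fin n) (φ : D.EnhancedState → k) :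
    D.edgeMap k c (D.edgeMap k c φ) = 0 := by
  rw [edgeMap_apply, edgeMap_apply, signedSurgery_mulState, mulState_mulState]
  funext y
  rw [mulState_apply, KauffmanState.flip_apply_self]
  cases y.1 c <;> simp

theorem signedSurgery_edgeMap (hA : D.IsAlternating) (hc : c ≠ c') (φ : D.EnhancedState → k) :
    D.signedSurgery k c (D.edgeMap k c' φ) = -D.edgeMap k c' (D.signedSurgery k c φ) := by
  rw [edgeMap_apply, signedSurgery_mulState, signedSurgery_anticomm hA hc, edgeMap_apply, map_neg]
  simp only [KauffmanState.flip_apply_of_ne _ hc.symm]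

theorem mulState_edgeMap {g : KauffmanState n → k} (hg : ∀ s : KauffmanState n, g (s.flip c) = g s)
    (φ : D.EnhancedState → k) :
    D.edgeMap k c (D.mulState k g φ) = D.mulState k g (D.edgeMap k c φ) := by
  rw [edgeMap_apply, signedSurgery_mulState, mulState_mulState, edgeMap_apply, mulState_mulState]
  simp only [hg, mul_comm]

theorem edgeMap_anticomm (hA : D.IsAlternating) (hc : c ≠ c') (φ : D.EnhancedState → k) :
    D.edgeMap k c (D.edgeMap k c' φ) = -D.edgeMap k c' (D.edgeMap k c φ) := by
  rw [edgeMap_apply c, signedSurgery_edgeMap hA hc, map_neg, edgeMap_apply c φ, mulState_edgeMap]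
  intro s
  rw [KauffmanState.flip_apply_of_ne s hc]

theorem edgeMap_mulX (hA : D.IsAlternating) (z : D.Point) :
    D.edgeMap k c (D.mulX k z φ) = D.mulX k z (D.edgeMap k c φ) := by
  rw [edgeMap_apply, signedSurgery_mulX hA, ← mulState_mulX]
  rfl

theorem partialDiff_apply (F : Finset (Fin n)) (φ : D.EnhancedState → k) :
    D.partialDiff k F φ = ∑ c ∈ F, D.edgeMap k c φ := by
  rw [partialDiff, LinearMap.sum_apply]

theorem partialDiff_insert (hc : c ∉ F) (φ : D.EnhancedState → k) :
    D.partialDiff k (insert c F) φ = D.partialDiff k F φ + D.edgeMap k c φ := by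
  rw [partialDiff_apply, Finset.sum_insert hc, partialDiff_apply, add_comm]

theorem partialDiff_mulX (hA : D.IsAlternating) (z : D.Point) :
    D.partialDiff k F (D.mulX k z φ) = D.mulX k z (D.partialDiff k F φ) := by
  simp only [partialDiff_apply, map_sum, edgeMap_mulX hA]

/-- As `signedSurgery` acts in both directions, the maps from the `0`-half to the `1`-half and back
are both chain maps up to sign; the inductive steps use both. -/
theorem signedSurgery_partialDiff (hA : D.IsAlternating) (hc : c ∉ F) (φ : D.EnhancedState → k) :
    D.signedSurgery k c (D.partialDiff k F φ) = -D.partialDiff k F (D.signedSurgery k c φ) := by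
  rw [partialDiff_apply, partialDiff_apply, map_sum, ← Finset.sum_neg_distrib]
  refine Finset.sum_congr rfl fun c' hc' => signedSurgery_edgeMap hA ?_ φ
  rintro rfl
  exact hc hc'

theorem partialDiff_partialDiff (hA : D.IsAlternating) (F : Finset (Fin n))
    (φ : D.EnhancedState → k) : D.partialDiff k F (D.partialDiff k F φ) = 0 := by
  induction F using Finset.induction_on with
  | empty => rfl
  | insert c F hc ih =>
    have h : D.partialDiff k F (D.edgeMap k c φ) = -D.edgeMap k c (D.partialDiff k F φ) := by
      rw [partialDiff_apply, partialDiff_apply, map_sum, ← Finset.sum_neg_distrib]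
      refine Finset.sum_congr rfl fun c' hc' => edgeMap_anticomm hA ?_ φ
      rintro rfl
      exact hc hc'
    rw [partialDiff_insert hc, partialDiff_insert hc, map_add, map_add, ih, h,
      edgeMap_edgeMap_self]
    abel

/-! ### Subcubes of the cube of states -/

/-- The states with `i` one-smoothings which differ from a given state at crossings in `F` only. -/
def subcube (F : Finset (Fin n)) (T : KauffmanState n) (i : ℤ) (s : KauffmanState n) : Prop :=
  (∀ c ∉ F, s c = T c) ∧ (s.oneCount : ℤ) = i

variable {T : KauffmanState n} {i : ℤ}

theorem oneCount_flip_of_true {s : KauffmanState n} (h : s c = true) :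
    (s.flip c).oneCount + 1 = s.oneCount := by
  have := KauffmanState.oneCount_flip (s := s.flip c) (c := c) (by
    rw [KauffmanState.flip_apply_self, h, Bool.not_true])
  rw [KauffmanState.flip_flip] at this
  exact this.symm

theorem edgeMap_mem_degSupp (hA : D.IsAlternating) (hc : c ∈ F)
    (h : φ ∈ D.degSupp k (subcube F T i) l) :
    D.edgeMap k c φ ∈ D.degSupp k (subcube F T (i + 1)) (l - 1) := by
  rw [edgeMap_apply]
  refine mulState_mem_degSupp (Q := fun s => subcube F T i (s.flip c))
    (signedSurgery_mem_degSupp hA h fun _ h => h) ?_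
  intro s hs h0
  have hsc : s c = true := by
    by_contra hne
    exact h0 (if_neg hne)
  refine ⟨fun d hd => ?_, ?_⟩
  · rw [← hs.1 d hd, KauffmanState.flip_apply_of_ne]
    rintro rfl
    exact hd hc
  · have := oneCount_flip_of_true hsc
    have := hs.2
    omega

theorem partialDiff_mem_degSupp (hA : D.IsAlternating) (h : φ ∈ D.degSupp k (subcube F T i) l) :
    D.partialDiff k F φ ∈ D.degSupp k (subcube F T (i + 1)) (l - 1) := by
  rw [partialDiff_apply]
  exact Submodule.sum_mem _ fun c hc => edgeMap_mem_degSupp hA hc h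

theorem partialDiff_mem_redSupp (hA : D.IsAlternating) (h : φ ∈ D.redSupp k (subcube F T i) l b) :
    D.partialDiff k F φ ∈ D.redSupp k (subcube F T (i + 1)) (l - 1) b := by
  refine ⟨partialDiff_mem_degSupp hA (redSupp_le_degSupp h), ?_⟩
  change D.mulX k b _ = 0
  rw [← partialDiff_mulX hA, mulX_of_mem_redSupp h, map_zero]

theorem redSupp_mono (h : ∀ s, Q s → Q' s) : D.redSupp k Q l b ≤ D.redSupp k Q' l b := by
  intro φ hφ
  rw [mem_redSupp] at hφ ⊢
  exact fun y hy => hφ y fun hy' => hy ⟨h _ hy'.1, hy'.2⟩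

theorem subcube_update_iff (hc : c ∉ F) {β : Bool} {s : KauffmanState n} :
    subcube F (Function.update T c β) i s ↔ subcube (insert c F) T i s ∧ s c = β := by
  constructor
  · rintro ⟨h, h'⟩
    refine ⟨⟨fun d hd => ?_, h'⟩, by simpa using h c hc⟩
    rw [Finset.mem_insert, not_or] at hd
    rw [h d hd.2, Function.update_of_ne hd.1]
  · rintro ⟨⟨h, h'⟩, h''⟩
    refine ⟨fun d hd => ?_, h'⟩
    by_cases hdc : d = c
    · subst hdc
      simpa using h''
    · rw [h d (by simp [hd, hdc]), Function.update_of_ne hdc]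

theorem subcube_false_flip (hc : c ∉ F) {s : KauffmanState n} :
    subcube F (Function.update T c false) i (s.flip c) ↔
      subcube F (Function.update T c true) (i + 1) s := by
  rw [subcube_update_iff hc, subcube_update_iff hc, KauffmanState.flip_apply_self]
  unfold subcube
  constructor
  · rintro ⟨⟨h, h'⟩, h''⟩
    have hs : s c = true := by simpa using h''
    refine ⟨⟨fun d hd => ?_, ?_⟩, hs⟩
    · rw [← h d hd, KauffmanState.flip_apply_of_ne]
      rintro rfl
      exact hd (Finset.mem_insert_self _ _)
    · have := oneCount_flip_of_true hs
      omega
  · rintro ⟨⟨h, h'⟩, hs⟩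
    refine ⟨⟨fun d hd => ?_, ?_⟩, by simpa using hs⟩
    · rw [← h d hd, KauffmanState.flip_apply_of_ne]
      rintro rfl
      exact hd (Finset.mem_insert_self _ _)
    · have := oneCount_flip_of_true hs
      omega

theorem subcube_true_flip (hc : c ∉ F) {s : KauffmanState n} :
    subcube F (Function.update T c true) (i + 1) (s.flip c) ↔
      subcube F (Function.update T c false) i s := by
  rw [← subcube_false_flip hc, KauffmanState.flip_flip]

/-- With `edgeMap_of_true`, this presents the complex of `insert c F` as the cone of `signedSurgery`
from the `0`-half to the `1`-half. -/
theorem edgeMap_of_false (hA : D.IsAlternating) (hc : c ∉ F)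
    (h : φ ∈ D.redSupp k (subcube F (Function.update T c false) i) l b) :
    D.edgeMap k c φ = D.signedSurgery k c φ := by
  have h' := signedSurgery_mem_redSupp (Q' := subcube F (Function.update T c true) (i + 1)) hA h
    fun s hs => (subcube_false_flip hc).1 hs
  funext y
  rw [edgeMap_apply, mulState_apply]
  split_ifs with hy
  · rw [one_mul]
  · rw [zero_mul, mem_redSupp.1 h' y]
    rintro ⟨hy', -⟩
    exact hy ((subcube_update_iff hc).1 hy').2

theorem edgeMap_of_true (hA : D.IsAlternating) (hc : c ∉ F)
    (h : φ ∈ D.redSupp k (subcube F (Function.update T c true) (i + 1)) l b) :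
    D.edgeMap k c φ = 0 := by
  have h' := signedSurgery_mem_redSupp (Q' := subcube F (Function.update T c false) i) hA h
    fun s hs => (subcube_true_flip hc).1 hs
  funext y
  rw [edgeMap_apply, mulState_apply]
  split_ifs with hy
  · rw [mem_redSupp.1 h' y, mul_zero, Pi.zero_apply]
    rintro ⟨hy', -⟩
    have := ((subcube_update_iff hc).1 hy').2
    simp [hy] at this
  · rw [zero_mul, Pi.zero_apply]

theorem eq_zero_of_add_eq_zero {i' l' : ℤ} {ψ : D.EnhancedState → k} (hc : c ∉ F)
    (h : φ ∈ D.redSupp k (subcube F (Function.update T c false) i) l b)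
    (h' : ψ ∈ D.redSupp k (subcube F (Function.update T c true) i') l' b) (h0 : φ + ψ = 0) :
    φ = 0 ∧ ψ = 0 := by
  have hφ : φ = 0 := by
    funext y
    by_cases hy : y.1 c = true
    · refine mem_redSupp.1 h y fun hy' => ?_
      have := ((subcube_update_iff hc).1 hy'.1).2
      simp [hy] at this
    · have h1 := congrFun h0 y
      have h2 : ψ y = 0 :=
        mem_redSupp.1 h' y fun hy' => hy ((subcube_update_iff hc).1 hy'.1).2
      rwa [Pi.add_apply, h2, add_zero] at h1
  rw [hφ, zero_add] at h0
  exact ⟨hφ, h0⟩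

theorem exists_add_eq (hc : c ∉ F) (h : φ ∈ D.redSupp k (subcube (insert c F) T i) l b) :
    ∃ φ₀ ∈ D.redSupp k (subcube F (Function.update T c false) i) l b,
      ∃ φ₁ ∈ D.redSupp k (subcube F (Function.update T c true) i) l b, φ = φ₀ + φ₁ := by
  have key : ∀ β : Bool, D.mulState k (fun s => if s c = β then 1 else 0) φ ∈
      D.redSupp k (subcube F (Function.update T c β) i) l b := by
    intro β
    refine mulState_mem_redSupp h fun s hs h0 => (subcube_update_iff hc).2 ⟨hs, ?_⟩
    by_contra hne
    exact h0 (if_neg hne)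
  refine ⟨_, key false, _, key true, ?_⟩
  funext y
  rw [Pi.add_apply, mulState_apply, mulState_apply]
  cases y.1 c <;> simp

theorem redSupp_update_le (hc : c ∉ F) {β : Bool} :
    D.redSupp k (subcube F (Function.update T c β) i) l b ≤
      D.redSupp k (subcube (insert c F) T i) l b :=
  redSupp_mono fun _ hs => ((subcube_update_iff hc).1 hs).1

/-! ### Vanishing of the reduced homology off one diagonal -/

theorem labelSum_of_one_circle (hT : T ∈ D.oneCircleStates) {y : D.EnhancedState} (hy : y.1 = T)
    (hb : y.val b = -1) : labelSum y = -1 := by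
  subst hy
  obtain ⟨h1, -⟩ := Nat.card_eq_one_iff_unique.1 hT
  rw [labelSum, Fintype.sum_subsingleton _ (D.pt y.1 b)]
  have : y.2 (D.pt y.1 b) = -1 := hb
  rw [this]
  rfl

/-- The reduced homology of the subcube of states differing from `T` at crossings in `F` vanishes
in all bidegrees off the diagonal of `n₁`. -/
def ReducedThin (D : LinkDiagram n) (k : Type) [CommRing k] (b : D.Point) (n₁ : ℤ)
    (F : Finset (Fin n)) (T : KauffmanState n) : Prop :=
  ∀ i l : ℤ, l ≠ i - n₁ - 1 → ∀ φ ∈ D.redSupp k (subcube F T i) l b, D.partialDiff k F φ = 0 →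
    ∃ ψ ∈ D.redSupp k (subcube F T (i - 1)) (l + 1) b, D.partialDiff k F ψ = φ

/-- The only reduced generator has one circle labelled `v_{-1}`, so `i = n₁` and `l = -1`, which is
on the diagonal. -/
theorem reducedThin_empty (hT : T ∈ D.oneCircleStates) :
    ReducedThin D k b T.oneCount ∅ T := by
  intro i l hl φ hφ _
  have h0 : φ = 0 := by
    funext y
    refine mem_redSupp.1 hφ y ?_
    rintro ⟨⟨h1, h2⟩, h3, h4⟩
    have hy : y.1 = T := funext fun c => h1 c (by simp)
    rw [labelSum_of_one_circle hT hy h4] at h3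
    rw [hy] at h2
    omega
  exact ⟨0, Submodule.zero_mem _, by rw [h0, map_zero]⟩

section Step

variable (hA : D.IsAlternating) {n₁ : ℤ} (hc : c ∉ F)
include hA hc

theorem partialDiff_insert_false {ψ : D.EnhancedState → k}
    (h : ψ ∈ D.redSupp k (subcube F (Function.update T c false) i) l b) :
    D.partialDiff k (insert c F) ψ = D.partialDiff k F ψ + D.signedSurgery k c ψ := by
  rw [partialDiff_insert hc, edgeMap_of_false hA hc h]

theorem partialDiff_insert_true {ψ : D.EnhancedState → k}
    (h : ψ ∈ D.redSupp k (subcube F (Function.update T c true) i) l b) :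
    D.partialDiff k (insert c F) ψ = D.partialDiff k F ψ := by
  rw [← sub_add_cancel i 1] at h
  rw [partialDiff_insert hc, edgeMap_of_true hA hc h, add_zero]

theorem signedSurgery_mem_true {ψ : D.EnhancedState → k}
    (h : ψ ∈ D.redSupp k (subcube F (Function.update T c false) i) l b) :
    D.signedSurgery k c ψ ∈
      D.redSupp k (subcube F (Function.update T c true) (i + 1)) (l - 1) b :=
  signedSurgery_mem_redSupp hA h fun _ hs => (subcube_false_flip hc).1 hs

theorem signedSurgery_mem_false {ψ : D.EnhancedState → k}
    (h : ψ ∈ D.redSupp k (subcube F (Function.update T c true) i) l b) :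
    D.signedSurgery k c ψ ∈
      D.redSupp k (subcube F (Function.update T c false) (i - 1)) (l - 1) b := by
  refine signedSurgery_mem_redSupp hA h fun s hs => ?_
  rw [← sub_add_cancel i 1] at hs
  exact (subcube_true_flip hc).1 hs

theorem partialDiff_eq_zero_split {φ₀ φ₁ : D.EnhancedState → k}
    (h₀ : φ₀ ∈ D.redSupp k (subcube F (Function.update T c false) i) l b)
    (h₁ : φ₁ ∈ D.redSupp k (subcube F (Function.update T c true) i) l b)
    (h : D.partialDiff k (insert c F) (φ₀ + φ₁) = 0) :
    D.partialDiff k F φ₀ = 0 ∧ D.partialDiff k F φ₁ + D.signedSurgery k c φ₀ = 0 := by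
  rw [map_add, partialDiff_insert_false hA hc h₀, partialDiff_insert_true hA hc h₁] at h
  refine eq_zero_of_add_eq_zero hc (partialDiff_mem_redSupp hA h₀)
    (Submodule.add_mem _ (partialDiff_mem_redSupp hA h₁) (signedSurgery_mem_true hA hc h₀)) ?_
  rw [← h]
  abel

/-- The long exact sequence of the cone. No shift occurs, because `i` counts all `1`-smoothings,
including the one at `c`. -/
theorem reducedThin_insert (h₀ : ReducedThin D k b n₁ F (Function.update T c false))
    (h₁ : ReducedThin D k b n₁ F (Function.update T c true)) :
    ReducedThin D k b n₁ (insert c F) T := by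
  intro i l hl φ hφ hd
  obtain ⟨φ₀, hφ₀, φ₁, hφ₁, rfl⟩ := exists_add_eq hc hφ
  obtain ⟨hd₀, hd₁⟩ := partialDiff_eq_zero_split hA hc hφ₀ hφ₁ hd
  obtain ⟨ψ₀, hψ₀, rfl⟩ := h₀ i l hl φ₀ hφ₀ hd₀
  have hs := signedSurgery_mem_true hA hc hψ₀
  rw [sub_add_cancel, add_sub_cancel_right] at hs
  obtain ⟨ψ₁, hψ₁, h⟩ := h₁ i l hl (φ₁ - D.signedSurgery k c ψ₀) (Submodule.sub_mem _ hφ₁ hs) (by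
    rw [signedSurgery_partialDiff hA hc] at hd₁
    rw [map_sub, sub_eq_add_neg, hd₁])
  refine ⟨ψ₀ + ψ₁, Submodule.add_mem _ (redSupp_update_le hc hψ₀)
    (redSupp_update_le hc hψ₁), ?_⟩
  rw [map_add, partialDiff_insert_false hA hc hψ₀, partialDiff_insert_true hA hc hψ₁, h]
  abel

/-- The case of a crossing at which changing the smoothing always splits the circle through the
base point. -/
theorem reducedThin_insert_of_split
    (hs : ∀ s i, subcube F (Function.update T c false) i s →
      D.circ s (D.fst c) (D.snd c) ∧ D.circ s b (D.fst c))
    (h₀ : ReducedThin D k b n₁ F (Function.update T c false)) :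
    ReducedThin D k b n₁ (insert c F) T := by
  intro i l hl φ hφ hd
  obtain ⟨φ₀, hφ₀, φ₁, hφ₁, rfl⟩ := exists_add_eq hc hφ
  obtain ⟨hd₀, hd₁⟩ := partialDiff_eq_zero_split hA hc hφ₀ hφ₁ hd
  have hflip : ∀ j, (fun s : KauffmanState n => subcube F (Function.update T c false) j (s.flip c)) =
      subcube F (Function.update T c true) (j + 1) := fun j =>
    funext fun s => propext (subcube_false_flip hc)
  -- Write d for `partialDiff` over `F` and σ for `signedSurgery`. The merge σφ₁ is a cycle of the
  -- `0`-half, since dσφ₁ = -σdφ₁ = σσφ₀ = 0, and its bidegree is moved parallel to the diagonal.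
  obtain ⟨χ, hχ, hχd⟩ := h₀ (i - 1) (l - 1) (by omega) (D.signedSurgery k c φ₁)
    (signedSurgery_mem_false hA hc hφ₁) (by
      rw [← neg_eq_zero, ← signedSurgery_partialDiff hA hc, eq_neg_of_add_eq_zero_left hd₁,
        map_neg, signedSurgery_signedSurgery_split hA (fun s => hs s _) hφ₀, neg_zero])
  rw [sub_add_cancel] at hχ
  -- Lifting χ = σχ₁ makes φ₁ + dχ₁ a chain killed by merging, hence of the form σψ₀.
  obtain ⟨χ₁, hχ₁, rfl⟩ := exists_signedSurgery_merge hA (fun s => hs s _) hχ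
  rw [hflip, sub_add_cancel] at hχ₁
  have hm := partialDiff_mem_redSupp hA hχ₁
  rw [sub_add_cancel, add_sub_cancel_right] at hm
  have hmem := Submodule.add_mem _ hφ₁ hm
  rw [← sub_add_cancel i 1, ← hflip] at hmem
  obtain ⟨ψ₀, hψ₀, hψ₀s⟩ := exists_signedSurgery_split hA (fun s => hs s _) hmem (by
    rw [map_add, signedSurgery_partialDiff hA hc, hχd, add_neg_cancel])
  have hm₀ := partialDiff_mem_redSupp hA hψ₀
  rw [sub_add_cancel, add_sub_cancel_right] at hm₀
  -- Applying the injective σ gives σφ₀ + dσψ₀ = σφ₀ + dφ₁ = 0.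
  have hφ₀ψ₀ : φ₀ - D.partialDiff k F ψ₀ = 0 := by
    refine eq_zero_of_signedSurgery_split hA (fun s => hs s _) (Submodule.sub_mem _ hφ₀ hm₀) ?_
    rw [map_sub, signedSurgery_partialDiff hA hc, hψ₀s, map_add, partialDiff_partialDiff hA,
      add_zero, sub_neg_eq_add, add_comm, hd₁]
  refine ⟨ψ₀ - χ₁, Submodule.sub_mem _ (redSupp_update_le hc hψ₀) (redSupp_update_le hc hχ₁), ?_⟩
  rw [map_sub, partialDiff_insert_false hA hc hψ₀, partialDiff_insert_true hA hc hχ₁, hψ₀s,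
    ← sub_eq_zero.1 hφ₀ψ₀]
  abel

/-- The case of a crossing at which changing the smoothing always merges some circle with the
circle through the base point. -/
theorem reducedThin_insert_of_merge
    (hs : ∀ s i, subcube F (Function.update T c true) i s →
      D.circ s (D.fst c) (D.snd c) ∧ D.circ s b (D.fst c))
    (h₁ : ReducedThin D k b n₁ F (Function.update T c true)) :
    ReducedThin D k b n₁ (insert c F) T := by
  intro i l hl φ hφ hd
  obtain ⟨φ₀, hφ₀, φ₁, hφ₁, rfl⟩ := exists_add_eq hc hφ
  obtain ⟨hd₀, hd₁⟩ := partialDiff_eq_zero_split hA hc hφ₀ hφ₁ hd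
  have hflip : ∀ j, (fun s : KauffmanState n => subcube F (Function.update T c true) j (s.flip c)) =
      subcube F (Function.update T c false) (j - 1) := fun j =>
    funext fun s => propext (by rw [← subcube_true_flip hc, sub_add_cancel])
  -- Write d for `partialDiff` over `F` and σ for `signedSurgery`. Merging is onto, so φ₁ = σψ₀;
  -- then φ₀ - dψ₀ is killed by σ and hence is σχ for some χ of the `1`-half.
  obtain ⟨ψ₀, hψ₀, rfl⟩ := exists_signedSurgery_merge hA (fun s => hs s _) hφ₁
  rw [hflip] at hψ₀
  have hm₀ := partialDiff_mem_redSupp hA hψ₀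
  rw [sub_add_cancel, add_sub_cancel_right] at hm₀
  have hmem := Submodule.sub_mem _ hφ₀ hm₀
  rw [← add_sub_cancel_right i 1, ← hflip] at hmem
  obtain ⟨χ, hχ, hχs⟩ := exists_signedSurgery_split hA (fun s => hs s _) hmem (by
    rw [map_sub, signedSurgery_partialDiff hA hc, sub_neg_eq_add, add_comm, hd₁])
  -- χ is a cycle because σ is injective on the `1`-half. Its bidegree is moved parallel to the
  -- diagonal, so χ = dω, and -σω corrects ψ₀.
  obtain ⟨ω, hω, rfl⟩ := h₁ (i + 1) (l + 1) (by omega) χ hχ (by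
    refine eq_zero_of_signedSurgery_split hA (fun s => hs s _) (partialDiff_mem_redSupp hA hχ) ?_
    rw [signedSurgery_partialDiff hA hc, hχs, map_sub, hd₀, partialDiff_partialDiff hA, sub_zero,
      neg_zero])
  rw [add_sub_cancel_right] at hω
  have hη := signedSurgery_mem_false hA hc hω
  rw [add_sub_cancel_right] at hη
  refine ⟨ψ₀ - D.signedSurgery k c ω,
    Submodule.sub_mem _ (redSupp_update_le hc hψ₀) (redSupp_update_le hc hη), ?_⟩
  rw [map_sub, partialDiff_insert_false hA hc hψ₀, partialDiff_insert_false hA hc hη,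
    signedSurgery_signedSurgery_split hA (fun s => hs s _) hω, add_zero, sub_eq_add_neg,
    ← signedSurgery_partialDiff hA hc, hχs]
  abel

end Step

theorem subcube_congr {T' : KauffmanState n} (h : ∀ c ∉ F, T' c = T c) :
    subcube F T' i = subcube F T i := by
  funext s
  refine propext (and_congr_left fun _ => forall₂_congr fun c hc => ?_)
  rw [h c hc]

theorem ReducedThin.congr {T' : KauffmanState n} {n₁ : ℤ} (h : ReducedThin D k b n₁ F T')
    (hT : ∀ c ∉ F, T' c = T c) : ReducedThin D k b n₁ F T := by
  intro i l
  rw [← subcube_congr hT, ← subcube_congr hT]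
  exact h i l

/-- Induction over subcubes containing a spanning tree. Membership of `T` guarantees that at least
one half at `c` contains one; if the other half does not, basis exchange makes every surgery at `c`
of the same kind. -/
theorem reducedThin (hA : D.IsAlternating) (hK : D.IsKnot) (b : D.Point) {n₁ : ℕ}
    (hn₁ : ∀ S ∈ D.oneCircleStates, S.oneCount = n₁) (F : Finset (Fin n)) :
    ∀ T ∈ D.oneCircleStates, ReducedThin D k b n₁ F T := by
  induction hm : F.card generalizing F with
  | zero =>
    intro T hT
    rw [Finset.card_eq_zero.1 hm, ← hn₁ T hT]
    exact reducedThin_empty hT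
  | succ m ih =>
    intro T hT
    obtain ⟨c, hcF, hbase⟩ := exists_forall_circ hA hK
      (Finset.card_pos.1 (by rw [hm]; exact Nat.succ_pos m)) hT b
    obtain ⟨F, hc, rfl⟩ : ∃ F', c ∉ F' ∧ insert c F' = F :=
      ⟨F.erase c, Finset.notMem_erase c F, Finset.insert_erase hcF⟩
    have hm' : F.card = m := by
      rw [Finset.card_insert_of_notMem hc] at hm
      omega
    have hagree : ∀ (β : Bool) (T' : KauffmanState n), (∀ d ∉ insert c F, T' d = T d) → T' c = β →
        ∀ d ∉ F, T' d = Function.update T c β d := by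
      intro β T' h h' d hd
      by_cases hdc : d = c
      · rw [hdc, h', Function.update_self]
      · rw [h d (by simp [hd, hdc]), Function.update_of_ne hdc]
    have hthin : ∀ (β : Bool) (T' : KauffmanState n), T' ∈ D.oneCircleStates →
        (∀ d ∉ insert c F, T' d = T d) → T' c = β →
          ReducedThin D k b n₁ F (Function.update T c β) :=
      fun β T' hT' h h' => (ih F hm' T' hT').congr (hagree β T' h h')
    -- The crossing `c` meets the circle through `b` in all states of the subcube; if the arcs at
    -- `c` share a circle, it is this one.
    have hbase' : ∀ (β : Bool) s i, subcube F (Function.update T c β) i s →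
        D.circ s (D.fst c) (D.snd c) → D.circ s b (D.fst c) := by
      intro β s i hs hcs
      rcases hbase s ((subcube_update_iff hc).1 hs).1.1 with h | h
      exacts [h, (D.circ s).trans h ((D.circ s).symm hcs)]
    by_cases h₀ : ∃ T' ∈ D.oneCircleStates, (∀ d ∉ insert c F, T' d = T d) ∧ T' c = false <;>
      by_cases h₁ : ∃ T' ∈ D.oneCircleStates, (∀ d ∉ insert c F, T' d = T d) ∧ T' c = true
    · obtain ⟨T₀, hT₀, hT₀', hT₀c⟩ := h₀
      obtain ⟨T₁, hT₁, hT₁', hT₁c⟩ := h₁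
      exact reducedThin_insert hA hc (hthin false T₀ hT₀ hT₀' hT₀c) (hthin true T₁ hT₁ hT₁' hT₁c)
    · obtain ⟨T₀, hT₀, hT₀', hT₀c⟩ := h₀
      refine reducedThin_insert_of_split hA hc (fun s i hs => ?_) (hthin false T₀ hT₀ hT₀' hT₀c)
      have hcs : D.circ s (D.fst c) (D.snd c) := by
        refine circ_of_forall_notMem hA hK hT₀ hT₀c (F := F) ?_ ?_ ((subcube_update_iff hc).1 hs).2
        · intro T' h h' hT'
          refine h₁ ⟨T', hT', fun d hd => ?_, h'⟩
          rw [← hT₀' d hd]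
          rw [Finset.mem_insert, not_or] at hd
          exact h d hd.2 hd.1
        · intro d hd
          rw [hs.1 d hd, hagree false T₀ hT₀' hT₀c d hd]
      exact ⟨hcs, hbase' _ _ _ hs hcs⟩
    · obtain ⟨T₁, hT₁, hT₁', hT₁c⟩ := h₁
      refine reducedThin_insert_of_merge hA hc (fun s i hs => ?_) (hthin true T₁ hT₁ hT₁' hT₁c)
      have hsc := ((subcube_update_iff hc).1 hs).2
      have hcs : D.circ s (D.fst c) (D.snd c) := by
        -- The state `s` has a `1`-smoothing at `c`; the merge is seen from the `0`-side, at `s.flip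
        -- c`.
        have := not_circ_of_forall_notMem hA hK hT₁ hT₁c (F := F) (s := s.flip c) ?_ ?_ ?_
        · rwa [← hA.circ_flip_iff, KauffmanState.flip_flip] at this
        · intro T' h h' hT'
          refine h₀ ⟨T', hT', fun d hd => ?_, h'⟩
          rw [← hT₁' d hd]
          rw [Finset.mem_insert, not_or] at hd
          exact h d hd.2 hd.1
        · intro d hd hdc
          rw [KauffmanState.flip_apply_of_ne _ hdc, hs.1 d hd, hagree true T₁ hT₁' hT₁c d hd]
        · rw [KauffmanState.flip_apply_self, hsc, Bool.not_true]
      exact ⟨hcs, hbase' _ _ _ hs hcs⟩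
    · exfalso
      cases hTc : T c
      · exact h₀ ⟨T, hT, fun _ _ => rfl, hTc⟩
      · exact h₁ ⟨T, hT, fun _ _ => rfl, hTc⟩

end LinkDiagram

/-! ### Thinness of the Khovanov homology -/

namespace LinkDiagram

open EnhancedState

variable {n : ℕ} {D : LinkDiagram n} {k : Type} [CommRing k] {T : KauffmanState n} {i j l : ℤ}
  {b : D.Point} {φ : D.EnhancedState → k} {F : Finset (Fin n)}

theorem labelSum_upd (y : D.EnhancedState) (z : D.Point) (u : ℤˣ) :
    labelSum (y.upd z u) + (y.val z : ℤ) = labelSum y + u := by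
  change ∑ a, ((Function.update y.2 (D.pt y.1 z) u a : ℤˣ) : ℤ) + (y.2 (D.pt y.1 z) : ℤ) =
    ∑ a, (y.2 a : ℤ) + u
  rw [← Finset.add_sum_erase _ _ (Finset.mem_univ (D.pt y.1 z)),
    ← Finset.add_sum_erase _ (fun a => (y.2 a : ℤ)) (Finset.mem_univ (D.pt y.1 z)),
    Function.update_self, Finset.sum_congr rfl fun a ha => by
      rw [Function.update_of_ne (Finset.ne_of_mem_erase ha)]]
  ring

theorem mulX_mem_redSupp {Q : KauffmanState n → Prop} (h : φ ∈ D.degSupp k Q l) :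
    D.mulX k b φ ∈ D.redSupp k Q (l - 2) b := by
  refine mem_redSupp.2 fun y hy => ?_
  rw [mulX_apply]
  split_ifs with hb
  · refine mem_degSupp.1 h _ fun h' => hy ⟨h'.1, ?_, hb⟩
    have := labelSum_upd y b 1
    rw [h'.2, hb] at this
    push_cast at this
    omega
  · rfl

/-- A preimage is obtained by changing the base label to `v_1`. So `mulX` exhibits the full complex
as an extension of the reduced complex by a copy of it shifted by `2` in label degree. -/
theorem exists_mulX_eq {Q : KauffmanState n → Prop} (h : φ ∈ D.redSupp k Q l b) :
    ∃ χ ∈ D.degSupp k Q (l + 2), D.mulX k b χ = φ := by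
  refine ⟨fun y => if y.val b = 1 then φ (y.upd b (-1)) else 0, fun y hy => ?_, ?_⟩
  · dsimp only
    split_ifs with hb
    · refine mem_redSupp.1 h _ fun h' => hy ⟨h'.1, ?_⟩
      have := labelSum_upd y b (-1)
      rw [h'.2.1, hb] at this
      push_cast at this
      omega
    · rfl
  · funext y
    rw [mulX_apply, val_upd_self, if_pos rfl, upd_upd]
    split_ifs with hb
    · rw [← hb, upd_val]
    · exact (mem_redSupp.1 h y fun h' => hb h'.2.2).symm

/-- Off two diagonals, every cycle of the Khovanov complex of an alternating knot diagram is a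
boundary, over every ring of coefficients. -/
theorem exists_partialDiff_eq (hA : D.IsAlternating) {n₁ : ℤ} (b : D.Point)
    (hT : ReducedThin D k b n₁ F T) (h₁ : l ≠ i - n₁ - 1) (h₂ : l ≠ i - n₁ + 1)
    (hφ : φ ∈ D.degSupp k (subcube F T i) l) (hd : D.partialDiff k F φ = 0) :
    ∃ ψ ∈ D.degSupp k (subcube F T (i - 1)) (l + 1), D.partialDiff k F ψ = φ := by
  obtain ⟨ψ, hψ, hψd⟩ := hT i (l - 2) (by omega) (D.mulX k b φ) (mulX_mem_redSupp hφ) (by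
    rw [partialDiff_mulX hA, hd, map_zero])
  obtain ⟨χ, hχ, rfl⟩ := exists_mulX_eq hψ
  rw [show l - 2 + 1 + 2 = l + 1 by ring] at hχ
  have hχd := partialDiff_mem_degSupp hA hχ
  rw [sub_add_cancel, add_sub_cancel_right] at hχd
  -- The difference is killed by `mulX`, hence is a reduced cycle. The first use of `hT`, at `l -
  -- 2`, excluded the upper diagonal; this one excludes the lower.
  obtain ⟨ω, hω, hωd⟩ := hT i l h₁ (φ - D.partialDiff k F χ)
    ⟨Submodule.sub_mem _ hφ hχd, by
      change D.mulX k b _ = 0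
      rw [map_sub, ← partialDiff_mulX hA, hψd, sub_self]⟩
    (by rw [map_sub, hd, partialDiff_partialDiff hA, sub_self])
  exact ⟨χ + ω, Submodule.add_mem _ hχ (redSupp_le_degSupp hω), by
    rw [map_add, hωd, add_sub_cancel]⟩

/-! ### Comparison with the complex of bigraded chains -/

theorem eq_update_true_iff {s t : KauffmanState n} {c : Fin n} :
    (s c = false ∧ t = Function.update s c true) ↔ (t = s.flip c ∧ t c = true) := by
  constructor
  · rintro ⟨h, rfl⟩
    rw [KauffmanState.flip, h]
    exact ⟨rfl, Function.update_self _ _ _⟩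
  · rintro ⟨rfl, h⟩
    rw [KauffmanState.flip_apply_self, Bool.not_eq_true'] at h
    rw [KauffmanState.flip, h]
    exact ⟨rfl, rfl⟩

theorem diffCoeff_eq (x y : D.EnhancedState) : D.diffCoeff x y =
    ∑ c, (if y.1 c = true then 1 else 0) * (crossingSign ℤ c y.1 * flipCoeff c x y) := by
  classical
  refine Finset.sum_congr rfl fun c _ => ?_
  by_cases h : y.1 = x.1.flip c
  · by_cases hc : y.1 c = true
    · rw [if_pos (eq_update_true_iff.2 ⟨h, hc⟩), if_pos hc, one_mul, h,
        crossingSign_flip_of_not_lt (lt_irrefl c), flipCoeff, if_pos h, crossingSign]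
    · rw [if_neg fun h' => hc (eq_update_true_iff.1 h').2, if_neg hc, zero_mul]
  · rw [if_neg fun h' => h (eq_update_true_iff.1 h').1, flipCoeff_of_ne h, mul_zero, mul_zero]

theorem partialDiff_univ_apply (φ : D.EnhancedState → k) (y : D.EnhancedState) :
    D.partialDiff k Finset.univ φ y = ∑ x, (D.diffCoeff x y : k) * φ x := by
  simp only [partialDiff_apply, Finset.sum_apply, edgeMap_apply, signedSurgery_apply,
    mulState_apply, surgery_apply, diffCoeff_eq, Int.cast_sum, Finset.sum_mul, Finset.mul_sum]
  rw [Finset.sum_comm]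
  refine Finset.sum_congr rfl fun x _ => Finset.sum_congr rfl fun c _ => ?_
  rw [crossingSign, crossingSign]
  push_cast
  ring

/-- The matrix of the differential is integral, so it commutes with change of coefficients. -/
theorem partialDiff_univ_map {k' : Type} [CommRing k'] (f : k →+* k') (φ : D.EnhancedState → k) :
    D.partialDiff k' Finset.univ (f ∘ φ) = f ∘ D.partialDiff k Finset.univ φ := by
  funext y
  simp [partialDiff_univ_apply]

/-- The chains of bidegree `(i, j)` as functions on all enhanced states. -/
noncomputable def chainExtend (D : LinkDiagram n) (i j : ℤ) :
    D.Chain i j →ₗ[ℤ] (D.EnhancedState → ℤ) :=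
  Function.ExtendByZero.linearMap ℤ Subtype.val

theorem chainExtend_apply (φ : D.Chain i j) (x : D.Generator i j) :
    D.chainExtend i j φ x = φ x :=
  Subtype.val_injective.extend_apply _ _ _

theorem chainExtend_of_not (φ : D.Chain i j) {y : D.EnhancedState}
    (hy : ¬ (D.primaryDegree y = i ∧ D.secondaryDegree y = j)) : D.chainExtend i j φ y = 0 := by
  refine Function.extend_apply' _ _ _ ?_
  rintro ⟨x, rfl⟩
  exact hy x.2

theorem chainExtend_injective : Function.Injective (D.chainExtend i j) := fun φ φ' h =>
  funext fun x => by rw [← chainExtend_apply φ, h, chainExtend_apply]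

/-- With every crossing free `T` plays no role, and the label sum is the secondary degree minus the
number of `1`-smoothings. -/
theorem range_chainExtend (T : KauffmanState n) : LinearMap.range (D.chainExtend i j) =
    D.degSupp ℤ (subcube Finset.univ T i) (j - i) := by
  have hdeg : ∀ x : D.EnhancedState, (D.primaryDegree x = i ∧ D.secondaryDegree x = j) ↔
      (subcube Finset.univ T i x.1 ∧ labelSum x = j - i) := fun x => by
    have h1 : D.secondaryDegree x = labelSum x + x.1.oneCount := rfl
    have h2 : D.primaryDegree x = x.1.oneCount := rfl
    rw [h1, h2, subcube]
    constructor
    · rintro ⟨h, h'⟩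
      exact ⟨⟨fun c hc => absurd (Finset.mem_univ c) hc, h⟩, by omega⟩
    · rintro ⟨⟨-, h⟩, h'⟩
      exact ⟨h, by omega⟩
  ext ψ
  constructor
  · rintro ⟨φ, rfl⟩ y hy
    exact chainExtend_of_not φ fun h => hy ((hdeg y).1 h)
  · intro h
    refine ⟨fun x => ψ x, funext fun y => ?_⟩
    by_cases hy : D.primaryDegree y = i ∧ D.secondaryDegree y = j
    · exact chainExtend_apply (fun x : D.Generator i j => ψ x) ⟨y, hy⟩
    · rw [mem_degSupp.1 h y fun h' => hy ((hdeg y).2 h')]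
      exact chainExtend_of_not _ hy

theorem chainExtend_mem (T : KauffmanState n) (φ : D.Chain i j) :
    D.chainExtend i j φ ∈ D.degSupp ℤ (subcube Finset.univ T i) (j - i) := by
  rw [← range_chainExtend]
  exact LinearMap.mem_range_self _ φ

theorem exists_chainExtend_eq {ψ : D.EnhancedState → ℤ}
    (h : ψ ∈ D.degSupp ℤ (subcube Finset.univ T i) (j - i)) : ∃ φ, D.chainExtend i j φ = ψ := by
  rwa [← range_chainExtend] at h

theorem chainExtend_differential (hA : D.IsAlternating) {i' : ℤ} (hi : i' = i + 1)
    (φ : D.Chain i j) : D.chainExtend i' j (D.differential i i' j φ) =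
      D.partialDiff ℤ Finset.univ (D.chainExtend i j φ) := by
  subst hi
  let T : KauffmanState n := fun _ => false
  have hmem := partialDiff_mem_degSupp hA (chainExtend_mem T φ)
  rw [sub_sub] at hmem
  obtain ⟨ψ, hψ⟩ := exists_chainExtend_eq hmem
  rw [← hψ]
  congr 1
  funext y
  rw [← chainExtend_apply ψ, hψ, partialDiff_univ_apply]
  change ∑ x : D.Generator i j, D.diffCoeff x.1 y.1 * φ x = _
  have h0 : ∀ x : D.EnhancedState, x ∉ Set.range (Subtype.val : D.Generator i j → _) →
      ((D.diffCoeff x y : ℤ) : ℤ) * D.chainExtend i j φ x = 0 := fun x hx => by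
    rw [show D.chainExtend i j φ x = 0 from
      chainExtend_of_not φ fun h => hx ⟨⟨x, h⟩, rfl⟩, mul_zero]
  exact Fintype.sum_of_injective Subtype.val Subtype.val_injective _ _ h0 fun x => by
    rw [chainExtend_apply, Int.cast_id]

/-! ### Vanishing and torsion of the homology groups -/

section Homology

variable (hA : D.IsAlternating) {n₁ : ℤ} (b : D.Point)
include hA

theorem mem_range_differential_of_thin (hT : ReducedThin D ℤ b n₁ Finset.univ T)
    (h₁ : j ≠ 2 * i - n₁ + 1) (h₂ : j ≠ 2 * i - n₁ - 1) {x : D.Chain i j}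
    (hx : D.differential i (i + 1) j x = 0) :
    x ∈ LinearMap.range (D.differential (i - 1) i j) := by
  obtain ⟨ψ, hψ, hψd⟩ := exists_partialDiff_eq hA b hT (l := j - i) (by omega) (by omega)
    (chainExtend_mem T x) (by rw [← chainExtend_differential hA rfl, hx, map_zero])
  rw [show j - i + 1 = j - (i - 1) by ring] at hψ
  obtain ⟨y, rfl⟩ := exists_chainExtend_eq hψ
  exact ⟨y, chainExtend_injective (by rw [chainExtend_differential hA (by omega), hψd])⟩

/-- A Bockstein argument: a chain bounded by m·x is a cycle modulo m in bidegree `(i - 1, j)`, which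
is off both diagonals, so thinness over ℤ/m applies. -/
theorem mem_range_differential_of_smul (hj : j = 2 * i - n₁ + 1) {x : D.Chain i j} {m : ℤ}
    (hm : m ≠ 0) (hT : ReducedThin D (ZMod m.natAbs) b n₁ Finset.univ T)
    (hx : m • x ∈ LinearMap.range (D.differential (i - 1) i j)) :
    x ∈ LinearMap.range (D.differential (i - 1) i j) := by
  obtain ⟨y, hy⟩ := hx
  have hcast : ∀ a : ℤ, (a : ZMod m.natAbs) = 0 ↔ m ∣ a := fun a => by
    rw [CharP.intCast_eq_zero_iff (ZMod m.natAbs) m.natAbs, Int.natAbs_dvd]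
  have hyd : D.partialDiff ℤ Finset.univ (D.chainExtend (i - 1) j y) =
      m • D.chainExtend i j x := by
    rw [← chainExtend_differential hA (sub_add_cancel i 1).symm, hy, map_smul]
  have hmem := chainExtend_mem T y
  obtain ⟨ψ, hψ, hψd⟩ := exists_partialDiff_eq hA b hT (i := i - 1) (l := j - (i - 1))
    (φ := Int.castRingHom (ZMod m.natAbs) ∘ D.chainExtend (i - 1) j y) (by omega) (by omega)
    (fun z hz => by rw [Function.comp_apply, mem_degSupp.1 hmem z hz, map_zero])
    (by
      rw [partialDiff_univ_map, hyd]
      exact funext fun z => (hcast _).2 (dvd_mul_right m _))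
  have hlift : Int.castRingHom (ZMod m.natAbs) ∘ (fun z => ((ψ z).cast : ℤ)) = ψ :=
    funext fun z => ZMod.intCast_zmod_cast _
  -- The lift sends zero to zero, so it keeps the support.
  have hliftmem : (fun z => ((ψ z).cast : ℤ)) ∈
      D.degSupp ℤ (subcube Finset.univ T (i - 1 - 1)) (j - (i - 1) + 1) :=
    fun z hz => (congrArg ZMod.cast (mem_degSupp.1 hψ z hz)).trans ZMod.cast_zero
  rw [← hlift, partialDiff_univ_map] at hψd
  generalize (fun z => ((ψ z).cast : ℤ)) = Ψ at hψd hliftmem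
  have hdmem := partialDiff_mem_degSupp hA hliftmem
  rw [sub_add_cancel, add_sub_cancel_right] at hdmem
  have hdvd : ∀ z, m ∣ D.chainExtend (i - 1) j y z - D.partialDiff ℤ Finset.univ Ψ z := fun z => by
    rw [← hcast, Int.cast_sub, sub_eq_zero]
    exact (congrFun hψd z).symm
  -- The quotient w of y - dΨ by m satisfies m·dw = dy = m·x, and m is cancelled because the chains
  -- are torsion-free.
  choose w hw using hdvd
  obtain ⟨v, rfl⟩ := exists_chainExtend_eq (D := D) (ψ := w) (T := T) (i := i - 1) (j := j)
    fun z hz => (mul_eq_zero.1 ((hw z).symm.trans (by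
      rw [mem_degSupp.1 hmem z hz, mem_degSupp.1 hdmem z hz, sub_zero]))).resolve_left hm
  refine ⟨v, chainExtend_injective (smul_right_injective _ hm ?_)⟩
  have hw' : m • D.chainExtend (i - 1) j v =
      D.chainExtend (i - 1) j y - D.partialDiff ℤ Finset.univ Ψ := funext fun z => (hw z).symm
  dsimp only
  rw [← hyd, chainExtend_differential hA (sub_add_cancel i 1).symm, ← map_smul, hw', map_sub,
    partialDiff_partialDiff hA, sub_zero]

theorem subsingleton_homology_of_thin (hT : ReducedThin D ℤ b n₁ Finset.univ T)
    (h₁ : j ≠ 2 * i - n₁ + 1) (h₂ : j ≠ 2 * i - n₁ - 1) : Subsingleton (D.Homology i j) := by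
  rw [Submodule.Quotient.subsingleton_iff, eq_top_iff]
  exact fun x _ => mem_range_differential_of_thin hA b hT h₁ h₂ x.2

theorem isTorsionFree_homology_of_thin
    (hT : ∀ (k : Type) [CommRing k], ReducedThin D k b n₁ Finset.univ T)
    (h : j ≠ 2 * i - n₁ - 1) : Module.IsTorsionFree ℤ (D.Homology i j) := by
  by_cases h₁ : j = 2 * i - n₁ + 1
  · refine ⟨fun m hm => (isSMulRegular_iff_right_eq_zero_of_smul).2 fun q hq => ?_⟩
    induction q using Submodule.Quotient.induction_on with
    | H x =>
      rw [← Submodule.Quotient.mk_smul, Submodule.Quotient.mk_eq_zero] at hq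
      rw [Submodule.Quotient.mk_eq_zero]
      exact mem_range_differential_of_smul hA b h₁ hm.ne_zero (hT _) hq
  · have := subsingleton_homology_of_thin hA b (hT ℤ) h₁ h
    infer_instance

end Homology

end LinkDiagram

theorem theorem3p1 {n : ℕ} (D : LinkDiagram n) (hK : D.IsKnot) (hA : D.IsAlternating) :
    ∃ n₁ : ℕ,
      D.oneCircleStates.Nonempty ∧
      (∀ S ∈ D.oneCircleStates, S.oneCount = n₁) ∧
      (∀ i j : ℤ, j ≠ 2 * i - (n₁ : ℤ) + 1 → j ≠ 2 * i - (n₁ : ℤ) - 1 →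
        Subsingleton (D.Homology i j)) ∧
      (∀ i j : ℤ, j ≠ 2 * i - (n₁ : ℤ) - 1 → Module.IsTorsionFree ℤ (D.Homology i j)) := by
  have hne := LinkDiagram.oneCircleStates_nonempty hA hK
  obtain ⟨T, hT⟩ := hne
  obtain ⟨b⟩ := hK.nonempty_point
  have hn₁ : ∀ S ∈ D.oneCircleStates, S.oneCount = T.oneCount := fun S hS => by
    have h := (LinkDiagram.mem_oneCircleStates_iff hA hK).1 hT
    have h' := (LinkDiagram.mem_oneCircleStates_iff hA hK).1 hS
    -- All spanning trees have one edge fewer than the graph has vertices.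
    exact Nat.succ_injective (h'.2.trans h.2.symm)
  have hthin : ∀ (k : Type) [CommRing k],
      LinkDiagram.ReducedThin D k b T.oneCount Finset.univ T :=
    fun k _ => LinkDiagram.reducedThin hA hK b hn₁ Finset.univ T hT
  exact ⟨T.oneCount, ⟨T, hT⟩, hn₁,
    fun i j h₁ h₂ => LinkDiagram.subsingleton_homology_of_thin hA b (hthin ℤ) h₁ h₂,
    fun i j h => LinkDiagram.isTorsionFree_homology_of_thin hA b hthin h⟩
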